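/- **SL-MIMO system.** Let $N_t,N_r$ be the numbers of transmit and receive antennas, $n=\min(N_t,N_r)$, and let $\mathbf H\in\mathbb C^{N_r\times N_t}$ have i.i.d. $\mathcal{CN}(0,1)$ entries, with singular value decomposition $\mathbf H=\mathbf U\boldsymbol\Sigma\mathbf V^H$, where $\boldsymbol\Sigma$ has diagonal entries $\sqrt{\lambda_1}\ge\dots\ge\sqrt{\lambda_n}\ge 0$. Write $\bar{\mathbf U},\bar{\mathbf V}$ for the first $n$ columns of $\mathbf U,\mathbf V$ and $\boldsymbol\Lambda=\operatorname{diag}(\lambda_1,\dots,\lambda_n)$. There are $L\ge 1$ layers; layer $l$ uses a set $\mathcal N_l\subseteq\{1,\dots,n\}$ of eigen-channels and has a codebook $\mathcal S_l\subset\mathbb C^n$ of $M\ge 2$ distinct codewords whose entries outside $\mathcal N_l$ vanish. The sparse-layering matrix $\mathbf A\in\{0,1\}^{n\times L}$ has $a_{m,l}=1$ iff $m\in\mathcal N_l$. The codewords $\mathbf s_l\in\mathcal S_l$ are chosen independently and uniformly; the data symbol vector is $\mathbf s=\sum_{l=1}^L\mathbf s_l$, and $\mathcal S$ is the set of all such vectors.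 The codebooks satisfy the design condition: for any $\mathbf s^{(1)}=\sum_l\mathbf s^{(1)}_l$, $\mathbf s^{(2)}=\sum_l\mathbf s^{(2)}_l$ and any $m$, one has $s^{(1)}_m\ne s^{(2)}_m$ if and only if $\mathbf s^{(1)}_l\neq\mathbf s^{(2)}_l$ for at least one layer $l$ with $m\in\mathcal N_l$. The transmitter sends $\mathbf x=\bar{\mathbf V}\mathbf s$, the receiver observes $\mathbf y=\mathbf H\mathbf x+\mathbf n$ with $\mathbf n\sim\mathcal{CN}(0,N_0\mathbf I_{N_r})$ independent of $\mathbf H$ and $\mathbf s$, forms $\mathbf z=\bar{\mathbf U}^H\mathbf y$, and decides by maximum likelihood, $\hat{\mathbf s}\in\arg\min_{\mathbf s'\in\mathcal S}\|\mathbf z-\boldsymbol\Lambda^{1/2}\mathbf s'\|^2$ (ties broken arbitrarily). Let $P_t=\mathbb E\|\mathbf s\|^2$, $\mathrm{SNR}=P_t/N_0$, and let $\mathrm{AWEP}(\mathrm{SNR})$ be the average word error probability $\Pr(\hat{\mathbf s}\ne\mathbf s)$, for a fixed code. The system has *diversity gain* $G_d$ if, for some coding gain $G_c>0$, $\mathrm{AWEP}(\mathrm{SNR})\sim(G_c\,\mathrm{SNR})^{-G_d}$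 as $\mathrm{SNR}\to\infty$ (the ratio of the two sides tends to $1$). **Proposition.** Let $N$ be the maximal number of leading zeros among the nonzero difference vectors $\mathbf s-\hat{\mathbf s}$, $\mathbf s,\hat{\mathbf s}\in\mathcal S$. Then $N$ is also the maximal number of leading zeros among the columns of $\mathbf A$, and the diversity gain of the SL-MIMO system is $$G_d=(N_r-N)(N_t-N).$$ -/

import Mathlib

open MeasureTheory ProbabilityTheory Filter Asymptotics
open scoped NNReal ENNReal Matrix

namespace SLMIMO

noncomputable section

/-- The circularly symmetric complex Gaussian law `CN(0, v)`: real and imaginary parts are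
independent real Gaussians of mean `0` and variance `v / 2`. -/
def complexGaussian (v : ℝ≥0) : Measure ℂ :=
  ((gaussianReal 0 (v / 2)).prod (gaussianReal 0 (v / 2))).map
    (fun p : ℝ × ℝ => (⟨p.1, p.2⟩ : ℂ))

/-- Law of the channel matrix: i.i.d. `CN(0, 1)` entries. -/
def channelLaw (Nr Nt : ℕ) : Measure (Fin Nr → Fin Nt → ℂ) :=
  Measure.pi fun _ => Measure.pi fun _ => complexGaussian 1

/-- Law `CN(0, N₀ I)` of the receiver noise. -/
def noiseLaw (Nr : ℕ) (N₀ : ℝ≥0) : Measure (Fin Nr → ℂ) :=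
  Measure.pi fun _ => complexGaussian N₀

/-- The rectangular matrix with `√λ₁, …, √λₙ`, `n = min (Nt, Nr)`, on its main diagonal and zeros
elsewhere. -/
def sigmaMatrix {Nr Nt : ℕ} (lam : Fin (min Nt Nr) → ℝ) : Matrix (Fin Nr) (Fin Nt) ℂ :=
  Matrix.of fun i j =>
    if h : (i : ℕ) = (j : ℕ) then
      ((Real.sqrt (lam ⟨i, lt_min (h ▸ j.isLt) i.isLt⟩) : ℝ) : ℂ)
    else 0

/-- A singular value decomposition `H = U Σ Vᴴ`, with `U`, `V` unitary and the squared singular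
values `lam` nonnegative and in decreasing order. -/
structure SVD {Nr Nt : ℕ} (H : Matrix (Fin Nr) (Fin Nt) ℂ) where
  U : Matrix (Fin Nr) (Fin Nr) ℂ
  V : Matrix (Fin Nt) (Fin Nt) ℂ
  lam : Fin (min Nt Nr) → ℝ
  unitary_U : U ∈ Matrix.unitaryGroup (Fin Nr) ℂ
  unitary_V : V ∈ Matrix.unitaryGroup (Fin Nt) ℂ
  lam_nonneg : ∀ m, 0 ≤ lam m
  lam_antitone : Antitone lam
  eq_mul : H = U * sigmaMatrix lam * Vᴴ

/-- The first `n` columns of `U`. -/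
def SVD.Ubar {Nr Nt : ℕ} {H : Matrix (Fin Nr) (Fin Nt) ℂ} (D : SVD H) :
    Matrix (Fin Nr) (Fin (min Nt Nr)) ℂ :=
  D.U.submatrix id (Fin.castLE (min_le_right Nt Nr))

/-- The first `n` columns of `V`. -/
def SVD.Vbar {Nr Nt : ℕ} {H : Matrix (Fin Nr) (Fin Nt) ℂ} (D : SVD H) :
    Matrix (Fin Nt) (Fin (min Nt Nr)) ℂ :=
  D.V.submatrix id (Fin.castLE (min_le_left Nt Nr))

/-- Number of leading zeros of a vector. -/
def leadingZeros {n : ℕ} {α : Type*} [Zero α] (v : Fin n → α) : ℕ :=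
  {m : Fin n | ∀ m' ≤ m, v m' = 0}.ncard

/-- A sparse layered code with `n` eigen-channels, `L` layers and codebooks of size `M`.
Layer `l` uses the eigen-channels in `pos l`, and `codebook l` lists its `M` distinct codewords. -/
structure Code (n L M : ℕ) where
  pos : Fin L → Finset (Fin n)
  codebook : Fin L → Fin M → Fin n → ℂ
  codebook_injective : ∀ l, Function.Injective (codebook l)
  /-- Codewords of layer `l` vanish off the eigen-channels used by that layer. -/
  sparse : ∀ l i m, m ∉ pos l → codebook l i m = 0
  /-- Two data symbol vectors differ in position `m` iff the chosen codewords differ in at least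
  one of the layers sharing eigen-channel `m`. -/
  design : ∀ (w w' : Fin L → Fin M) (m : Fin n),
    (∑ l, codebook l (w l)) m ≠ (∑ l, codebook l (w' l)) m ↔
      ∃ l, m ∈ pos l ∧ codebook l (w l) ≠ codebook l (w' l)

namespace Code

variable {n L M : ℕ} (C : Code n L M)

/-- The binary sparse layering matrix. -/
def slMatrix : Matrix (Fin n) (Fin L) ℕ :=
  Matrix.of fun m l => if m ∈ C.pos l then 1 else 0

/-- The data symbol vector of the message `w`: the sum of the codewords of the layers. -/
def symbol (w : Fin L → Fin M) : Fin n → ℂ := ∑ l, C.codebook l (w l)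

/-- The set of all data symbol vectors. -/
def symbols : Set (Fin n → ℂ) := Set.range C.symbol

/-- The set of all difference vectors. -/
def differences : Set (Fin n → ℂ) :=
  {ψ | ∃ s ∈ C.symbols, ∃ s' ∈ C.symbols, ψ = s - s'}

/-- Maximal number of leading zeros among the nonzero difference vectors. -/
def maxLeadingZeros : ℕ := sSup (leadingZeros '' {ψ ∈ C.differences | ψ ≠ 0})

/-- Average energy of the data symbol vector (uniform independent messages on the layers), which
is the total transmit power. -/
def power : ℝ := (∑ w : Fin L → Fin M, ∑ m, ‖C.symbol w m‖ ^ 2) / (M : ℝ) ^ L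

end Code

/-- The post-processed received vector `z = Ūᴴ y`, where `y = H x + η` and `x = V̄ s`. -/
def received {Nr Nt : ℕ} {H : Matrix (Fin Nr) (Fin Nt) ℂ} (D : SVD H)
    (s : Fin (min Nt Nr) → ℂ) (η : Fin Nr → ℂ) : Fin (min Nt Nr) → ℂ :=
  D.Ubarᴴ *ᵥ (H *ᵥ (D.Vbar *ᵥ s) + η)

/-- `‖z - Λ^{1/2} s‖²`. -/
def metric {n : ℕ} (lam : Fin n → ℝ) (z s : Fin n → ℂ) : ℝ :=
  ∑ m, ‖z m - ((Real.sqrt (lam m) : ℝ) : ℂ) * s m‖ ^ 2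

/-- `detect` is a maximum likelihood detector: knowing the channel `H` and the vector `z`, it
returns a data symbol vector that minimizes `‖z - Λ^{1/2} s‖²` (ties are broken arbitrarily). -/
def IsMLDetector {Nr Nt L M : ℕ} (C : Code (min Nt Nr) L M)
    (svd : ∀ H : Matrix (Fin Nr) (Fin Nt) ℂ, SVD H)
    (detect : Matrix (Fin Nr) (Fin Nt) ℂ → (Fin (min Nt Nr) → ℂ) → (Fin (min Nt Nr) → ℂ)) :
    Prop :=
  ∀ H z, detect H z ∈ C.symbols ∧
    ∀ s ∈ C.symbols, metric (svd H).lam z (detect H z) ≤ metric (svd H).lam z s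

/-- Average word error probability at noise level `N₀`: the probability, averaged over the
channel and over uniformly distributed messages, that the detected data symbol vector differs
from the transmitted one. -/
def awep {Nr Nt L M : ℕ} (C : Code (min Nt Nr) L M)
    (svd : ∀ H : Matrix (Fin Nr) (Fin Nt) ℂ, SVD H)
    (detect : Matrix (Fin Nr) (Fin Nt) ℂ → (Fin (min Nt Nr) → ℂ) → (Fin (min Nt Nr) → ℂ))
    (N₀ : ℝ≥0) : ℝ :=
  (∑ w : Fin L → Fin M,
    (∫⁻ h, noiseLaw Nr N₀
      {η | detect (Matrix.of h) (received (svd (Matrix.of h)) (C.symbol w) η) ≠ C.symbol w}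
      ∂(channelLaw Nr Nt)).toReal) / (M : ℝ) ^ L

/-- The error probability `P`, a function of the SNR, has diversity gain `d`: for some coding gain
`G > 0`, it is asymptotically equivalent to `(G · SNR) ^ (-d)` at high SNR. -/
def HasDiversityGain (P : ℝ → ℝ) (d : ℝ) : Prop :=
  ∃ G : ℝ, 0 < G ∧ P ~[atTop] fun snr => (G * snr) ^ (-d)

end

end SLMIMO

/-! Write `δ ^ 2` for the noise variance and index the squared singular values from `0`. Since the
noise law is unitarily invariant and ties are negligible, the word error probability given an almost
every channel is a function `errProb` of the ratios `λ_m / δ²` alone (`noiseLaw_detect_ne`). Any two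
symbol vectors differ at some position `m ≤ N`, so a Chernoff bound makes `errProb` exponentially
small in `λ_N / δ²`. Errors thus come from channels with `λ_N` of order `δ²`, that is, at distance
of order `δ` from the matrices of rank at most `N`. These form a variety of real codimension `2ab`,
where `a = Nr - N` and `b = Nt - N`, which suggests the order `δ^(2ab) = N₀^(ab)`.

The exact asymptotics are obtained without the joint density of the singular values. Where an `N ×
N` block `A` is invertible, the rank `N` matrices with blocks `A, B, C, D` are the graph `D = C A⁻¹
B`. The substitution `D = C A⁻¹ B + δ T` has Jacobian `δ^(2ab)` (`exists_lintegral_eq_blowUp`). For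
fixed `A, B, C` and generic `T`, as `δ → 0` the ratio `λ_m / δ²` tends to infinity for `m < N`
(`tendsto_lam_div_atTop`) and to a positive limit for `m ≥ N` (`exists_tendsto_lam_div`), so
`errProb` converges (`exists_tendsto_errProb`).

The charts, one for each choice of the block `A`, are glued by a partition of unity built from
powers of the `N × N` minors. The same weights provide the domination: `minorWeight_mul_le` bounds
the weight times `‖T i j‖ ^ (2 s)` by a multiple of `(λ_N / δ²) ^ s`, and
`exists_pow_mul_errProb_le` absorbs that power. Dominated convergence gives a finite limit of the
rescaled error probability. The limit is positive because some pair of distinct symbol vectors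
agrees in the first `N` positions.

The equality of the two descriptions of `N` is combinatorial: by the design condition, the first
position where two symbol vectors differ is the smallest first position of a layer in which they
differ, so the worst case is reached by changing a single layer. -/

namespace SLMIMO

/-! ### Squared norms, rectangular diagonal matrices and quadratic forms of an SVD. -/

noncomputable section

/-- The squared Euclidean norm of a complex vector. -/
def nsq {ι : Type*} [Fintype ι] (x : ι → ℂ) : ℝ := ∑ i, ‖x i‖ ^ 2

section nsq

variable {ι κ : Type*} [Fintype ι] [Fintype κ]

lemma nsq_nonneg (x : ι → ℂ) : 0 ≤ nsq x := Finset.sum_nonneg fun _ _ => sq_nonneg _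

lemma nsq_eq_zero {x : ι → ℂ} : nsq x = 0 ↔ x = 0 := by
  unfold nsq
  rw [Finset.sum_eq_zero_iff_of_nonneg fun _ _ => sq_nonneg _]
  simp [funext_iff]

lemma nsq_pos {x : ι → ℂ} (hx : x ≠ 0) : 0 < nsq x :=
  lt_of_le_of_ne (nsq_nonneg x) fun h => hx (nsq_eq_zero.1 h.symm)

@[simp] lemma nsq_zero : nsq (0 : ι → ℂ) = 0 := nsq_eq_zero.2 rfl

lemma norm_sq_le_nsq (x : ι → ℂ) (i : ι) : ‖x i‖ ^ 2 ≤ nsq x :=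
  Finset.single_le_sum (f := fun i => ‖x i‖ ^ 2) (fun _ _ => sq_nonneg _) (Finset.mem_univ i)

lemma continuous_nsq : Continuous (nsq : (ι → ℂ) → ℝ) := by unfold nsq; fun_prop

lemma nsq_smul (c : ℂ) (x : ι → ℂ) : nsq (c • x) = ‖c‖ ^ 2 * nsq x := by
  simp [nsq, Finset.mul_sum, mul_pow]

lemma star_dotProduct_self (x : ι → ℂ) : star x ⬝ᵥ x = (nsq x : ℂ) := by
  simp only [dotProduct, nsq, Pi.star_apply, RCLike.star_def, Complex.conj_mul']
  push_cast
  rfl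

lemma nsq_mulVec_of_conjTranspose_mul [DecidableEq ι] {Q : Matrix κ ι ℂ} (hQ : Qᴴ * Q = 1)
    (x : ι → ℂ) : nsq (Q *ᵥ x) = nsq x := by
  have h : ((nsq (Q *ᵥ x) : ℝ) : ℂ) = nsq x := by
    rw [← star_dotProduct_self, ← star_dotProduct_self, Matrix.star_mulVec,
      ← Matrix.dotProduct_mulVec, Matrix.mulVec_mulVec, hQ, Matrix.one_mulVec]
  exact_mod_cast h

lemma nsq_unitary_mulVec [DecidableEq ι] {Q : Matrix ι ι ℂ} (hQ : Q ∈ Matrix.unitaryGroup ι ℂ)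
    (x : ι → ℂ) : nsq (Q *ᵥ x) = nsq x :=
  nsq_mulVec_of_conjTranspose_mul (Matrix.mem_unitaryGroup_iff'.1 hQ) x

lemma nsq_unitary_conjTranspose_mulVec [DecidableEq ι] {Q : Matrix ι ι ℂ}
    (hQ : Q ∈ Matrix.unitaryGroup ι ℂ) (x : ι → ℂ) : nsq (Qᴴ *ᵥ x) = nsq x :=
  nsq_mulVec_of_conjTranspose_mul
    (by rw [Matrix.conjTranspose_conjTranspose]; exact Matrix.mem_unitaryGroup_iff.1 hQ) x

/-- The sum of the absolute values of the entries of a matrix. -/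
def entrySum (E : Matrix ι κ ℂ) : ℝ := ∑ i, ∑ j, ‖E i j‖

lemma abs_re_quadratic_le (E : Matrix ι ι ℂ) (x : ι → ℂ) :
    |(star x ⬝ᵥ (E *ᵥ x)).re| ≤ entrySum E * nsq x := by
  refine (Complex.abs_re_le_norm _).trans ?_
  simp only [dotProduct, Matrix.mulVec, entrySum, Finset.sum_mul, Finset.mul_sum]
  refine (norm_sum_le _ _).trans (Finset.sum_le_sum fun i _ => ?_)
  refine (norm_sum_le _ _).trans (Finset.sum_le_sum fun j _ => ?_)
  rw [norm_mul, norm_mul, Pi.star_apply, norm_star]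
  have h1 := norm_sq_le_nsq x i
  have h2 := norm_sq_le_nsq x j
  have h3 : ‖x i‖ * ‖x j‖ ≤ nsq x := by nlinarith [sq_nonneg (‖x i‖ - ‖x j‖)]
  calc ‖x i‖ * (‖E i j‖ * ‖x j‖) = ‖E i j‖ * (‖x i‖ * ‖x j‖) := by ring
    _ ≤ _ := by gcongr

end nsq

/-- Extension of a vector by zeros. -/
def extend {α : Type*} [Zero α] {n : ℕ} (k : ℕ) (a : Fin n → α) : Fin k → α :=
  fun i => if h : (i : ℕ) < n then a ⟨i, h⟩ else 0

lemma sum_extend {α : Type*} [AddCommMonoid α] {n k : ℕ} (hnk : n ≤ k) (a : Fin n → α) :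
    ∑ i, extend k a i = ∑ m, a m := by
  symm
  refine Finset.sum_of_injOn (Fin.castLE hnk) (Fin.castLE_injective hnk).injOn (by simp)
    (fun i _ hi => ?_) (fun m _ => ?_)
  · unfold extend
    rw [dif_neg]
    intro h
    exact hi ⟨⟨i, h⟩, by simp, rfl⟩
  · simp [extend]

@[simp] lemma extend_castLE {α : Type*} [Zero α] {n k : ℕ} (hnk : n ≤ k) (a : Fin n → α)
    (m : Fin n) : extend k a (Fin.castLE hnk m) = a m := by simp [extend]

lemma extend_antitone {n k : ℕ} {a : Fin n → ℝ} (ha : Antitone a) (h0 : ∀ m, 0 ≤ a m) :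
    Antitone (extend k a) := by
  intro i j hij
  unfold extend
  split_ifs with h1 h2 h2
  · exact ha hij
  · exact absurd (lt_of_le_of_lt (Fin.le_def.1 hij) h1) h2
  · exact h0 _
  · exact le_rfl

section sigma

variable {Nr Nt : ℕ} (lam : Fin (min Nt Nr) → ℝ)

lemma sigmaMatrix_mulVec (y : Fin Nt → ℂ) :
    sigmaMatrix (Nr := Nr) lam *ᵥ y = extend Nr fun m =>
      ((Real.sqrt (lam m) : ℝ) : ℂ) * y (Fin.castLE (min_le_left Nt Nr) m) := by
  funext i
  simp only [Matrix.mulVec, dotProduct, sigmaMatrix, Matrix.of_apply, extend]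
  split_ifs with h
  · rw [Finset.sum_eq_single ⟨i, h.trans_le (min_le_left _ _)⟩]
    · rw [dif_pos rfl]; rfl
    · intro j _ hj
      rw [dif_neg, zero_mul]
      exact fun h' => hj (Fin.ext h'.symm)
    · simp
  · refine Finset.sum_eq_zero fun j _ => ?_
    rw [dif_neg, zero_mul]
    exact fun h' => h (lt_min (h' ▸ j.isLt) i.isLt)

lemma sigmaMatrix_conjTranspose_mulVec (y : Fin Nr → ℂ) :
    (sigmaMatrix (Nt := Nt) lam)ᴴ *ᵥ y = extend Nt fun m =>
      ((Real.sqrt (lam m) : ℝ) : ℂ) * y (Fin.castLE (min_le_right Nt Nr) m) := by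
  funext i
  simp only [Matrix.mulVec, dotProduct, sigmaMatrix, Matrix.of_apply, extend,
    Matrix.conjTranspose_apply]
  split_ifs with h
  · rw [Finset.sum_eq_single ⟨i, h.trans_le (min_le_right _ _)⟩]
    · rw [dif_pos rfl]; simp [Fin.castLE]
    · intro j _ hj
      rw [dif_neg, star_zero, zero_mul]
      exact fun h' => hj (Fin.ext h')
    · simp
  · refine Finset.sum_eq_zero fun j _ => ?_
    rw [dif_neg, star_zero, zero_mul]
    exact fun h' => h (lt_min i.isLt (h' ▸ j.isLt))

lemma nsq_extend {n k : ℕ} (hnk : n ≤ k) (a : Fin n → ℂ) : nsq (extend k a) = nsq a := by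
  unfold nsq
  rw [← sum_extend hnk]
  refine Finset.sum_congr rfl fun i _ => ?_
  unfold extend
  split_ifs <;> simp

variable {lam}

lemma nsq_sqrt_mul (h0 : ∀ m, 0 ≤ lam m) (y : Fin (min Nt Nr) → ℂ) :
    nsq (fun m => ((Real.sqrt (lam m) : ℝ) : ℂ) * y m) = ∑ m, lam m * ‖y m‖ ^ 2 := by
  unfold nsq
  refine Finset.sum_congr rfl fun m _ => ?_
  rw [norm_mul, mul_pow, Complex.norm_real, Real.norm_eq_abs, sq_abs, Real.sq_sqrt (h0 m)]

end sigma

namespace SVD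

variable {Nr Nt : ℕ} {H : Matrix (Fin Nr) (Fin Nt) ℂ} (D : SVD H)

lemma nsq_mulVec (x : Fin Nt → ℂ) : nsq (H *ᵥ x) =
    ∑ m, D.lam m * ‖(D.Vᴴ *ᵥ x) (Fin.castLE (min_le_left Nt Nr) m)‖ ^ 2 := by
  conv_lhs => rw [D.eq_mul]
  rw [← Matrix.mulVec_mulVec, ← Matrix.mulVec_mulVec, nsq_unitary_mulVec D.unitary_U,
    sigmaMatrix_mulVec, nsq_extend (min_le_right _ _), nsq_sqrt_mul D.lam_nonneg]

lemma nsq_conjTranspose_mulVec (y : Fin Nr → ℂ) : nsq (Hᴴ *ᵥ y) =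
    ∑ m, D.lam m * ‖(D.Uᴴ *ᵥ y) (Fin.castLE (min_le_right Nt Nr) m)‖ ^ 2 := by
  conv_lhs => rw [D.eq_mul]
  rw [Matrix.conjTranspose_mul, Matrix.conjTranspose_mul, Matrix.conjTranspose_conjTranspose,
    ← Matrix.mulVec_mulVec, ← Matrix.mulVec_mulVec, nsq_unitary_mulVec D.unitary_V,
    sigmaMatrix_conjTranspose_mulVec, nsq_extend (min_le_left _ _), nsq_sqrt_mul D.lam_nonneg]

end SVD

end

end SLMIMO
-- Min-max bounds for singular values and perturbation of eigenvalues.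
namespace SLMIMO

noncomputable section

/-- Weyl monotonicity by dimension count: asking that the coordinates before `m` in the second
eigenbasis and those after `m` in the first one vanish imposes `k - 1` linear conditions. On a
nonzero solution the first form is at least `a m * nsq x` and the second at most `a' m * nsq x`. -/
lemma antitone_le_add_of_quadratic_le {k : ℕ} {U U' : Matrix (Fin k) (Fin k) ℂ}
    (hU : U ∈ Matrix.unitaryGroup (Fin k) ℂ) (hU' : U' ∈ Matrix.unitaryGroup (Fin k) ℂ)
    {a a' : Fin k → ℝ} (ha : Antitone a) (ha' : Antitone a') {c : ℝ}
    (h : ∀ x, ∑ i, a i * ‖(Uᴴ *ᵥ x) i‖ ^ 2 ≤ ∑ i, a' i * ‖(U'ᴴ *ᵥ x) i‖ ^ 2 + c * nsq x)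
    (m : Fin k) : a m ≤ a' m + c := by
  let f : (Fin k → ℂ) →ₗ[ℂ] ({i : Fin k // i ≠ m} → ℂ) := LinearMap.pi fun i =>
    if i.1 < m then LinearMap.proj i.1 ∘ₗ U'ᴴ.mulVecLin else LinearMap.proj i.1 ∘ₗ Uᴴ.mulVecLin
  have hf : LinearMap.ker f ≠ ⊥ := by
    apply f.ker_ne_bot_of_finrank_lt
    simp only [Module.finrank_fintype_fun_eq_card, Fintype.card_fin, Fintype.card_subtype_compl,
      Fintype.card_subtype_eq]
    have := m.isLt
    omega
  obtain ⟨x, hx, hx0⟩ := (Submodule.ne_bot_iff _).1 hf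
  have hx1 : ∀ i, i < m → (U'ᴴ *ᵥ x) i = 0 := by
    intro i hi
    have := congrFun (LinearMap.mem_ker.1 hx) ⟨i, hi.ne⟩
    simpa [f, hi] using this
  have hx2 : ∀ i, m < i → (Uᴴ *ᵥ x) i = 0 := by
    intro i hi
    have := congrFun (LinearMap.mem_ker.1 hx) ⟨i, hi.ne'⟩
    simpa [f, not_lt.2 hi.le] using this
  have e1 : a m * nsq x ≤ ∑ i, a i * ‖(Uᴴ *ᵥ x) i‖ ^ 2 := by
    rw [← nsq_unitary_conjTranspose_mulVec hU x, nsq, Finset.mul_sum]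
    refine Finset.sum_le_sum fun i _ => ?_
    rcases lt_or_ge m i with hi | hi
    · simp [hx2 i hi]
    · exact mul_le_mul_of_nonneg_right (ha hi) (sq_nonneg _)
  have e2 : ∑ i, a' i * ‖(U'ᴴ *ᵥ x) i‖ ^ 2 ≤ a' m * nsq x := by
    rw [← nsq_unitary_conjTranspose_mulVec hU' x, nsq, Finset.mul_sum]
    refine Finset.sum_le_sum fun i _ => ?_
    rcases lt_or_ge i m with hi | hi
    · simp [hx1 i hi]
    · exact mul_le_mul_of_nonneg_right (ha' hi) (sq_nonneg _)
  have e3 := h x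
  have : a m * nsq x ≤ (a' m + c) * nsq x := by linarith
  exact le_of_mul_le_mul_right this (nsq_pos hx0)

lemma star_dotProduct_diagonal_mulVec {k : ℕ} (U : Matrix (Fin k) (Fin k) ℂ) (a : Fin k → ℝ)
    (x : Fin k → ℂ) :
    (star x ⬝ᵥ ((U * Matrix.diagonal (fun i => (a i : ℂ)) * Uᴴ) *ᵥ x)).re =
      ∑ i, a i * ‖(Uᴴ *ᵥ x) i‖ ^ 2 := by
  rw [← Matrix.mulVec_mulVec, ← Matrix.mulVec_mulVec, Matrix.dotProduct_mulVec,
    show star x ᵥ* U = star (Uᴴ *ᵥ x) by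
      rw [Matrix.star_mulVec, Matrix.conjTranspose_conjTranspose]]
  simp only [dotProduct, Matrix.mulVec_diagonal, Pi.star_apply, RCLike.star_def, Complex.re_sum]
  refine Finset.sum_congr rfl fun i _ => ?_
  rw [mul_left_comm, Complex.conj_mul', ← Complex.ofReal_pow, ← Complex.ofReal_mul,
    Complex.ofReal_re]

/-- Ordered eigenvalues of Hermitian matrices are Lipschitz functions of the matrix. -/
lemma abs_eigenvalue_sub_le {k : ℕ} {U U' : Matrix (Fin k) (Fin k) ℂ}
    (hU : U ∈ Matrix.unitaryGroup (Fin k) ℂ) (hU' : U' ∈ Matrix.unitaryGroup (Fin k) ℂ)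
    {a a' : Fin k → ℝ} (ha : Antitone a) (ha' : Antitone a') (m : Fin k) :
    |a m - a' m| ≤ entrySum (U * Matrix.diagonal (fun i => (a i : ℂ)) * Uᴴ -
      U' * Matrix.diagonal (fun i => (a' i : ℂ)) * U'ᴴ) := by
  set K := U * Matrix.diagonal (fun i => (a i : ℂ)) * Uᴴ
  set K' := U' * Matrix.diagonal (fun i => (a' i : ℂ)) * U'ᴴ
  have key : ∀ x, |∑ i, a i * ‖(Uᴴ *ᵥ x) i‖ ^ 2 - ∑ i, a' i * ‖(U'ᴴ *ᵥ x) i‖ ^ 2| ≤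
      entrySum (K - K') * nsq x := by
    intro x
    rw [← star_dotProduct_diagonal_mulVec, ← star_dotProduct_diagonal_mulVec, ← Complex.sub_re,
      ← dotProduct_sub, ← Matrix.sub_mulVec]
    exact abs_re_quadratic_le _ _
  rw [abs_le]
  constructor
  · have := antitone_le_add_of_quadratic_le hU' hU ha' ha (c := entrySum (K - K'))
      (fun x => by linarith [(abs_le.1 (key x)).1]) m
    linarith
  · have := antitone_le_add_of_quadratic_le hU hU' ha ha' (c := entrySum (K - K'))
      (fun x => by linarith [(abs_le.1 (key x)).2]) m
    linarith

namespace SVD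

variable {Nr Nt : ℕ} {H : Matrix (Fin Nr) (Fin Nt) ℂ} (D : SVD H)

/-- Courant–Fischer from below: `W` is too large to avoid the orthogonal complement of the first `m`
right singular vectors, where `nsq (H *ᵥ x)` is at most `D.lam m * nsq x`. -/
lemma le_lam (m : Fin (min Nt Nr)) (W : Submodule ℂ (Fin Nt → ℂ))
    (hW : (m : ℕ) < Module.finrank ℂ W) {c : ℝ} (h : ∀ x ∈ W, c * nsq x ≤ nsq (H *ᵥ x)) :
    c ≤ D.lam m := by
  let f : W →ₗ[ℂ] (Fin m → ℂ) := LinearMap.pi fun i =>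
    LinearMap.proj (Fin.castLE (m.isLt.le.trans (min_le_left _ _)) i) ∘ₗ D.Vᴴ.mulVecLin ∘ₗ W.subtype
  have hf : LinearMap.ker f ≠ ⊥ := by
    apply f.ker_ne_bot_of_finrank_lt
    simpa using hW
  obtain ⟨x, hx, hx0⟩ := (Submodule.ne_bot_iff _).1 hf
  have hx1 : ∀ i : Fin (min Nt Nr), i < m →
      (D.Vᴴ *ᵥ x.1) (Fin.castLE (min_le_left Nt Nr) i) = 0 := by
    intro i hi
    exact congrFun (LinearMap.mem_ker.1 hx) ⟨i, hi⟩
  have e1 : nsq (H *ᵥ x.1) ≤ D.lam m * nsq x.1 := by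
    rw [D.nsq_mulVec, ← nsq_unitary_conjTranspose_mulVec D.unitary_V x.1]
    calc _ ≤ ∑ i, D.lam m * ‖(D.Vᴴ *ᵥ x.1) (Fin.castLE (min_le_left Nt Nr) i)‖ ^ 2 := by
          refine Finset.sum_le_sum fun i _ => ?_
          rcases lt_or_ge i m with hi | hi
          · simp [hx1 i hi]
          · exact mul_le_mul_of_nonneg_right (D.lam_antitone hi) (sq_nonneg _)
      _ ≤ _ := by
          rw [← Finset.mul_sum]
          refine mul_le_mul_of_nonneg_left ?_ (D.lam_nonneg m)
          have := Finset.sum_map Finset.univ (Fin.castLEEmb (min_le_left Nt Nr))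
            fun i => ‖(D.Vᴴ *ᵥ x.1) i‖ ^ 2
          simp only [Fin.castLEEmb_apply] at this
          rw [← this]
          exact Finset.sum_le_univ_sum_of_nonneg fun _ => sq_nonneg _
  have e2 := h x.1 x.2
  exact le_of_mul_le_mul_right (e2.trans e1) (nsq_pos fun h => hx0 (Subtype.ext h))

/-- Courant–Fischer from above: by dimension, `W` meets the span of the first `m + 1` right singular
vectors nontrivially. -/
lemma lam_le (m : Fin (min Nt Nr)) (W : Submodule ℂ (Fin Nt → ℂ))
    (hW : Nt < Module.finrank ℂ W + m + 1) {c : ℝ} (h : ∀ x ∈ W, nsq (H *ᵥ x) ≤ c * nsq x) :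
    D.lam m ≤ c := by
  have hm : (m : ℕ) + 1 ≤ Nt := (Nat.succ_le_of_lt m.isLt).trans (min_le_left _ _)
  let f : W →ₗ[ℂ] (Fin (Nt - (m + 1)) → ℂ) := LinearMap.pi fun i =>
    LinearMap.proj (⟨m + 1 + i, by have := i.isLt; omega⟩ : Fin Nt) ∘ₗ D.Vᴴ.mulVecLin ∘ₗ W.subtype
  have hf : LinearMap.ker f ≠ ⊥ := by
    apply f.ker_ne_bot_of_finrank_lt
    simp only [Module.finrank_fintype_fun_eq_card, Fintype.card_fin]
    omega
  obtain ⟨x, hx, hx0⟩ := (Submodule.ne_bot_iff _).1 hf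
  have hx1 : ∀ i : Fin Nt, (m : ℕ) < i → (D.Vᴴ *ᵥ x.1) i = 0 := by
    intro i hi
    have := congrFun (LinearMap.mem_ker.1 hx) ⟨i - (m + 1), by have := i.isLt; omega⟩
    have e : (⟨m + 1 + (i - (m + 1)), by have := i.isLt; omega⟩ : Fin Nt) = i := by
      apply Fin.ext
      simp only
      omega
    simpa [f, e] using this
  have e1 : D.lam m * nsq x.1 ≤ nsq (H *ᵥ x.1) := by
    rw [D.nsq_mulVec, ← nsq_unitary_conjTranspose_mulVec D.unitary_V x.1, nsq, Finset.mul_sum]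
    calc _ = ∑ i : Fin Nt, extend Nt (fun i : Fin (min Nt Nr) =>
            D.lam m * ‖(D.Vᴴ *ᵥ x.1) (Fin.castLE (min_le_left Nt Nr) i)‖ ^ 2) i := by
          refine Finset.sum_congr rfl fun i _ => ?_
          unfold extend
          split_ifs with hi
          · rfl
          · rw [hx1 i (m.isLt.trans_le (not_lt.1 hi))]
            simp
      _ = ∑ i, D.lam m * ‖(D.Vᴴ *ᵥ x.1) (Fin.castLE (min_le_left Nt Nr) i)‖ ^ 2 :=
          sum_extend (min_le_left _ _) _
      _ ≤ _ := by
          refine Finset.sum_le_sum fun i _ => ?_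
          rcases lt_or_ge m i with hi | hi
          · rw [hx1 _ (by simpa using hi)]
            simp
          · exact mul_le_mul_of_nonneg_right (D.lam_antitone hi) (sq_nonneg _)
  have e2 := h x.1 x.2
  exact le_of_mul_le_mul_right (e1.trans e2) (nsq_pos fun h => hx0 (Subtype.ext h))

/-- Tested on the left singular vector of index `m`. This covers wide matrices: they have a kernel,
so no positive bound through `H` itself holds on the whole space. -/
lemma le_lam_of_conjTranspose (m : Fin (min Nt Nr)) {c : ℝ}
    (h : ∀ y, c * nsq y ≤ nsq (Hᴴ *ᵥ y)) : c ≤ D.lam m := by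
  have h1 := h (D.U *ᵥ Pi.single (Fin.castLE (min_le_right Nt Nr) m) 1)
  have e : D.Uᴴ * D.U = 1 := Matrix.mem_unitaryGroup_iff'.1 D.unitary_U
  rw [nsq_unitary_mulVec D.unitary_U, D.nsq_conjTranspose_mulVec, Matrix.mulVec_mulVec, e,
    Matrix.one_mulVec, Finset.sum_eq_single m] at h1
  · have e2 : nsq (Pi.single (Fin.castLE (min_le_right Nt Nr) m) 1 : Fin Nr → ℂ) = 1 := by
      rw [nsq, Finset.sum_eq_single (Fin.castLE (min_le_right Nt Nr) m)]
      · simp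
      · intro i _ hi
        simp [Pi.single_eq_of_ne hi]
      · simp
    simpa [e2] using h1
  · intro i _ hi
    rw [Pi.single_eq_of_ne fun h' => hi (Fin.castLE_injective _ h')]
    simp
  · simp

lemma mul_conjTranspose_eq : H * Hᴴ =
    D.U * Matrix.diagonal (fun i => ((extend Nr D.lam i : ℝ) : ℂ)) * D.Uᴴ := by
  have hS : sigmaMatrix (Nr := Nr) D.lam * (sigmaMatrix (Nr := Nr) D.lam)ᴴ =
      Matrix.diagonal (fun i => ((extend Nr D.lam i : ℝ) : ℂ)) := by
    refine Matrix.ext_of_mulVec_single fun i => ?_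
    rw [← Matrix.mulVec_mulVec, sigmaMatrix_conjTranspose_mulVec, sigmaMatrix_mulVec]
    funext j
    rw [Matrix.mulVec_diagonal]
    simp only [extend, Fin.val_castLE]
    split_ifs with h
    · rw [← mul_assoc, ← Complex.ofReal_mul, Real.mul_self_sqrt (D.lam_nonneg _)]
      rfl
    · simp
  have hV : D.Vᴴ * D.V = 1 := Matrix.mem_unitaryGroup_iff'.1 D.unitary_V
  conv_lhs => rw [D.eq_mul]
  rw [Matrix.conjTranspose_mul, Matrix.conjTranspose_mul, Matrix.conjTranspose_conjTranspose, ← hS]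
  calc _ = D.U * sigmaMatrix D.lam * (D.Vᴴ * D.V) * (sigmaMatrix D.lam)ᴴ * D.Uᴴ := by
        simp only [Matrix.mul_assoc]
    _ = _ := by rw [hV, Matrix.mul_one]; simp only [Matrix.mul_assoc]

lemma resolvent_eq {t : ℝ} (ht : 0 < t) : (1 + ((t⁻¹ : ℝ) : ℂ) • (H * Hᴴ))⁻¹ =
    D.U * Matrix.diagonal (fun i => (((1 + extend Nr D.lam i / t)⁻¹ : ℝ) : ℂ)) * D.Uᴴ := by
  have e : D.Uᴴ * D.U = 1 := Matrix.mem_unitaryGroup_iff'.1 D.unitary_U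
  have e' : D.U * D.Uᴴ = 1 := Matrix.mem_unitaryGroup_iff.1 D.unitary_U
  have h0 : ∀ i, 0 ≤ extend Nr D.lam i := by
    intro i
    unfold extend
    split_ifs
    · exact D.lam_nonneg _
    · exact le_rfl
  apply Matrix.inv_eq_right_inv
  have e1 : 1 + ((t⁻¹ : ℝ) : ℂ) • (H * Hᴴ) =
      D.U * Matrix.diagonal (fun i => ((1 + extend Nr D.lam i / t : ℝ) : ℂ)) * D.Uᴴ := by
    have : Matrix.diagonal (fun i => ((1 + extend Nr D.lam i / t : ℝ) : ℂ)) =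
        1 + ((t⁻¹ : ℝ) : ℂ) • Matrix.diagonal (fun i => ((extend Nr D.lam i : ℝ) : ℂ)) := by
      rw [← Matrix.diagonal_one, ← Matrix.diagonal_smul, Matrix.diagonal_add]
      congr 1
      funext i
      simp [div_eq_inv_mul]
    rw [this, D.mul_conjTranspose_eq, Matrix.mul_add, Matrix.add_mul, Matrix.mul_one, e',
      Matrix.mul_smul, Matrix.smul_mul]
  rw [e1]
  calc _ = D.U * Matrix.diagonal (fun i => ((1 + extend Nr D.lam i / t : ℝ) : ℂ)) *
        (D.Uᴴ * D.U) * Matrix.diagonal (fun i => (((1 + extend Nr D.lam i / t)⁻¹ : ℝ) : ℂ)) *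
        D.Uᴴ := by simp only [Matrix.mul_assoc]
    _ = 1 := by
      rw [e, Matrix.mul_one, Matrix.mul_assoc D.U, Matrix.diagonal_mul_diagonal]
      have : (fun i => ((1 + extend Nr D.lam i / t : ℝ) : ℂ) *
          (((1 + extend Nr D.lam i / t)⁻¹ : ℝ) : ℂ)) = fun _ => (1 : ℂ) := by
        funext i
        rw [← Complex.ofReal_mul, mul_inv_cancel₀, Complex.ofReal_one]
        have := div_nonneg (h0 i) ht.le
        positivity
      rw [this, Matrix.diagonal_one, Matrix.mul_one, e']

/-- Under the blow-up some of the ratios `λ_m / t` diverge, so the Lipschitz bound for eigenvalues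
is applied to the resolvents, whose eigenvalues stay in `[0, 1]`. -/
lemma abs_inv_one_add_lam_sub_le {H' : Matrix (Fin Nr) (Fin Nt) ℂ} (D' : SVD H') {t t' : ℝ}
    (ht : 0 < t) (ht' : 0 < t') (m : Fin (min Nt Nr)) :
    |(1 + D.lam m / t)⁻¹ - (1 + D'.lam m / t')⁻¹| ≤
      entrySum ((1 + ((t⁻¹ : ℝ) : ℂ) • (H * Hᴴ))⁻¹ - (1 + ((t'⁻¹ : ℝ) : ℂ) • (H' * H'ᴴ))⁻¹) := by
  -- Inversion reverses the order of the eigenvalues; the minus sign restores a decreasing family.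
  have mono : ∀ {H : Matrix (Fin Nr) (Fin Nt) ℂ} (D : SVD H) {t : ℝ}, 0 < t →
      Antitone fun i => -(1 + extend Nr D.lam i / t)⁻¹ := by
    intro H D t ht i j hij
    have h0 : 0 ≤ extend Nr D.lam j := by
      unfold extend
      split_ifs
      · exact D.lam_nonneg _
      · exact le_rfl
    have h1 := extend_antitone (k := Nr) D.lam_antitone D.lam_nonneg hij
    have h2 : extend Nr D.lam j / t ≤ extend Nr D.lam i / t := by gcongr
    have h3 : 0 ≤ extend Nr D.lam j / t := div_nonneg h0 ht.le
    simp only [neg_le_neg_iff]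
    gcongr
  have key := abs_eigenvalue_sub_le D.unitary_U D'.unitary_U (mono D ht) (mono D' ht')
    (Fin.castLE (min_le_right Nt Nr) m)
  rw [D.resolvent_eq ht, D'.resolvent_eq ht']
  simp only [extend_castLE, Complex.ofReal_neg] at key
  rw [abs_sub_comm]
  convert key using 1
  · congr 1
    ring
  · unfold entrySum
    refine Finset.sum_congr rfl fun i _ => Finset.sum_congr rfl fun j _ => ?_
    rw [← norm_neg]
    congr 1
    have hd : ∀ v : Fin Nr → ℂ, Matrix.diagonal (fun i => -v i) = -Matrix.diagonal v := fun v => by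
      rw [Matrix.diagonal_neg]
    simp only [hd, Matrix.mul_neg, Matrix.neg_mul, Matrix.sub_apply, Matrix.neg_apply]
    ring

lemma abs_lam_sub_le {H' : Matrix (Fin Nr) (Fin Nt) ℂ} (D' : SVD H') (m : Fin (min Nt Nr)) :
    |D.lam m - D'.lam m| ≤ entrySum (H * Hᴴ - H' * H'ᴴ) := by
  have key := abs_eigenvalue_sub_le D.unitary_U D'.unitary_U
    (extend_antitone (k := Nr) D.lam_antitone D.lam_nonneg)
    (extend_antitone (k := Nr) D'.lam_antitone D'.lam_nonneg) (Fin.castLE (min_le_right Nt Nr) m)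
  rwa [extend_castLE, extend_castLE, ← D.mul_conjTranspose_eq, ← D'.mul_conjTranspose_eq] at key

lemma received_apply (s : Fin (min Nt Nr) → ℂ) (η : Fin Nr → ℂ) (m : Fin (min Nt Nr)) :
    received D s η m = ((Real.sqrt (D.lam m) : ℝ) : ℂ) * s m +
      (D.Uᴴ *ᵥ η) (Fin.castLE (min_le_right Nt Nr) m) := by
  have hV : D.Vᴴ * D.V = 1 := Matrix.mem_unitaryGroup_iff'.1 D.unitary_V
  have hU : D.Uᴴ * D.U = 1 := Matrix.mem_unitaryGroup_iff'.1 D.unitary_U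
  have e1 : D.Vbar *ᵥ s = D.V *ᵥ extend Nt s := by
    funext i
    simp only [Matrix.mulVec, dotProduct, Vbar, Matrix.submatrix_apply, id]
    rw [← sum_extend (min_le_left Nt Nr)]
    refine Finset.sum_congr rfl fun j _ => ?_
    unfold extend
    split_ifs
    · rfl
    · simp
  have e2 : ∀ y, (D.Ubarᴴ *ᵥ y) m = (D.Uᴴ *ᵥ y) (Fin.castLE (min_le_right Nt Nr) m) := by
    intro y
    simp [Matrix.mulVec, dotProduct, Ubar, Matrix.conjTranspose_apply]
  have e3 : D.Uᴴ *ᵥ (H *ᵥ (D.V *ᵥ extend Nt s)) = sigmaMatrix D.lam *ᵥ extend Nt s := by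
    refine (congrArg (fun M => D.Uᴴ *ᵥ (M *ᵥ (D.V *ᵥ extend Nt s))) D.eq_mul).trans ?_
    rw [Matrix.mulVec_mulVec, Matrix.mulVec_mulVec]
    congr 1
    calc _ = (D.Uᴴ * D.U) * sigmaMatrix D.lam * (D.Vᴴ * D.V) := by simp only [Matrix.mul_assoc]
      _ = _ := by rw [hU, hV, Matrix.one_mul, Matrix.mul_one]
  unfold received
  rw [e2, e1, Matrix.mulVec_add, Pi.add_apply, e3, sigmaMatrix_mulVec]
  simp

end SVD

/-- The factors `U` and `V` of an arbitrary choice of SVD need not even be measurable, but the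
singular values are controlled by `H * Hᴴ`. This is what makes the conditional error probability a
measurable function of the channel. -/
lemma continuous_lam {Nr Nt : ℕ} (svd : ∀ H : Matrix (Fin Nr) (Fin Nt) ℂ, SVD H)
    (m : Fin (min Nt Nr)) :
    Continuous fun h : Fin Nr → Fin Nt → ℂ => (svd (Matrix.of h)).lam m := by
  rw [continuous_iff_continuousAt]
  intro h₀
  unfold ContinuousAt
  rw [tendsto_iff_dist_tendsto_zero]
  have hc : Continuous fun h : Fin Nr → Fin Nt → ℂ =>
      entrySum (Matrix.of h * (Matrix.of h)ᴴ - Matrix.of h₀ * (Matrix.of h₀)ᴴ) := by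
    unfold entrySum
    simp only [Matrix.sub_apply, Matrix.mul_apply, Matrix.conjTranspose_apply, Matrix.of_apply]
    fun_prop
  refine squeeze_zero (fun _ => dist_nonneg) (fun h => ?_)
    (show Tendsto _ _ _ from ?_) (g := fun h : Fin Nr → Fin Nt → ℂ =>
      entrySum (Matrix.of h * (Matrix.of h)ᴴ - Matrix.of h₀ * (Matrix.of h₀)ᴴ))
  · exact (svd (Matrix.of h)).abs_lam_sub_le (svd (Matrix.of h₀)) m
  · have := hc.tendsto h₀
    simpa [entrySum] using this

end

end SLMIMO
-- Gaussian densities, unitary invariance, null sets and the pairwise error bound.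
namespace SLMIMO

noncomputable section

lemma pi_withDensity_ofReal {ι α : Type*} [Fintype ι] [MeasurableSpace α] (μ : Measure α)
    [SigmaFinite μ] {f : α → ℝ} (hf : Integrable f μ) (h0 : ∀ x, 0 ≤ f x) :
    Measure.pi (fun _ : ι => μ.withDensity fun x => ENNReal.ofReal (f x)) =
      (Measure.pi fun _ : ι => μ).withDensity fun x => ENNReal.ofReal (∏ i, f (x i)) := by
  have : IsFiniteMeasure (μ.withDensity fun x => ENNReal.ofReal (f x)) :=
    isFiniteMeasure_withDensity_ofReal hf.2
  refine Measure.pi_eq fun s hs => ?_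
  rw [withDensity_apply _ (MeasurableSet.univ_pi hs), Measure.restrict_pi_pi,
    ← ofReal_integral_eq_lintegral_ofReal, integral_fintype_prod_eq_prod (fun _ => f),
    ENNReal.ofReal_prod_of_nonneg fun i _ => integral_nonneg h0]
  · refine Finset.prod_congr rfl fun i _ => ?_
    rw [withDensity_apply _ (hs i), ofReal_integral_eq_lintegral_ofReal hf.integrableOn
      (Eventually.of_forall h0)]
  · exact Integrable.fintype_prod_dep fun i => hf.integrableOn
  · exact Eventually.of_forall fun x => Finset.prod_nonneg fun i _ => h0 _

/-- The density of `CN(0, 1)`. -/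
def gaussDensity (z : ℂ) : ℝ := Real.pi⁻¹ * Real.exp (-‖z‖ ^ 2)

lemma gaussDensity_pos (z : ℂ) : 0 < gaussDensity z := by
  unfold gaussDensity
  have := Real.pi_pos
  positivity

lemma continuous_gaussDensity : Continuous gaussDensity := by
  unfold gaussDensity
  fun_prop

lemma complexGaussian_eq_map (v : ℝ≥0) : complexGaussian v =
    ((gaussianReal 0 (v / 2)).prod (gaussianReal 0 (v / 2))).map
      Complex.measurableEquivRealProd.symm := rfl

instance (v : ℝ≥0) : IsProbabilityMeasure (complexGaussian v) := by
  rw [complexGaussian_eq_map]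
  exact Measure.isProbabilityMeasure_map (by fun_prop)

lemma complexGaussian_one_eq_withDensity :
    complexGaussian 1 = volume.withDensity fun z => ENNReal.ofReal (gaussDensity z) := by
  rw [complexGaussian_eq_map, gaussianReal_of_var_ne_zero 0 (by norm_num),
    prod_withDensity (measurable_gaussianPDF _ _) (measurable_gaussianPDF _ _)]
  ext s hs
  rw [MeasurableEquiv.map_apply, withDensity_apply _ hs, withDensity_apply _
    (Complex.measurableEquivRealProd.symm.measurable hs),
    ← (Complex.volume_preserving_equiv_real_prod.symm).setLIntegral_comp_preimage hs
      (by have := continuous_gaussDensity; fun_prop)]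
  refine lintegral_congr fun p => ?_
  rw [gaussianPDF, gaussianPDF, ← ENNReal.ofReal_mul (gaussianPDFReal_nonneg _ _ _)]
  congr 1
  simp only [gaussianPDFReal, gaussDensity]
  have h2 : ‖Complex.measurableEquivRealProd.symm p‖ ^ 2 = p.1 ^ 2 + p.2 ^ 2 := by
    rw [Complex.sq_norm, Complex.normSq_apply]
    simp [sq]
  rw [h2]
  have h3 : (2 : ℝ) * Real.pi * ((1 / 2 : ℝ≥0) : ℝ) = Real.pi := by push_cast; ring
  have h4 : (2 : ℝ) * ((1 / 2 : ℝ≥0) : ℝ) = 1 := by push_cast; ring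
  rw [h3, h4]
  have h5 : (√Real.pi)⁻¹ * (√Real.pi)⁻¹ = Real.pi⁻¹ := by
    rw [← mul_inv, Real.mul_self_sqrt Real.pi_pos.le]
  calc _ = ((√Real.pi)⁻¹ * (√Real.pi)⁻¹) *
        (Real.exp (-(p.1 - 0) ^ 2 / 1) * Real.exp (-(p.2 - 0) ^ 2 / 1)) := by ring
    _ = _ := by
      rw [h5, ← Real.exp_add]
      congr 2
      ring

lemma lintegral_gaussDensity : ∫⁻ z, ENNReal.ofReal (gaussDensity z) = 1 := by
  have := measure_univ (μ := complexGaussian 1)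
  rwa [complexGaussian_one_eq_withDensity, withDensity_apply _ MeasurableSet.univ,
    Measure.restrict_univ] at this

lemma integrable_gaussDensity : Integrable gaussDensity := by
  refine ⟨continuous_gaussDensity.aestronglyMeasurable, ?_⟩
  rw [hasFiniteIntegral_iff_ofReal (Eventually.of_forall fun z => (gaussDensity_pos z).le),
    lintegral_gaussDensity]
  exact ENNReal.one_lt_top

/-- The density of a vector of i.i.d. `CN(0, 1)` variables. -/
def vecDensity {ι : Type*} [Fintype ι] (x : ι → ℂ) : ℝ := ∏ i, gaussDensity (x i)

lemma vecDensity_pos {ι : Type*} [Fintype ι] (x : ι → ℂ) : 0 < vecDensity x :=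
  Finset.prod_pos fun _ _ => gaussDensity_pos _

lemma continuous_vecDensity {ι : Type*} [Fintype ι] :
    Continuous (vecDensity : (ι → ℂ) → ℝ) := by
  have := continuous_gaussDensity
  unfold vecDensity
  fun_prop

lemma vecDensity_eq {ι : Type*} [Fintype ι] (x : ι → ℂ) :
    vecDensity x = Real.pi⁻¹ ^ Fintype.card ι * Real.exp (-nsq x) := by
  unfold vecDensity gaussDensity nsq
  rw [Finset.prod_mul_distrib, ← Real.exp_sum, Finset.prod_const, Finset.card_univ,
    Finset.sum_neg_distrib]

lemma noiseLaw_one_eq_withDensity (k : ℕ) :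
    noiseLaw k 1 = volume.withDensity fun x => ENNReal.ofReal (vecDensity x) := by
  unfold noiseLaw
  rw [complexGaussian_one_eq_withDensity]
  exact pi_withDensity_ofReal volume integrable_gaussDensity fun z => (gaussDensity_pos z).le

/-- The density of the channel matrix. -/
def matDensity {Nr Nt : ℕ} (h : Fin Nr → Fin Nt → ℂ) : ℝ := ∏ i, vecDensity (h i)

lemma matDensity_pos {Nr Nt : ℕ} (h : Fin Nr → Fin Nt → ℂ) : 0 < matDensity h :=
  Finset.prod_pos fun _ _ => vecDensity_pos _

lemma continuous_matDensity {Nr Nt : ℕ} :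
    Continuous (matDensity : (Fin Nr → Fin Nt → ℂ) → ℝ) := by
  unfold matDensity
  exact continuous_finsetProd _ fun i _ => continuous_vecDensity.comp (continuous_apply i)

lemma matDensity_eq {Nr Nt : ℕ} (h : Fin Nr → Fin Nt → ℂ) :
    matDensity h = (Real.pi⁻¹ ^ Nt) ^ Nr * Real.exp (-∑ i, nsq (h i)) := by
  unfold matDensity
  simp only [vecDensity_eq]
  rw [Finset.prod_mul_distrib, ← Real.exp_sum, Finset.prod_const, Finset.card_univ,
    Finset.sum_neg_distrib, Fintype.card_fin, Fintype.card_fin]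

instance (k : ℕ) (v : ℝ≥0) : IsProbabilityMeasure (noiseLaw k v) := by
  unfold noiseLaw
  infer_instance

lemma integrable_vecDensity {k : ℕ} : Integrable (vecDensity : (Fin k → ℂ) → ℝ) := by
  refine ⟨continuous_vecDensity.aestronglyMeasurable, ?_⟩
  rw [hasFiniteIntegral_iff_ofReal (Eventually.of_forall fun z => (vecDensity_pos z).le)]
  have := measure_univ (μ := noiseLaw k 1)
  rw [noiseLaw_one_eq_withDensity, withDensity_apply _ MeasurableSet.univ,
    Measure.restrict_univ] at this
  rw [this]
  exact ENNReal.one_lt_top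

lemma channelLaw_eq_withDensity (Nr Nt : ℕ) :
    channelLaw Nr Nt = volume.withDensity fun h => ENNReal.ofReal (matDensity h) := by
  have h1 : channelLaw Nr Nt = Measure.pi fun _ : Fin Nr => noiseLaw Nt 1 := rfl
  rw [h1, noiseLaw_one_eq_withDensity]
  exact pi_withDensity_ofReal volume integrable_vecDensity fun z => (vecDensity_pos z).le

lemma complexGaussian_eq_map_smul (v : ℝ≥0) :
    complexGaussian v = (complexGaussian 1).map fun z => Real.sqrt v • z := by
  have h1 : gaussianReal 0 (v / 2) = (gaussianReal 0 (1 / 2)).map fun x => Real.sqrt v * x := by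
    rw [gaussianReal_map_const_mul, mul_zero]
    congr 1
    apply NNReal.eq
    push_cast
    rw [← NNReal.coe_mk (Real.sqrt v ^ 2) (sq_nonneg _)]
    simp [Real.sq_sqrt, div_eq_mul_inv]
  rw [complexGaussian_eq_map, complexGaussian_eq_map, h1, Measure.map_prod_map _ _ (by fun_prop)
    (by fun_prop), Measure.map_map (by fun_prop) (by fun_prop),
    Measure.map_map (by fun_prop) (by fun_prop)]
  congr 1
  funext p
  apply Complex.ext <;> simp

lemma noiseLaw_eq_map_smul (k : ℕ) (v : ℝ≥0) :
    noiseLaw k v = (noiseLaw k 1).map fun x => Real.sqrt v • x := by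
  unfold noiseLaw
  have h := Measure.pi_map_pi (μ := fun _ : Fin k => complexGaussian 1)
    (f := fun _ z => Real.sqrt v • z) (fun i => by fun_prop)
  rw [complexGaussian_eq_map_smul v, ← h]
  rfl

/-- Uniqueness of Haar measure replaces the computation of a determinant; only the fact that the
factor is neither `0` nor `∞` is ever needed. -/
lemma exists_map_eq_smul {E F : Type*} [NormedAddCommGroup E] [NormedSpace ℝ E]
    [MeasurableSpace E] [BorelSpace E] [NormedAddCommGroup F] [NormedSpace ℝ F]
    [FiniteDimensional ℝ F] [MeasurableSpace F] [BorelSpace F] (L : E ≃L[ℝ] F)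
    (μ : Measure E) [μ.IsAddHaarMeasure] (ν : Measure F) [ν.IsAddHaarMeasure] :
    ∃ c : ℝ≥0∞, c ≠ 0 ∧ c ≠ ∞ ∧ μ.map L = c • ν := by
  have : ProperSpace F := FiniteDimensional.proper_real F
  refine ⟨Measure.addHaarScalarFactor (μ.map L) ν, ?_, ENNReal.coe_ne_top,
    Measure.isAddLeftInvariant_eq_smul (μ.map L) ν⟩
  exact_mod_cast (Measure.addHaarScalarFactor_pos_of_isAddHaarMeasure (μ.map L) ν).ne'

/-- The density depends on the norm alone and Lebesgue measure is rescaled by a constant, which has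
to be `1` because both sides have total mass `1`. -/
lemma noiseLaw_map_unitary {k : ℕ} {U : Matrix (Fin k) (Fin k) ℂ}
    (hU : U ∈ Matrix.unitaryGroup (Fin k) ℂ) :
    (noiseLaw k 1).map (fun x => Uᴴ *ᵥ x) = noiseLaw k 1 := by
  have e : Uᴴ * U = 1 := Matrix.mem_unitaryGroup_iff'.1 hU
  have e' : U * Uᴴ = 1 := Matrix.mem_unitaryGroup_iff.1 hU
  let T : (Fin k → ℂ) ≃ₗ[ℂ] (Fin k → ℂ) := LinearEquiv.ofLinearMap Uᴴ.mulVecLin U.mulVecLin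
    (by rw [← Matrix.mulVecLin_mul, e, Matrix.mulVecLin_one])
    (by rw [← Matrix.mulVecLin_mul, e', Matrix.mulVecLin_one])
  let L : (Fin k → ℂ) ≃L[ℝ] (Fin k → ℂ) := (T.restrictScalars ℝ).toContinuousLinearEquiv
  have hL : (fun x => Uᴴ *ᵥ x) = L := rfl
  obtain ⟨c, -, -, h⟩ := exists_map_eq_smul L volume volume
  have key : (noiseLaw k 1).map (fun x => Uᴴ *ᵥ x) = c • noiseLaw k 1 := by
    rw [noiseLaw_one_eq_withDensity, ← withDensity_smul_measure, ← h, hL]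
    ext s hs
    have hm : Measurable fun x : Fin k → ℂ => ENNReal.ofReal (vecDensity x) :=
      continuous_vecDensity.measurable.ennreal_ofReal
    rw [Measure.map_apply L.continuous.measurable hs, withDensity_apply _ hs,
      withDensity_apply _ (L.continuous.measurable hs), setLIntegral_map hs hm
      L.continuous.measurable]
    refine lintegral_congr fun x => ?_
    rw [vecDensity_eq, vecDensity_eq, ← hL, nsq_unitary_conjTranspose_mulVec hU]
  have h1 : ((noiseLaw k 1).map (fun x => Uᴴ *ᵥ x)) Set.univ = 1 := by
    rw [hL, Measure.map_apply L.continuous.measurable MeasurableSet.univ, Set.preimage_univ,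
      measure_univ]
  have hc1 : c = 1 := by
    rw [key] at h1
    simpa using h1
  rw [key, hc1, one_smul]

/-- A measurable set that meets every line of some direction in a countable set is null. -/
lemma measure_eq_zero_of_countable_lines {E : Type*} [NormedAddCommGroup E] [NormedSpace ℝ E]
    [MeasurableSpace E] [BorelSpace E] [SecondCountableTopology E] (μ : Measure E) [SFinite μ]
    [μ.IsAddRightInvariant] {Z : Set E} (hZ : MeasurableSet Z) (e : E)
    (h : ∀ x, {t : ℝ | x + t • e ∈ Z}.Countable) : μ Z = 0 := by
  let ν : Measure ℝ := volume.restrict (Set.Icc 0 1)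
  let S : Set (ℝ × E) := {p | p.2 + p.1 • e ∈ Z}
  have hS : MeasurableSet S := by
    have : Measurable fun p : ℝ × E => p.2 + p.1 • e := by fun_prop
    exact this hZ
  -- Fubini on `[0, 1] × E`: the slices at fixed `t` are translates of `Z`, and those at fixed `x`
  -- are countable.
  have h1 : (ν.prod μ) S = μ Z := by
    rw [Measure.prod_apply hS]
    have : ∀ t : ℝ, μ (Prod.mk t ⁻¹' S) = μ Z := fun t => measure_preimage_add_right μ (t • e) Z
    simp [this, ν]
  have h2 : (ν.prod μ) S = 0 := by
    rw [Measure.prod_apply_symm hS]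
    have : ∀ x : E, ν ((fun t => (t, x)) ⁻¹' S) = 0 := fun x =>
      Measure.absolutelyContinuous_of_le Measure.restrict_le_self ((h x).measure_zero volume)
    simp [this]
  rw [← h1, h2]

lemma nsq_add_smul_sub {k : ℕ} (x v : Fin k → ℂ) (t : ℝ) :
    nsq (x + t • v + v) - nsq (x + t • v) = nsq (x + v) - nsq x + 2 * t * nsq v := by
  unfold nsq
  rw [← Finset.sum_sub_distrib, ← Finset.sum_sub_distrib, Finset.mul_sum,
    ← Finset.sum_add_distrib]
  refine Finset.sum_congr rfl fun i _ => ?_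
  simp only [Complex.sq_norm, Complex.normSq_apply, Pi.add_apply, Pi.smul_apply,
    Complex.add_re, Complex.add_im, Complex.smul_re, Complex.smul_im, smul_eq_mul]
  ring

/-- Along lines of direction `v` the difference of the two sides is affine with slope `2 * nsq v`,
so each line meets the set at most once. Hence the tie-breaking rule has no effect on the error
probability. -/
lemma noiseLaw_tie {k : ℕ} {v : Fin k → ℂ} (hv : v ≠ 0) :
    noiseLaw k 1 {x | nsq (x + v) = nsq x} = 0 := by
  rw [noiseLaw_one_eq_withDensity]
  refine withDensity_absolutelyContinuous _ _ ?_
  refine measure_eq_zero_of_countable_lines volume ?_ v fun x => ?_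
  · have := continuous_nsq (ι := Fin k)
    exact (isClosed_eq (by fun_prop) (by fun_prop)).measurableSet
  · refine Set.Subsingleton.countable fun t ht t' ht' => ?_
    simp only [Set.mem_ofPred_eq] at ht ht'
    have h1 := nsq_add_smul_sub x v t
    have h2 := nsq_add_smul_sub x v t'
    rw [ht] at h1
    rw [ht'] at h2
    have h3 := nsq_pos hv
    have h4 : (t - t') * (2 * nsq v) = 0 := by linarith
    rcases mul_eq_zero.1 h4 with h5 | h5
    · linarith
    · linarith

lemma noiseLaw_pos_of_isOpen {k : ℕ} {s : Set (Fin k → ℂ)} (hs : IsOpen s) (hne : s.Nonempty) :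
    0 < noiseLaw k 1 s := by
  rw [pos_iff_ne_zero]
  intro h
  rw [noiseLaw_one_eq_withDensity] at h
  have hm : AEMeasurable (fun x : Fin k → ℂ => ENNReal.ofReal (vecDensity x)) :=
    continuous_vecDensity.measurable.ennreal_ofReal.aemeasurable
  have := withDensity_absolutelyContinuous' hm
    (Eventually.of_forall fun x => (ENNReal.ofReal_pos.2 (vecDensity_pos x)).ne') h
  exact (hs.measure_pos volume hne).ne' this

lemma nsq_add_add_nsq {k : ℕ} (x v : Fin k → ℂ) :
    nsq (x + v) + nsq x = 2 * nsq (x + (2⁻¹ : ℝ) • v) + nsq v / 2 := by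
  unfold nsq
  rw [← Finset.sum_add_distrib, Finset.mul_sum, Finset.sum_div, ← Finset.sum_add_distrib]
  refine Finset.sum_congr rfl fun i _ => ?_
  simp only [Complex.sq_norm, Complex.normSq_apply, Pi.add_apply, Pi.smul_apply,
    Complex.add_re, Complex.add_im, Complex.smul_re, Complex.smul_im, smul_eq_mul]
  ring

/-- By the parallelogram identity, on the event `nsq x` exceeds `nsq (x + v / 2) + nsq v / 4`. The
density at `x` is therefore at most the exponential factor times the density at `x + v / 2`, which
integrates to `1`. -/
lemma noiseLaw_lt_le_exp {k : ℕ} (v : Fin k → ℂ) :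
    noiseLaw k 1 {x | nsq (x + v) < nsq x} ≤ ENNReal.ofReal (Real.exp (-(nsq v / 4))) := by
  have hm : Measurable fun x : Fin k → ℂ => ENNReal.ofReal (vecDensity x) :=
    continuous_vecDensity.measurable.ennreal_ofReal
  have hs : MeasurableSet {x : Fin k → ℂ | nsq (x + v) < nsq x} := by
    have := continuous_nsq (ι := Fin k)
    exact (isOpen_lt (by fun_prop) (by fun_prop)).measurableSet
  have h1 : ∫⁻ x : Fin k → ℂ, ENNReal.ofReal (vecDensity x) = 1 := by
    have := measure_univ (μ := noiseLaw k 1)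
    rwa [noiseLaw_one_eq_withDensity, withDensity_apply _ MeasurableSet.univ,
      Measure.restrict_univ] at this
  rw [noiseLaw_one_eq_withDensity, withDensity_apply _ hs]
  calc ∫⁻ x in {x | nsq (x + v) < nsq x}, ENNReal.ofReal (vecDensity x)
      ≤ ∫⁻ x in {x | nsq (x + v) < nsq x}, ENNReal.ofReal (Real.exp (-(nsq v / 4))) *
          ENNReal.ofReal (vecDensity (x + (2⁻¹ : ℝ) • v)) := by
        refine setLIntegral_mono' hs fun x hx => ?_
        rw [← ENNReal.ofReal_mul (Real.exp_pos _).le]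
        refine ENNReal.ofReal_le_ofReal ?_
        rw [vecDensity_eq, vecDensity_eq, mul_left_comm, ← Real.exp_add]
        have h2 := nsq_add_add_nsq x v
        have h3 : nsq (x + v) < nsq x := hx
        have h4 := Real.pi_pos
        gcongr
        linarith
    _ ≤ ∫⁻ x, ENNReal.ofReal (Real.exp (-(nsq v / 4))) *
          ENNReal.ofReal (vecDensity (x + (2⁻¹ : ℝ) • v)) := setLIntegral_le_lintegral _ _
    _ = ENNReal.ofReal (Real.exp (-(nsq v / 4))) := by
        have hm' : Measurable fun x : Fin k → ℂ =>
            ENNReal.ofReal (vecDensity (x + (2⁻¹ : ℝ) • v)) := hm.comp (measurable_add_const _)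
        rw [lintegral_const_mul _ hm', lintegral_add_right_eq_self
          (fun x => ENNReal.ofReal (vecDensity x)), h1, mul_one]

end

end SLMIMO
-- Conditional error probability: decay, limits, and the link with the detector.
namespace SLMIMO

noncomputable section

section errProb

variable {n : ℕ} {κ : Type*}

/-- The shift of the noise vector caused by the difference vector `ψ` when the squared singular
values are `μ`. -/
def shift (k : ℕ) (μ : Fin n → ℝ) (ψ : Fin n → ℂ) : Fin k → ℂ :=
  extend k fun m => ((Real.sqrt (μ m) : ℝ) : ℂ) * ψ m

/-- The noise vectors for which some competing symbol is strictly closer than the sent one. -/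
def errSet (k : ℕ) (ψ : κ → Fin n → ℂ) (μ : Fin n → ℝ) : Set (Fin k → ℂ) :=
  {x | ∃ j, nsq (x + shift k μ (ψ j)) < nsq x}

/-- The conditional error probability given the squared singular values. -/
def errProb (k : ℕ) (ψ : κ → Fin n → ℂ) (μ : Fin n → ℝ) : ℝ≥0∞ := noiseLaw k 1 (errSet k ψ μ)

lemma continuous_shift (k : ℕ) (ψ : Fin n → ℂ) :
    Continuous fun μ : Fin n → ℝ => shift k μ ψ := by
  refine continuous_pi fun i => ?_
  unfold shift extend
  split_ifs
  · fun_prop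
  · fun_prop

lemma isOpen_errSet (k : ℕ) (ψ : κ → Fin n → ℂ) (μ : Fin n → ℝ) : IsOpen (errSet k ψ μ) := by
  have := continuous_nsq (ι := Fin k)
  simp only [errSet, Set.ofPred_exists]
  exact isOpen_iUnion fun j => isOpen_lt (by fun_prop) (by fun_prop)

lemma measurable_errProb (k : ℕ) (ψ : κ → Fin n → ℂ) : Measurable (errProb k ψ) := by
  let S : Set ((Fin n → ℝ) × (Fin k → ℂ)) := {p | ∃ j, nsq (p.2 + shift k p.1 (ψ j)) < nsq p.2}
  have hS : IsOpen S := by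
    have := continuous_nsq (ι := Fin k)
    have h2 := continuous_shift (n := n) k
    simp only [S, Set.ofPred_exists]
    refine isOpen_iUnion fun j => isOpen_lt ?_ (by fun_prop)
    exact this.comp (continuous_snd.add ((h2 _).comp continuous_fst))
  exact measurable_measure_prodMk_left (ν := noiseLaw k 1) hS.measurableSet

lemma errProb_le_one (k : ℕ) (ψ : κ → Fin n → ℂ) (μ : Fin n → ℝ) : errProb k ψ μ ≤ 1 :=
  prob_le_one

lemma nsq_shift {k : ℕ} (hnk : n ≤ k) {μ : Fin n → ℝ} (h0 : ∀ m, 0 ≤ μ m) (ψ : Fin n → ℂ) :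
    nsq (shift k μ ψ) = ∑ m, μ m * ‖ψ m‖ ^ 2 := by
  rw [shift, nsq_extend hnk, nsq]
  refine Finset.sum_congr rfl fun m _ => ?_
  rw [norm_mul, mul_pow, Complex.norm_real, Real.norm_eq_abs, sq_abs, Real.sq_sqrt (h0 m)]

lemma pow_mul_exp_neg_le {x b : ℝ} (hx : 0 ≤ x) (hb : 0 < b) (q : ℕ) :
    x ^ q * Real.exp (-(b * x)) ≤ q.factorial / b ^ q := by
  have h1 := Real.pow_div_factorial_le_exp (b * x) (by positivity) q
  rw [Real.exp_neg, ← div_eq_mul_inv, div_le_div_iff₀ (Real.exp_pos _) (by positivity)]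
  rw [div_le_iff₀ (by positivity), mul_pow] at h1
  linarith

/-- Each `ψ j` has a nonzero entry at some `m ≤ p`, where `μ m ≥ μ p`. Every pairwise bound thus
decays exponentially in `μ p` and absorbs any power of it. -/
lemma exists_pow_mul_errProb_le {k : ℕ} (hnk : n ≤ k) [Finite κ] (ψ : κ → Fin n → ℂ) (p : Fin n)
    (hψ : ∀ j, ∃ m ≤ p, ψ j m ≠ 0) (q : ℕ) :
    ∃ K : ℝ, 0 ≤ K ∧ ∀ μ : Fin n → ℝ, Antitone μ → (∀ m, 0 ≤ μ m) →
      ENNReal.ofReal (μ p ^ q) * errProb k ψ μ ≤ ENNReal.ofReal K := by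
  have := Fintype.ofFinite κ
  choose m hm hm0 using hψ
  have hb : ∀ j, 0 < ‖ψ j (m j)‖ ^ 2 / 4 := fun j => by
    have := norm_pos_iff.2 (hm0 j)
    positivity
  refine ⟨∑ j, q.factorial / (‖ψ j (m j)‖ ^ 2 / 4) ^ q, Finset.sum_nonneg fun j _ => by positivity,
    fun μ hμ h0 => ?_⟩
  have h1 : errProb k ψ μ ≤ ∑ j, ENNReal.ofReal (Real.exp (-(nsq (shift k μ (ψ j)) / 4))) := by
    unfold errProb errSet
    rw [Set.ofPred_exists]
    refine (measure_iUnion_fintype_le _ _).trans (Finset.sum_le_sum fun j _ => ?_)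
    exact noiseLaw_lt_le_exp _
  rw [ENNReal.ofReal_sum_of_nonneg fun j _ => by positivity]
  refine (mul_le_mul_right h1 _).trans ?_
  rw [Finset.mul_sum]
  refine Finset.sum_le_sum fun j _ => ?_
  rw [← ENNReal.ofReal_mul (by have := h0 p; positivity)]
  refine ENNReal.ofReal_le_ofReal ?_
  refine le_trans ?_ (pow_mul_exp_neg_le (h0 p) (hb j) q)
  have h2 : μ p * ‖ψ j (m j)‖ ^ 2 ≤ nsq (shift k μ (ψ j)) := by
    rw [nsq_shift hnk h0]
    calc μ p * ‖ψ j (m j)‖ ^ 2 ≤ μ (m j) * ‖ψ j (m j)‖ ^ 2 :=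
          mul_le_mul_of_nonneg_right (hμ (hm j)) (sq_nonneg _)
      _ ≤ _ := Finset.single_le_sum (f := fun m => μ m * ‖ψ j m‖ ^ 2)
          (fun i _ => mul_nonneg (h0 i) (sq_nonneg _)) (Finset.mem_univ _)
  have h3 : 0 ≤ μ p ^ q := by have := h0 p; positivity
  gcongr
  linarith

/-- Competitors that differ before position `p` are pushed to infinity and eventually cause no
error. The others have converging shifts, so off the null set of ties membership in the error set
stabilizes. -/
lemma exists_tendsto_errProb {k : ℕ} (hnk : n ≤ k) [Finite κ] (ψ : κ → Fin n → ℂ)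
    (hψ : ∀ j, ψ j ≠ 0) (p : Fin n) {l : Filter ℝ} [l.IsCountablyGenerated]
    {μ : ℝ → Fin n → ℝ} (h1 : ∀ m < p, Tendsto (fun δ => μ δ m) l atTop)
    (h2 : ∀ m, p ≤ m → ∃ a, 0 < a ∧ Tendsto (fun δ => μ δ m) l (nhds a)) :
    ∃ ℓ, Tendsto (fun δ => errProb k ψ (μ δ)) l (nhds ℓ) ∧
      ((∃ j, ∀ m < p, ψ j m = 0) → 0 < ℓ) := by
  have h2' : ∀ m, ∃ a, 0 < a ∧ (p ≤ m → Tendsto (fun δ => μ δ m) l (nhds a)) := fun m => by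
    by_cases hm : p ≤ m
    · obtain ⟨a, ha, h⟩ := h2 m hm
      exact ⟨a, ha, fun _ => h⟩
    · exact ⟨1, one_pos, fun h => absurd h hm⟩
  choose a ha hlim using h2'
  have hcn := continuous_nsq (ι := Fin k)
  let A : Set (Fin k → ℂ) :=
    {x | ∃ j, (∀ m < p, ψ j m = 0) ∧ nsq (x + shift k a (ψ j)) < nsq x}
  have hA : IsOpen A := by
    simp only [A, Set.ofPred_exists]
    refine isOpen_iUnion fun j => ?_
    by_cases hj : ∀ m < p, ψ j m = 0
    · simp only [and_iff_right hj]
      exact isOpen_lt (by fun_prop) (by fun_prop)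
    · simp [hj]
  have hsh : ∀ j, shift k a (ψ j) ≠ 0 := by
    intro j h
    have h3 := nsq_eq_zero.2 h
    rw [nsq_shift hnk fun m => (ha m).le,
      Finset.sum_eq_zero_iff_of_nonneg fun m _ => mul_nonneg (ha m).le (sq_nonneg _)] at h3
    refine hψ j (funext fun m => ?_)
    have := h3 m (Finset.mem_univ m)
    simpa [(ha m).ne'] using this
  refine ⟨noiseLaw k 1 A, ?_, ?_⟩
  · refine tendsto_measure_of_ae_tendsto_indicator_of_isFiniteMeasure l hA.measurableSet
      (fun δ => (isOpen_errSet k ψ (μ δ)).measurableSet) ?_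
    have htie : ∀ᵐ x ∂noiseLaw k 1, ∀ j, nsq (x + shift k a (ψ j)) ≠ nsq x :=
      ae_all_iff.2 fun j => by
        rw [ae_iff]
        simpa using noiseLaw_tie (hsh j)
    filter_upwards [htie] with x hx
    have key : ∀ j, ∀ᶠ δ in l, (nsq (x + shift k (μ δ) (ψ j)) < nsq x ↔
        (∀ m < p, ψ j m = 0) ∧ nsq (x + shift k a (ψ j)) < nsq x) := by
      intro j
      by_cases hj : ∀ m < p, ψ j m = 0
      · simp only [and_iff_right hj]
        have ht : Tendsto (fun δ => nsq (x + shift k (μ δ) (ψ j))) l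
            (nhds (nsq (x + shift k a (ψ j)))) := by
          refine (hcn.tendsto _).comp (tendsto_const_nhds.add ?_)
          refine tendsto_pi_nhds.2 fun i => ?_
          unfold shift extend
          split_ifs with hi
          · by_cases hip : p ≤ ⟨i, hi⟩
            · have := hlim _ hip
              exact ((Complex.continuous_ofReal.tendsto _).comp
                ((Real.continuous_sqrt.tendsto _).comp this)).mul tendsto_const_nhds
            · simp only [hj _ (not_le.1 hip), mul_zero]
              exact tendsto_const_nhds
          · exact tendsto_const_nhds
        rcases lt_or_gt_of_ne (hx j) with h | h
        · filter_upwards [ht.eventually_lt_const h] with δ hδ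
          exact iff_of_true hδ h
        · filter_upwards [ht.eventually_const_lt h] with δ hδ
          exact iff_of_false hδ.le.not_gt h.le.not_gt
      · push Not at hj
        obtain ⟨m, hm, hm0⟩ := hj
        have ht : Tendsto (fun δ => Real.sqrt (μ δ m) * ‖ψ j m‖) l atTop :=
          (Real.tendsto_sqrt_atTop.comp (h1 m hm)).atTop_mul_const (norm_pos_iff.2 hm0)
        filter_upwards [ht.eventually_ge_atTop
          (Real.sqrt (nsq x) + ‖x (Fin.castLE hnk m)‖)] with δ hδ
        refine iff_of_false (not_lt.2 ?_) fun h => hm0 (h.1 m hm)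
        have h3 := norm_sq_le_nsq (x + shift k (μ δ) (ψ j)) (Fin.castLE hnk m)
        refine le_trans ?_ h3
        rw [← Real.sqrt_le_left (norm_nonneg _)]
        have h4 : (x + shift k (μ δ) (ψ j)) (Fin.castLE hnk m) =
            x (Fin.castLE hnk m) + ((Real.sqrt (μ δ m) : ℝ) : ℂ) * ψ j m := by
          simp [shift]
        have h5 : ‖((Real.sqrt (μ δ m) : ℝ) : ℂ) * ψ j m‖ = Real.sqrt (μ δ m) * ‖ψ j m‖ := by
          rw [norm_mul, Complex.norm_real, Real.norm_of_nonneg (Real.sqrt_nonneg _)]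
        rw [h4]
        have h6 := norm_sub_norm_le (((Real.sqrt (μ δ m) : ℝ) : ℂ) * ψ j m)
          (-x (Fin.castLE hnk m))
        rw [norm_neg, sub_neg_eq_add, add_comm (_ * _)] at h6
        linarith
    filter_upwards [eventually_all.2 key] with δ hδ
    exact exists_congr hδ
  · rintro ⟨j, hj⟩
    -- For this noise vector the competitor is at distance `0`.
    refine noiseLaw_pos_of_isOpen hA ⟨-shift k a (ψ j), j, hj, ?_⟩
    rw [neg_add_cancel, nsq_zero]
    exact nsq_pos (neg_ne_zero.2 (hsh j))

end errProb

section detection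

variable {Nr Nt L M : ℕ} (C : Code (min Nt Nr) L M)

/-- The nonzero difference vectors seen from the message `w`. -/
def diffs (w : Fin L → Fin M) (w' : {w' : Fin L → Fin M // w' ≠ w}) : Fin (min Nt Nr) → ℂ :=
  C.symbol w - C.symbol w'.1

lemma metric_received_sub {H : Matrix (Fin Nr) (Fin Nt) ℂ} (D : SVD H) {v : ℝ≥0} (hv : 0 < v)
    (s s' : Fin (min Nt Nr) → ℂ) (x η : Fin Nr → ℂ) (hη : D.Uᴴ *ᵥ η = Real.sqrt v • x) :
    metric D.lam (received D s η) s' - metric D.lam (received D s η) s =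
      v * (nsq (x + shift Nr (fun m => D.lam m / v) (s - s')) - nsq x) := by
  have hv' : (0 : ℝ) < Real.sqrt v := Real.sqrt_pos.2 (by exact_mod_cast hv)
  have e : nsq (x + shift Nr (fun m => D.lam m / v) (s - s')) - nsq x =
      ∑ m : Fin (min Nt Nr), (‖x (Fin.castLE (min_le_right Nt Nr) m) +
        ((Real.sqrt (D.lam m / v) : ℝ) : ℂ) * (s m - s' m)‖ ^ 2 -
        ‖x (Fin.castLE (min_le_right Nt Nr) m)‖ ^ 2) := by
    rw [nsq, nsq, ← Finset.sum_sub_distrib, ← sum_extend (min_le_right Nt Nr)]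
    refine Finset.sum_congr rfl fun i _ => ?_
    unfold shift
    simp only [Pi.add_apply, extend]
    split_ifs with h
    · rfl
    · simp
  rw [e, metric, metric, ← Finset.sum_sub_distrib, Finset.mul_sum]
  refine Finset.sum_congr rfl fun m _ => ?_
  rw [D.received_apply, hη]
  have h1 : ((Real.sqrt (D.lam m) : ℝ) : ℂ) =
      ((Real.sqrt v : ℝ) : ℂ) * ((Real.sqrt (D.lam m / v) : ℝ) : ℂ) := by
    have hv0 : (0 : ℝ) < v := by exact_mod_cast hv
    rw [← Complex.ofReal_mul, ← Real.sqrt_mul v.coe_nonneg, mul_div_cancel₀ _ hv0.ne']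
  have h2 : ∀ z : ℂ, (v : ℝ) * ‖z‖ ^ 2 = ‖((Real.sqrt v : ℝ) : ℂ) * z‖ ^ 2 := fun z => by
    rw [norm_mul, mul_pow, Complex.norm_real, Real.norm_of_nonneg hv'.le,
      Real.sq_sqrt v.coe_nonneg]
  rw [mul_sub, h2, h2, h1]
  simp only [Pi.smul_apply, Complex.real_smul]
  congr 3
  · ring
  · ring_nf

variable {C} in
-- In the rotated and normalized noise `g η`, an error forces some competitor to be at least as
-- close as the sent symbol, and a strictly closer competitor forces an error. The two events differ
-- by ties, which are null because positive singular values make all shifts nonzero.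
lemma noiseLaw_detect_ne {svd : ∀ H : Matrix (Fin Nr) (Fin Nt) ℂ, SVD H}
    {detect : Matrix (Fin Nr) (Fin Nt) ℂ → (Fin (min Nt Nr) → ℂ) → (Fin (min Nt Nr) → ℂ)}
    (hdetect : IsMLDetector C svd detect) (hinj : Function.Injective C.symbol)
    (w : Fin L → Fin M) {v : ℝ≥0} (hv : 0 < v) (H : Matrix (Fin Nr) (Fin Nt) ℂ)
    (hlam : ∀ m, 0 < (svd H).lam m) :
    noiseLaw Nr v {η | detect H (received (svd H) (C.symbol w) η) ≠ C.symbol w} =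
      errProb Nr (diffs C w) fun m => (svd H).lam m / v := by
  set D := svd H with hD
  set μ : Fin (min Nt Nr) → ℝ := fun m => D.lam m / v
  have hv0 : (0 : ℝ) < v := by exact_mod_cast hv
  have hv' : (0 : ℝ) < Real.sqrt v := Real.sqrt_pos.2 hv0
  let g : (Fin Nr → ℂ) → (Fin Nr → ℂ) := fun η => D.Uᴴ *ᵥ ((Real.sqrt v)⁻¹ • η)
  have hU : Measurable fun x : Fin Nr → ℂ => D.Uᴴ *ᵥ x :=
    (Continuous.matrix_mulVec continuous_const continuous_id).measurable
  have hg : Measurable g := hU.comp (measurable_const_smul _)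
  have hmap : (noiseLaw Nr v).map g = noiseLaw Nr 1 := by
    rw [noiseLaw_eq_map_smul, Measure.map_map hg (by fun_prop)]
    have : (g ∘ fun x : Fin Nr → ℂ => Real.sqrt v • x) = fun x => D.Uᴴ *ᵥ x := by
      funext x
      simp only [g, Function.comp, smul_smul, inv_mul_cancel₀ hv'.ne', one_smul]
    rw [this, noiseLaw_map_unitary D.unitary_U]
  have hmetric : ∀ η s', metric D.lam (received D (C.symbol w) η) s' -
      metric D.lam (received D (C.symbol w) η) (C.symbol w) =
      v * (nsq (g η + shift Nr μ (C.symbol w - s')) - nsq (g η)) := by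
    intro η s'
    refine metric_received_sub D hv _ _ _ _ ?_
    simp only [g, Matrix.mulVec_smul, smul_smul, mul_inv_cancel₀ hv'.ne', one_smul]
  let tie : Set (Fin Nr → ℂ) := {x | ∃ j, nsq (x + shift Nr μ (diffs C w j)) = nsq x}
  have htie : noiseLaw Nr 1 tie = 0 := by
    simp only [tie, Set.ofPred_exists]
    refine measure_iUnion_null fun j => noiseLaw_tie fun h => ?_
    have h3 := nsq_eq_zero.2 h
    have hμ : ∀ m, 0 < μ m := fun m => div_pos (hlam m) hv0
    rw [nsq_shift (min_le_right _ _) fun m => (hμ m).le,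
      Finset.sum_eq_zero_iff_of_nonneg fun m _ => mul_nonneg (hμ m).le (sq_nonneg _)] at h3
    refine j.2 (hinj (sub_eq_zero.1 (funext fun m => ?_ : diffs C w j = 0))).symm
    have := h3 m (Finset.mem_univ m)
    simpa [(hμ m).ne'] using this
  have htm : MeasurableSet tie := by
    have := continuous_nsq (ι := Fin Nr)
    simp only [tie, Set.ofPred_exists]
    exact MeasurableSet.iUnion fun j => (isClosed_eq (by fun_prop) (by fun_prop)).measurableSet
  have hem := (isOpen_errSet Nr (diffs C w) μ).measurableSet
  refine le_antisymm ?_ ?_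
  · calc _ ≤ noiseLaw Nr v (g ⁻¹' (errSet Nr (diffs C w) μ ∪ tie)) := by
          refine measure_mono fun η hη => ?_
          obtain ⟨⟨w', hw'⟩, hmin⟩ := hdetect H (received D (C.symbol w) η)
          have hne : detect H (received D (C.symbol w) η) ≠ C.symbol w := hη
          rw [← hw'] at hmin hne
          have h1 := hmin (C.symbol w) ⟨w, rfl⟩
          have h2 := hmetric η (C.symbol w')
          have h3 : nsq (g η + shift Nr μ (C.symbol w - C.symbol w')) ≤ nsq (g η) := by
            rw [← sub_nonpos]
            refine nonpos_of_mul_nonpos_right ?_ hv0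
            rw [← h2]
            linarith
          have hj : w' ≠ w := fun h => hne (by rw [h])
          rcases h3.lt_or_eq with h4 | h4
          · exact Or.inl ⟨⟨w', hj⟩, h4⟩
          · exact Or.inr ⟨⟨w', hj⟩, h4⟩
      _ = noiseLaw Nr 1 (errSet Nr (diffs C w) μ ∪ tie) := by
          rw [← hmap, Measure.map_apply hg (hem.union htm)]
      _ ≤ noiseLaw Nr 1 (errSet Nr (diffs C w) μ) + noiseLaw Nr 1 tie := measure_union_le _ _
      _ = errProb Nr (diffs C w) μ := by rw [htie, add_zero]; rfl
  · rw [errProb, ← hmap, Measure.map_apply hg hem]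
    refine measure_mono fun η hη => ?_
    obtain ⟨j, hj⟩ := hη
    intro heq
    have hmin := (hdetect H (received D (C.symbol w) η)).2 (C.symbol j.1) ⟨j.1, rfl⟩
    have heq' : detect H (received D (C.symbol w) η) = C.symbol w := heq
    rw [heq'] at hmin
    have h2 := hmetric η (C.symbol j.1)
    have h3 : v * (nsq (g η + shift Nr μ (C.symbol w - C.symbol j.1)) - nsq (g η)) < 0 :=
      mul_neg_of_pos_of_neg hv0 (sub_neg.2 hj)
    rw [← h2] at h3
    linarith

end detection

end

end SLMIMO
-- Blow-up of block matrices at rank `N`: bounds on the rescaled singular values.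
namespace SLMIMO

noncomputable section

section bounds

variable {ι κ : Type*} [Fintype ι] [Fintype κ]

lemma nsq_comp_equiv (e : ι ≃ κ) (x : κ → ℂ) : nsq (x ∘ e) = nsq x :=
  Equiv.sum_comp e fun i => ‖x i‖ ^ 2

lemma nsq_sumElim (x : ι → ℂ) (y : κ → ℂ) : nsq (Sum.elim x y) = nsq x + nsq y := by
  simp [nsq]

lemma exists_nsq_mulVec_le (P : Matrix ι κ ℂ) :
    ∃ K, 0 < K ∧ ∀ y, nsq (P *ᵥ y) ≤ K * nsq y := by
  refine ⟨1 + ∑ i, (∑ j, ‖P i j‖) ^ 2, by positivity, fun y => ?_⟩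
  have h1 : nsq (P *ᵥ y) ≤ (∑ i, (∑ j, ‖P i j‖) ^ 2) * nsq y := by
    rw [nsq, Finset.sum_mul]
    refine Finset.sum_le_sum fun i _ => ?_
    have h2 : ‖(P *ᵥ y) i‖ ≤ (∑ j, ‖P i j‖) * Real.sqrt (nsq y) := by
      rw [Matrix.mulVec, dotProduct, Finset.sum_mul]
      refine (norm_sum_le _ _).trans (Finset.sum_le_sum fun j _ => ?_)
      rw [norm_mul]
      have := Real.le_sqrt_of_sq_le (norm_sq_le_nsq y j)
      gcongr
    calc ‖(P *ᵥ y) i‖ ^ 2 ≤ ((∑ j, ‖P i j‖) * Real.sqrt (nsq y)) ^ 2 := by gcongr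
      _ = _ := by rw [mul_pow, Real.sq_sqrt (nsq_nonneg _)]
  have := nsq_nonneg y
  linarith

lemma exists_le_nsq_mulVec [DecidableEq κ] {P : Matrix κ ι ℂ} {Q : Matrix ι κ ℂ}
    (h : P * Q = 1) : ∃ c, 0 < c ∧ ∀ x, c * nsq x ≤ nsq (Q *ᵥ x) := by
  obtain ⟨K, hK, hP⟩ := exists_nsq_mulVec_le P
  refine ⟨K⁻¹, inv_pos.2 hK, fun x => ?_⟩
  have := hP (Q *ᵥ x)
  rw [Matrix.mulVec_mulVec, h, Matrix.one_mulVec] at this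
  rwa [inv_mul_le_iff₀ hK]

lemma star_dotProduct_mul_conjTranspose_mulVec (Q : Matrix ι κ ℂ) (x : ι → ℂ) :
    star x ⬝ᵥ ((Q * Qᴴ) *ᵥ x) = (nsq (Qᴴ *ᵥ x) : ℂ) := by
  rw [← star_dotProduct_self, Matrix.star_mulVec, Matrix.conjTranspose_conjTranspose,
    ← Matrix.dotProduct_mulVec, Matrix.mulVec_mulVec]

end bounds

section blocks

variable {Nr Nt N a b : ℕ} (e : Fin N ⊕ Fin a ≃ Fin Nr) (f : Fin N ⊕ Fin b ≃ Fin Nt)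

/-- The matrix with the given blocks, its rows and columns being indexed through `e` and `f`. -/
def blockMat (A : Matrix (Fin N) (Fin N) ℂ) (B : Matrix (Fin N) (Fin b) ℂ)
    (C : Matrix (Fin a) (Fin N) ℂ) (D : Matrix (Fin a) (Fin b) ℂ) : Matrix (Fin Nr) (Fin Nt) ℂ :=
  (Matrix.fromBlocks A B C D).submatrix e.symm f.symm

lemma nsq_submatrix_mulVec (X : Matrix (Fin N ⊕ Fin a) (Fin N ⊕ Fin b) ℂ) (x : Fin Nt → ℂ) :
    nsq (X.submatrix e.symm f.symm *ᵥ x) = nsq (X *ᵥ (x ∘ f)) := by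
  rw [Matrix.submatrix_mulVec_equiv, nsq_comp_equiv, Equiv.symm_symm]

variable (A : Matrix (Fin N) (Fin N) ℂ) (B : Matrix (Fin N) (Fin b) ℂ)
    (C : Matrix (Fin a) (Fin N) ℂ) (T : Matrix (Fin a) (Fin b) ℂ)

/-- The blow-up at scale `δ` of the matrices of rank `N`. -/
def blowUp (δ : ℝ) : Matrix (Fin Nr) (Fin Nt) ℂ :=
  blockMat e f A B C (C * A⁻¹ * B + (δ : ℂ) • T)

/-- The lower triangular factor of a block matrix. -/
def lowerFactor : Matrix (Fin N ⊕ Fin a) (Fin N ⊕ Fin a) ℂ := Matrix.fromBlocks 1 0 (C * A⁻¹) 1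

/-- The inverse of the lower triangular factor. -/
def lowerFactorInv : Matrix (Fin N ⊕ Fin a) (Fin N ⊕ Fin a) ℂ :=
  Matrix.fromBlocks 1 0 (-(C * A⁻¹)) 1

lemma lowerFactorInv_mul : lowerFactorInv A C * lowerFactor A C = 1 := by
  simp [lowerFactor, lowerFactorInv, Matrix.fromBlocks_multiply, Matrix.fromBlocks_one]

lemma lowerFactor_mul_inv : lowerFactor A C * lowerFactorInv A C = 1 := by
  simp [lowerFactor, lowerFactorInv, Matrix.fromBlocks_multiply, Matrix.fromBlocks_one]

/-- The diagonal scaling of the first block. -/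
def scaleFst (a : ℕ) (N : ℕ) (δ : ℂ) : Matrix (Fin N ⊕ Fin a) (Fin N ⊕ Fin a) ℂ :=
  Matrix.fromBlocks (δ • 1) 0 0 1

/-- The diagonal scaling of the second block. -/
def scaleSnd (a : ℕ) (N : ℕ) (δ : ℂ) : Matrix (Fin N ⊕ Fin a) (Fin N ⊕ Fin a) ℂ :=
  Matrix.fromBlocks 1 0 0 (δ • 1)

/-- The upper triangular factor of a block matrix. -/
def upperFactor : Matrix (Fin N ⊕ Fin a) (Fin N ⊕ Fin b) ℂ := Matrix.fromBlocks A B 0 T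

variable {A} in
-- The Schur complement of `A` is `δ • T`, so block elimination isolates the whole dependence on `δ`
-- in one diagonal factor.
lemma fromBlocks_eq_mul (hA : IsUnit A.det) (δ : ℂ) :
    Matrix.fromBlocks A B C (C * A⁻¹ * B + δ • T) =
      lowerFactor A C * scaleSnd a N δ * upperFactor A B T := by
  simp [lowerFactor, scaleSnd, upperFactor, Matrix.fromBlocks_multiply, Matrix.mul_assoc,
    Matrix.nonsing_inv_mul A hA]

lemma blowUp_eq (hA : IsUnit A.det) (δ : ℝ) : blowUp e f A B C T δ =
    (lowerFactor A C * scaleSnd a N δ * upperFactor A B T).submatrix e.symm f.symm := by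
  rw [blowUp, blockMat, fromBlocks_eq_mul B C T hA]

lemma nsq_scaleSnd_mulVec {δ : ℝ} (h0 : 0 ≤ δ) (h1 : δ ≤ 1) (x : Fin N ⊕ Fin a → ℂ) :
    δ ^ 2 * nsq x ≤ nsq (scaleSnd a N δ *ᵥ x) := by
  have hx : x = Sum.elim (x ∘ Sum.inl) (x ∘ Sum.inr) := (Sum.elim_comp_inl_inr x).symm
  rw [hx, scaleSnd, Matrix.fromBlocks_mulVec, nsq_sumElim, nsq_sumElim]
  simp only [Sum.elim_comp_inl, Sum.elim_comp_inr, Matrix.one_mulVec, Matrix.zero_mulVec, add_zero,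
    zero_add, Matrix.smul_mulVec, nsq_smul, Complex.norm_real, Real.norm_of_nonneg h0]
  have := nsq_nonneg (x ∘ Sum.inl)
  have : δ ^ 2 ≤ 1 := pow_le_one₀ h0 h1
  nlinarith

section limits

variable {A} (hA : IsUnit A.det) (D : ∀ δ : ℝ, SVD (blowUp e f A B C T δ))

include hA

/-- On the `N`-dimensional space of vectors supported on the first block, the image contains `A *ᵥ
x`, which gives a lower bound for `λ_m` independent of `δ`. -/
lemma tendsto_lam_div_atTop (m : Fin (min Nt Nr)) (hm : (m : ℕ) < N) :
    Tendsto (fun δ => (D δ).lam m / δ ^ 2) (nhdsWithin 0 (Set.Ioi 0)) atTop := by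
  obtain ⟨c, hc, h⟩ := exists_le_nsq_mulVec (Matrix.nonsing_inv_mul A hA)
  have key : ∀ δ, c ≤ (D δ).lam m := by
    intro δ
    let J : (Fin N → ℂ) →ₗ[ℂ] (Fin Nt → ℂ) :=
      { toFun := fun x => Sum.elim x 0 ∘ f.symm
        map_add' := fun x y => by
          funext i
          rcases h : f.symm i <;> simp [h]
        map_smul' := fun r x => by
          funext i
          rcases h : f.symm i <;> simp [h] }
    have hJ : Function.Injective J := by
      intro x y hxy
      funext i
      have := congrFun hxy (f (Sum.inl i))
      simpa [J] using this
    refine (D δ).le_lam m (LinearMap.range J) ?_ ?_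
    · rw [LinearMap.finrank_range_of_inj hJ]
      simpa using hm
    · rintro _ ⟨x, rfl⟩
      have e1 : (J x) ∘ f = Sum.elim x 0 := by
        funext i
        simp [J]
      rw [blowUp, blockMat, nsq_submatrix_mulVec, ← nsq_comp_equiv f, e1,
        Matrix.fromBlocks_mulVec, nsq_sumElim, nsq_sumElim]
      simp only [Sum.elim_comp_inl, Sum.elim_comp_inr, Matrix.mulVec_zero, add_zero, nsq_zero]
      have := nsq_nonneg (C *ᵥ x)
      linarith [h x]
  have h1 : Tendsto (fun δ : ℝ => c * (δ⁻¹) ^ 2) (nhdsWithin 0 (Set.Ioi 0)) atTop :=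
    ((tendsto_pow_atTop two_ne_zero).comp tendsto_inv_nhdsGT_zero).const_mul_atTop hc
  refine tendsto_atTop_mono (fun δ => ?_) h1
  rw [div_eq_mul_inv, inv_pow]
  exact mul_le_mul_of_nonneg_right (key δ) (by positivity)

/-- The test space is the `b`-dimensional graph of `x ↦ -A⁻¹ B x`: the first block row kills it and
the second one maps it to `δ • T x`. -/
lemma exists_lam_div_le : ∃ K, 0 < K ∧ ∀ δ : ℝ, 0 < δ → ∀ m : Fin (min Nt Nr), N ≤ m →
    (D δ).lam m / δ ^ 2 ≤ K := by
  obtain ⟨K, hK, h⟩ := exists_nsq_mulVec_le T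
  refine ⟨K, hK, fun δ hδ m hm => ?_⟩
  rw [div_le_iff₀ (by positivity)]
  let J : (Fin b → ℂ) →ₗ[ℂ] (Fin Nt → ℂ) :=
    { toFun := fun x => Sum.elim (-(A⁻¹ *ᵥ (B *ᵥ x))) x ∘ f.symm
      map_add' := fun x y => by
        funext i
        rcases h : f.symm i <;> simp [h, Matrix.mulVec_add, add_comm]
      map_smul' := fun r x => by
        funext i
        rcases h : f.symm i <;> simp [h, Matrix.mulVec_smul] }
  have hJ : Function.Injective J := by
    intro x y hxy
    funext i
    have := congrFun hxy (f (Sum.inr i))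
    simpa [J] using this
  have hcard : Nt = N + b := by simpa using (Fintype.card_congr f).symm
  refine (D δ).lam_le m (LinearMap.range J) ?_ ?_
  · rw [LinearMap.finrank_range_of_inj hJ]
    simp only [Module.finrank_fintype_fun_eq_card, Fintype.card_fin]
    omega
  · rintro _ ⟨x, rfl⟩
    have e1 : (J x) ∘ f = Sum.elim (-(A⁻¹ *ᵥ (B *ᵥ x))) x := by
      funext i
      simp [J]
    have e2 : A * A⁻¹ = 1 := Matrix.mul_nonsing_inv A hA
    have e3 : A *ᵥ (-(A⁻¹ *ᵥ (B *ᵥ x))) + B *ᵥ x = 0 := by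
      rw [Matrix.mulVec_neg, Matrix.mulVec_mulVec, e2, Matrix.one_mulVec, neg_add_cancel]
    have e4 : C *ᵥ (-(A⁻¹ *ᵥ (B *ᵥ x))) + (C * A⁻¹ * B + (δ : ℂ) • T) *ᵥ x =
        (δ : ℂ) • (T *ᵥ x) := by
      rw [Matrix.mulVec_neg, Matrix.mulVec_mulVec, Matrix.mulVec_mulVec, Matrix.add_mulVec,
        Matrix.smul_mulVec, neg_add_cancel_left]
    rw [blowUp, blockMat, nsq_submatrix_mulVec, ← nsq_comp_equiv f (J x), e1,
      Matrix.fromBlocks_mulVec, nsq_sumElim, nsq_sumElim]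
    simp only [Sum.elim_comp_inl, Sum.elim_comp_inr, e3, e4, nsq_zero, zero_add, nsq_smul,
      Complex.norm_real, Real.norm_of_nonneg hδ.le]
    have h1 := nsq_nonneg (-(A⁻¹ *ᵥ (B *ᵥ x)))
    have h2 := h x
    have h3 : 0 ≤ K * δ ^ 2 := by positivity
    nlinarith [mul_nonneg h3 h1, mul_le_mul_of_nonneg_left h2 (sq_nonneg δ)]

/-- In the factorization only the diagonal factor degenerates, shrinking norms by at most `δ`. The
triangular factors are bounded below: directly when `T` has a left inverse, after conjugate
transposition when it has a right inverse. -/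
lemma exists_le_lam_div (hT : (∃ P : Matrix (Fin b) (Fin a) ℂ, P * T = 1) ∨
    ∃ P : Matrix (Fin b) (Fin a) ℂ, T * P = 1) :
    ∃ c, 0 < c ∧ ∀ δ : ℝ, 0 < δ → δ ≤ 1 → ∀ m : Fin (min Nt Nr),
      c ≤ (D δ).lam m / δ ^ 2 := by
  have hinv : A⁻¹ * A = 1 := Matrix.nonsing_inv_mul A hA
  have hinv' : A * A⁻¹ = 1 := Matrix.mul_nonsing_inv A hA
  rcases hT with ⟨P, hP⟩ | ⟨P, hP⟩
  · obtain ⟨c, hc, h⟩ := exists_le_nsq_mulVec (lowerFactorInv_mul A C)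
    have hG : (Matrix.fromBlocks A⁻¹ (-(A⁻¹ * B * P)) 0 P :
        Matrix (Fin N ⊕ Fin b) (Fin N ⊕ Fin a) ℂ) * upperFactor A B T = 1 := by
      simp [upperFactor, Matrix.fromBlocks_multiply, hinv, hP, Matrix.mul_assoc,
        Matrix.fromBlocks_one]
    obtain ⟨c', hc', h'⟩ := exists_le_nsq_mulVec hG
    refine ⟨c * c', mul_pos hc hc', fun δ hδ hδ1 m => ?_⟩
    rw [le_div_iff₀ (by positivity)]
    refine (D δ).le_lam m ⊤ ?_ fun x _ => ?_
    · simpa using m.isLt.trans_le (min_le_left _ _)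
    · rw [blowUp_eq e f A B C T hA, nsq_submatrix_mulVec, ← Matrix.mulVec_mulVec,
        ← Matrix.mulVec_mulVec]
      calc c * c' * δ ^ 2 * nsq x = c * (δ ^ 2 * (c' * nsq (x ∘ f))) := by
            rw [nsq_comp_equiv]; ring
        _ ≤ c * (δ ^ 2 * nsq (upperFactor A B T *ᵥ (x ∘ f))) := by
            have := h' (x ∘ f)
            gcongr
        _ ≤ c * nsq (scaleSnd a N δ *ᵥ (upperFactor A B T *ᵥ (x ∘ f))) := by
            have := nsq_scaleSnd_mulVec hδ.le hδ1 (upperFactor A B T *ᵥ (x ∘ f))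
            gcongr
        _ ≤ _ := h _
  · have hL : (lowerFactorInv A C)ᴴ * (lowerFactor A C)ᴴ = 1 := by
      rw [← Matrix.conjTranspose_mul, lowerFactor_mul_inv, Matrix.conjTranspose_one]
    obtain ⟨c, hc, h⟩ := exists_le_nsq_mulVec hL
    have hG : upperFactor A B T * (Matrix.fromBlocks A⁻¹ (-(A⁻¹ * B * P)) 0 P :
        Matrix (Fin N ⊕ Fin b) (Fin N ⊕ Fin a) ℂ) = 1 := by
      simp only [upperFactor, Matrix.fromBlocks_multiply, hinv', hP, Matrix.mul_zero,
        Matrix.zero_mul, add_zero, zero_add, Matrix.mul_neg, ← Matrix.mul_assoc, Matrix.one_mul,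
        neg_add_cancel, neg_zero, Matrix.fromBlocks_one]
    have hG' := congrArg Matrix.conjTranspose hG
    rw [Matrix.conjTranspose_mul, Matrix.conjTranspose_one] at hG'
    obtain ⟨c', hc', h'⟩ := exists_le_nsq_mulVec hG'
    refine ⟨c * c', mul_pos hc hc', fun δ hδ hδ1 m => ?_⟩
    rw [le_div_iff₀ (by positivity)]
    refine (D δ).le_lam_of_conjTranspose m fun y => ?_
    have hs : (scaleSnd a N (δ : ℂ))ᴴ = scaleSnd a N δ := by
      simp [scaleSnd, Matrix.fromBlocks_conjTranspose]
    rw [blowUp_eq e f A B C T hA, Matrix.conjTranspose_submatrix, nsq_submatrix_mulVec f e,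
      Matrix.conjTranspose_mul, Matrix.conjTranspose_mul, hs, ← Matrix.mulVec_mulVec,
      ← Matrix.mulVec_mulVec]
    calc c * c' * δ ^ 2 * nsq y = c' * (δ ^ 2 * (c * nsq (y ∘ e))) := by
          rw [nsq_comp_equiv]; ring
      _ ≤ c' * (δ ^ 2 * nsq ((lowerFactor A C)ᴴ *ᵥ (y ∘ e))) := by
          have := h (y ∘ e)
          gcongr
      _ ≤ c' * nsq (scaleSnd a N δ *ᵥ ((lowerFactor A C)ᴴ *ᵥ (y ∘ e))) := by
          have := nsq_scaleSnd_mulVec hδ.le hδ1 ((lowerFactor A C)ᴴ *ᵥ (y ∘ e))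
          gcongr
      _ ≤ _ := h' _

end limits

end blocks

end

end SLMIMO
-- Convergence of the resolvent and of the rescaled singular values.
namespace SLMIMO

noncomputable section

section limits

variable {Nr Nt N a b : ℕ} (e : Fin N ⊕ Fin a ≃ Fin Nr) (f : Fin N ⊕ Fin b ≃ Fin Nt)
  {A : Matrix (Fin N) (Fin N) ℂ} (B : Matrix (Fin N) (Fin b) ℂ)
  (C : Matrix (Fin a) (Fin N) ℂ) (T : Matrix (Fin a) (Fin b) ℂ)

variable (A) in
/-- The core of the resolvent of the blow-up, which stays invertible at scale `0`. -/
def resolventCore (δ : ℂ) : Matrix (Fin N ⊕ Fin a) (Fin N ⊕ Fin a) ℂ :=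
  (scaleFst a N δ * lowerFactorInv A C) * ((lowerFactorInv A C)ᴴ * scaleFst a N δ) +
    upperFactor A B T * (upperFactor A B T)ᴴ

/-- At `δ = 0` the core is a sum of two positive semidefinite matrices. A kernel vector is killed by
both: the first one annihilates its second block, and then `Aᴴ` annihilates its first block. -/
lemma resolventCore_det_ne_zero (hA : IsUnit A.det) : (resolventCore A B C T 0).det ≠ 0 := by
  intro hdet
  obtain ⟨x, hx0, hx⟩ := Matrix.exists_mulVec_eq_zero_iff.2 hdet
  apply hx0
  have hs : (scaleFst a N 0)ᴴ = scaleFst a N 0 := by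
    simp [scaleFst, Matrix.fromBlocks_conjTranspose]
  have hQ : (lowerFactorInv A C)ᴴ * scaleFst a N 0 =
      (scaleFst a N 0 * lowerFactorInv A C)ᴴ := by rw [Matrix.conjTranspose_mul, hs]
  have h1 : star x ⬝ᵥ (resolventCore A B C T 0 *ᵥ x) = 0 := by rw [hx, dotProduct_zero]
  rw [resolventCore, hQ, Matrix.add_mulVec, dotProduct_add,
    star_dotProduct_mul_conjTranspose_mulVec, star_dotProduct_mul_conjTranspose_mulVec] at h1
  have h2 : nsq ((scaleFst a N 0 * lowerFactorInv A C)ᴴ *ᵥ x) +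
      nsq ((upperFactor A B T)ᴴ *ᵥ x) = 0 := by exact_mod_cast h1
  have h3 := nsq_nonneg ((scaleFst a N 0 * lowerFactorInv A C)ᴴ *ᵥ x)
  have h4 := nsq_nonneg ((upperFactor A B T)ᴴ *ᵥ x)
  have h5 : (scaleFst a N 0 * lowerFactorInv A C)ᴴ *ᵥ x = 0 := nsq_eq_zero.1 (by linarith)
  have h6 : (upperFactor A B T)ᴴ *ᵥ x = 0 := nsq_eq_zero.1 (by linarith)
  have h7 : scaleFst a N 0 *ᵥ x = 0 := by
    have : (lowerFactor A C)ᴴ * (lowerFactorInv A C)ᴴ = 1 := by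
      rw [← Matrix.conjTranspose_mul, lowerFactorInv_mul, Matrix.conjTranspose_one]
    rw [← hQ] at h5
    have h8 := congrArg ((lowerFactor A C)ᴴ *ᵥ ·) h5
    simpa only [Matrix.mulVec_mulVec, ← Matrix.mul_assoc, this, Matrix.one_mul,
      Matrix.mulVec_zero] using h8
  have hx' : x = Sum.elim (x ∘ Sum.inl) (x ∘ Sum.inr) := (Sum.elim_comp_inl_inr x).symm
  have h9 : x ∘ Sum.inr = 0 := by
    rw [hx', scaleFst, Matrix.fromBlocks_mulVec] at h7
    funext i
    simpa using congrFun h7 (Sum.inr i)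
  have h10 : x ∘ Sum.inl = 0 := by
    rw [upperFactor, Matrix.fromBlocks_conjTranspose, hx', Matrix.fromBlocks_mulVec] at h6
    have h11 : Aᴴ *ᵥ (x ∘ Sum.inl) = 0 := by
      funext i
      simpa using congrFun h6 (Sum.inl i)
    have h12 : IsUnit Aᴴ.det := by
      rw [Matrix.det_conjTranspose]
      exact hA.star
    have h13 := congrArg ((Aᴴ)⁻¹ *ᵥ ·) h11
    simpa only [Matrix.mulVec_mulVec, Matrix.nonsing_inv_mul _ h12, Matrix.one_mulVec,
      Matrix.mulVec_zero] using h13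
  rw [hx', h9, h10]
  simp

lemma continuous_scaleFst (a N : ℕ) : Continuous fun δ : ℂ => scaleFst a N δ := by
  unfold scaleFst
  exact Continuous.matrix_fromBlocks (continuous_id.smul continuous_const) continuous_const
    continuous_const continuous_const

lemma continuous_resolventCore : Continuous (resolventCore A B C T) := by
  unfold resolventCore
  have := continuous_scaleFst a N
  exact ((this.matrix_mul continuous_const).matrix_mul
    (continuous_const.matrix_mul this)).add continuous_const

/-- Since `scaleSnd` times `scaleFst` is `δ • 1`, the identity can be pulled inside the outer
factors of `H * Hᴴ`. All negative powers of `δ` then cancel in the inverse, leaving an expression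
with a limit at `δ = 0`. -/
lemma resolvent_blowUp (hA : IsUnit A.det) {δ : ℝ} (hδ : 0 < δ)
    (hdet : (resolventCore A B C T δ).det ≠ 0) :
    (1 + (((δ ^ 2)⁻¹ : ℝ) : ℂ) • (blowUp e f A B C T δ * (blowUp e f A B C T δ)ᴴ))⁻¹ =
      ((lowerFactorInv A C)ᴴ * scaleFst a N δ * (resolventCore A B C T δ)⁻¹ *
        (scaleFst a N δ * lowerFactorInv A C)).submatrix e.symm e.symm := by
  set Li := lowerFactorInv A C
  set Lo := lowerFactor A C
  set G := upperFactor A B T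
  set S := scaleFst a N (δ : ℂ)
  set R := scaleSnd a N (δ : ℂ)
  set K := resolventCore A B C T δ with hK
  have hδ0 : (δ : ℂ) ≠ 0 := by exact_mod_cast hδ.ne'
  have hRS : R * S = (δ : ℂ) • 1 := by
    simp [R, S, scaleFst, scaleSnd, Matrix.fromBlocks_multiply, ← Matrix.fromBlocks_one,
      Matrix.fromBlocks_smul]
  have hSR : S * R = (δ : ℂ) • 1 := by
    simp [R, S, scaleFst, scaleSnd, Matrix.fromBlocks_multiply, ← Matrix.fromBlocks_one,
      Matrix.fromBlocks_smul]
  have hR : Rᴴ = R := by simp [R, scaleSnd, Matrix.fromBlocks_conjTranspose]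
  have hLL : Lo * Li = 1 := lowerFactor_mul_inv A C
  have hLL' : Li * Lo = 1 := lowerFactorInv_mul A C
  have hLLc : Liᴴ * Loᴴ = 1 := by rw [← Matrix.conjTranspose_mul, hLL, Matrix.conjTranspose_one]
  have hLLc' : Loᴴ * Liᴴ = 1 := by rw [← Matrix.conjTranspose_mul, hLL', Matrix.conjTranspose_one]
  have hKK : K * K⁻¹ = 1 := Matrix.mul_nonsing_inv _ (isUnit_iff_ne_zero.2 hdet)
  have hmain : 1 + ((δ : ℂ) ^ 2)⁻¹ • ((Lo * R * G) * (Lo * R * G)ᴴ) =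
      ((δ : ℂ) ^ 2)⁻¹ • (Lo * R * K * (R * Loᴴ)) := by
    have h1 : Lo * R * ((S * Li) * (Liᴴ * S)) * (R * Loᴴ) = (δ : ℂ) ^ 2 • 1 := by
      calc _ = Lo * (R * S) * Li * Liᴴ * (S * R) * Loᴴ := by simp only [Matrix.mul_assoc]
        _ = ((δ : ℂ) * δ) • ((Lo * Li) * (Liᴴ * Loᴴ)) := by
          rw [hRS, hSR]
          simp only [Matrix.mul_smul, Matrix.smul_mul, Matrix.mul_one, Matrix.mul_assoc, smul_smul]
        _ = _ := by rw [hLL, hLLc, Matrix.mul_one, sq]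
    have h2 : (Lo * R * G) * (Lo * R * G)ᴴ = Lo * R * (G * Gᴴ) * (R * Loᴴ) := by
      simp only [Matrix.conjTranspose_mul, hR, Matrix.mul_assoc]
    rw [h2, hK, resolventCore, Matrix.mul_add, Matrix.add_mul, smul_add]
    congr 1
    rw [h1, smul_smul, inv_mul_cancel₀ (pow_ne_zero 2 hδ0), one_smul]
  have hprod : (1 + ((δ : ℂ) ^ 2)⁻¹ • ((Lo * R * G) * (Lo * R * G)ᴴ)) *
      (Liᴴ * S * K⁻¹ * (S * Li)) = 1 := by
    rw [hmain, Matrix.smul_mul]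
    have h3 : Lo * R * K * (R * Loᴴ) * (Liᴴ * S * K⁻¹ * (S * Li)) = (δ : ℂ) ^ 2 • 1 := by
      calc _ = Lo * R * K * R * (Loᴴ * Liᴴ) * S * K⁻¹ * (S * Li) := by
            simp only [Matrix.mul_assoc]
        _ = Lo * R * K * (R * S) * K⁻¹ * (S * Li) := by
            rw [hLLc', Matrix.mul_one]; simp only [Matrix.mul_assoc]
        _ = (δ : ℂ) • (Lo * R * (K * K⁻¹) * (S * Li)) := by
            rw [hRS]
            simp only [Matrix.mul_smul, Matrix.smul_mul, Matrix.mul_one, Matrix.mul_assoc]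
        _ = (δ : ℂ) • (Lo * (R * S) * Li) := by
            rw [hKK, Matrix.mul_one]; simp only [Matrix.mul_assoc]
        _ = _ := by
            rw [hRS]
            simp only [Matrix.mul_smul, Matrix.smul_mul, Matrix.mul_one, hLL, smul_smul, sq]
    rw [h3, smul_smul, inv_mul_cancel₀ (pow_ne_zero 2 hδ0), one_smul]
  have hpush : ((((δ ^ 2)⁻¹ : ℝ)) : ℂ) = ((δ : ℂ) ^ 2)⁻¹ := by push_cast; rfl
  rw [blowUp_eq e f A B C T hA, Matrix.conjTranspose_submatrix, Matrix.submatrix_mul_equiv, hpush]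
  apply Matrix.inv_eq_right_inv
  have h4 : (1 : Matrix (Fin Nr) (Fin Nr) ℂ) + ((δ : ℂ) ^ 2)⁻¹ •
      ((Lo * R * G) * (Lo * R * G)ᴴ).submatrix e.symm e.symm =
      (1 + ((δ : ℂ) ^ 2)⁻¹ • ((Lo * R * G) * (Lo * R * G)ᴴ)).submatrix e.symm e.symm := by
    rw [← Matrix.submatrix_one_equiv e.symm]
    rfl
  rw [h4, Matrix.submatrix_mul_equiv, hprod, Matrix.submatrix_one_equiv]

lemma exists_tendsto_resolvent (hA : IsUnit A.det) :
    ∃ K : Matrix (Fin Nr) (Fin Nr) ℂ, Tendsto (fun δ : ℝ =>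
      (1 + (((δ ^ 2)⁻¹ : ℝ) : ℂ) • (blowUp e f A B C T δ * (blowUp e f A B C T δ)ᴴ))⁻¹)
      (nhdsWithin 0 (Set.Ioi 0)) (nhds K) := by
  have hcore : Tendsto (fun δ : ℝ => resolventCore A B C T δ) (nhdsWithin 0 (Set.Ioi 0))
      (nhds (resolventCore A B C T 0)) := by
    have h := ((continuous_resolventCore B C T (A := A)).comp Complex.continuous_ofReal).tendsto 0
    simp only [Function.comp_def, Complex.ofReal_zero] at h
    exact h.mono_left nhdsWithin_le_nhds
  have hdet : Tendsto (fun δ : ℝ => (resolventCore A B C T δ).det) (nhdsWithin 0 (Set.Ioi 0))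
      (nhds (resolventCore A B C T 0).det) :=
    ((continuous_id.matrix_det).tendsto _).comp hcore
  have hne := resolventCore_det_ne_zero B C T hA
  have hinv : Tendsto (fun δ : ℝ => (resolventCore A B C T δ)⁻¹) (nhdsWithin 0 (Set.Ioi 0))
      (nhds (resolventCore A B C T 0)⁻¹) := by
    simp only [Matrix.inv_def, Ring.inverse_eq_inv']
    exact (hdet.inv₀ hne).smul (((continuous_id.matrix_adjugate).tendsto _).comp hcore)
  have hs : Tendsto (fun δ : ℝ => scaleFst a N (δ : ℂ)) (nhdsWithin 0 (Set.Ioi 0))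
      (nhds (scaleFst a N 0)) := by
    have h := ((continuous_scaleFst a N).comp Complex.continuous_ofReal).tendsto 0
    simp only [Function.comp_def, Complex.ofReal_zero] at h
    exact h.mono_left nhdsWithin_le_nhds
  have hmul : ∀ {F G : ℝ → Matrix (Fin N ⊕ Fin a) (Fin N ⊕ Fin a) ℂ} {F₀ G₀},
      Tendsto F (nhdsWithin 0 (Set.Ioi 0)) (nhds F₀) →
      Tendsto G (nhdsWithin 0 (Set.Ioi 0)) (nhds G₀) →
      Tendsto (fun δ => F δ * G δ) (nhdsWithin 0 (Set.Ioi 0)) (nhds (F₀ * G₀)) :=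
    fun hF hG => hF.mul hG
  have hlim := hmul (hmul (hmul (tendsto_const_nhds (x := (lowerFactorInv A C)ᴴ)) hs) hinv)
    (hmul hs (tendsto_const_nhds (x := lowerFactorInv A C)))
  refine ⟨_, Tendsto.congr' ?_
    (((continuous_id.matrix_submatrix e.symm e.symm).tendsto _).comp hlim)⟩
  filter_upwards [hdet.eventually_ne hne, self_mem_nhdsWithin] with δ h1 h2
  exact (resolvent_blowUp e f B C T hA h2 h1).symm

lemma exists_tendsto_of_dist_le {l : Filter ℝ} [l.NeBot] {x G : ℝ → ℝ}
    (hG : Tendsto G l (nhds 0)) {s : Set ℝ} (hs : s ∈ l)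
    (h : ∀ δ ∈ s, ∀ δ' ∈ s, |x δ - x δ'| ≤ G δ + G δ') : ∃ κ, Tendsto x l (nhds κ) := by
  rw [← cauchy_map_iff_exists_tendsto, Metric.cauchy_iff]
  refine ⟨inferInstance, fun ε hε => ⟨x '' (s ∩ {δ | G δ < ε / 2}), image_mem_map
    (inter_mem hs (hG.eventually_lt_const (half_pos hε))), ?_⟩⟩
  rintro _ ⟨δ, hδ, rfl⟩ _ ⟨δ', hδ', rfl⟩
  have h1 := h δ hδ.1 δ' hδ'.1
  have h2 : G δ < ε / 2 := hδ.2
  have h3 : G δ' < ε / 2 := hδ'.2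
  rw [Real.dist_eq]
  linarith

/-- The resolvents converge, so by the Lipschitz bound their eigenvalues `(1 + λ_m / δ²)⁻¹` are
Cauchy; the limit `κ` need not be identified. The upper bound on `λ_m / δ²` keeps `κ` away from `0`,
and the lower bound makes `κ⁻¹ - 1` positive. -/
lemma exists_tendsto_lam_div (hA : IsUnit A.det) (D : ∀ δ : ℝ, SVD (blowUp e f A B C T δ))
    (hT : (∃ P : Matrix (Fin b) (Fin a) ℂ, P * T = 1) ∨
      ∃ P : Matrix (Fin b) (Fin a) ℂ, T * P = 1) (m : Fin (min Nt Nr)) (hm : N ≤ m) :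
    ∃ μ, 0 < μ ∧ Tendsto (fun δ => (D δ).lam m / δ ^ 2) (nhdsWithin 0 (Set.Ioi 0)) (nhds μ) := by
  obtain ⟨K, hK⟩ := exists_tendsto_resolvent e f B C T hA
  obtain ⟨c₁, hc₁, h₁⟩ := exists_lam_div_le e f B C T hA D
  obtain ⟨c₂, hc₂, h₂⟩ := exists_le_lam_div e f B C T hA D hT
  let F : ℝ → Matrix (Fin Nr) (Fin Nr) ℂ := fun δ =>
    (1 + (((δ ^ 2)⁻¹ : ℝ) : ℂ) • (blowUp e f A B C T δ * (blowUp e f A B C T δ)ᴴ))⁻¹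
  have hG : Tendsto (fun δ => entrySum (F δ - K)) (nhdsWithin 0 (Set.Ioi 0)) (nhds 0) := by
    have hc : Continuous (entrySum : Matrix (Fin Nr) (Fin Nr) ℂ → ℝ) := by
      unfold entrySum
      fun_prop
    have h := (hc.tendsto (K - K)).comp (hK.sub (tendsto_const_nhds (x := K)))
    have h0 : entrySum (K - K) = 0 := by simp [entrySum]
    rwa [h0] at h
  have htri : ∀ X Y : Matrix (Fin Nr) (Fin Nr) ℂ,
      entrySum (X - Y) ≤ entrySum (X - K) + entrySum (Y - K) := by
    intro X Y
    unfold entrySum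
    rw [← Finset.sum_add_distrib]
    refine Finset.sum_le_sum fun i _ => ?_
    rw [← Finset.sum_add_distrib]
    refine Finset.sum_le_sum fun j _ => ?_
    have : (X - Y) i j = (X - K) i j - (Y - K) i j := by simp
    rw [this]
    exact norm_sub_le _ _
  obtain ⟨κ, hκ⟩ := exists_tendsto_of_dist_le (x := fun δ => (1 + (D δ).lam m / δ ^ 2)⁻¹) hG
    self_mem_nhdsWithin (fun δ hδ δ' hδ' =>
      ((D δ).abs_inv_one_add_lam_sub_le (D δ') (pow_pos hδ 2) (pow_pos hδ' 2) m).trans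
        (htri _ _))
  have hκ1 : (1 + c₁)⁻¹ ≤ κ := by
    refine ge_of_tendsto hκ ?_
    filter_upwards [self_mem_nhdsWithin] with δ hδ
    have h3 := h₁ δ hδ m hm
    have h4 : 0 ≤ (D δ).lam m / δ ^ 2 := div_nonneg ((D δ).lam_nonneg m) (sq_nonneg δ)
    gcongr
  have hκ0 : 0 < κ := lt_of_lt_of_le (by positivity) hκ1
  have hlim : Tendsto (fun δ => (D δ).lam m / δ ^ 2) (nhdsWithin 0 (Set.Ioi 0))
      (nhds (κ⁻¹ - 1)) := by
    have h5 := (hκ.inv₀ hκ0.ne').sub_const 1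
    simpa using h5
  refine ⟨κ⁻¹ - 1, lt_of_lt_of_le hc₂ (ge_of_tendsto hlim ?_), hlim⟩
  filter_upwards [Ioc_mem_nhdsGT (zero_lt_one' ℝ)] with δ hδ
  exact h₂ δ hδ.1 hδ.2 m

end limits

/-! ### Lower bound for a singular value by a quotient of minors. -/

section minors

variable {Nr Nt : ℕ}

/-- The entries of the adjugate of an `(N + 1) × (N + 1)` submatrix `X` are, up to sign, `N × N`
minors, hence at most `R`. So `adj X * X = det X` bounds `X` from below, and with it `H` on a
coordinate subspace of dimension `N + 1`. -/
lemma det_sq_le_mul_lam {N : ℕ} {H : Matrix (Fin Nr) (Fin Nt) ℂ} (D : SVD H)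
    (m : Fin (min Nt Nr)) (hm : (m : ℕ) = N) {r : Fin (N + 1) → Fin Nr} {c : Fin (N + 1) → Fin Nt}
    (hr : Function.Injective r) (hc : Function.Injective c) {R : ℝ}
    (hR : ∀ (p : Fin N → Fin Nr) (q : Fin N → Fin Nt), ‖(H.submatrix p q).det‖ ≤ R) (hR0 : 0 < R) :
    ‖(H.submatrix r c).det‖ ^ 2 ≤ (N + 1) ^ 2 * R ^ 2 * D.lam m := by
  set X := H.submatrix r c with hX
  have hadj : ∀ i j, ‖X.adjugate i j‖ ≤ R := by
    intro i j
    rw [Matrix.adjugate_fin_succ_eq_det_submatrix, norm_mul, norm_pow, norm_neg, norm_one, one_pow,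
      one_mul, hX, Matrix.submatrix_submatrix]
    exact hR _ _
  have hcoord : ∀ (x : Fin (N + 1) → ℂ) i, ‖X.det‖ ^ 2 * ‖x i‖ ^ 2 ≤
      (N + 1) * R ^ 2 * nsq (X *ᵥ x) := by
    intro x i
    have h1 : X.det * x i = ∑ j, X.adjugate i j * (X *ᵥ x) j := by
      have h2 : X.adjugate *ᵥ (X *ᵥ x) = X.det • x := by
        rw [Matrix.mulVec_mulVec, Matrix.adjugate_mul, Matrix.smul_mulVec, Matrix.one_mulVec]
      exact (congrFun h2 i).symm
    have h3 : ‖X.det * x i‖ ≤ R * ∑ j, ‖(X *ᵥ x) j‖ := by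
      rw [h1, Finset.mul_sum]
      refine (norm_sum_le _ _).trans (Finset.sum_le_sum fun j _ => ?_)
      rw [norm_mul]
      exact mul_le_mul_of_nonneg_right (hadj i j) (norm_nonneg _)
    have h4 : (∑ j, ‖(X *ᵥ x) j‖) ^ 2 ≤ (N + 1) * nsq (X *ᵥ x) := by
      have := sq_sum_le_card_mul_sum_sq (s := Finset.univ) (f := fun j => ‖(X *ᵥ x) j‖)
      simpa [nsq] using this
    calc ‖X.det‖ ^ 2 * ‖x i‖ ^ 2 = ‖X.det * x i‖ ^ 2 := by rw [norm_mul, mul_pow]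
      _ ≤ (R * ∑ j, ‖(X *ᵥ x) j‖) ^ 2 := by gcongr
      _ = R ^ 2 * (∑ j, ‖(X *ᵥ x) j‖) ^ 2 := mul_pow _ _ _
      _ ≤ R ^ 2 * ((N + 1) * nsq (X *ᵥ x)) := by gcongr
      _ = _ := by ring
  have hsum : ∀ x : Fin (N + 1) → ℂ,
      ‖X.det‖ ^ 2 * nsq x ≤ (N + 1) ^ 2 * R ^ 2 * nsq (X *ᵥ x) := by
    intro x
    have h1 := Finset.sum_le_sum fun i (_ : i ∈ Finset.univ) => hcoord x i
    rw [← Finset.mul_sum, Finset.sum_const, Finset.card_univ, Fintype.card_fin, nsmul_eq_mul] at h1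
    refine h1.trans (le_of_eq ?_)
    push_cast
    ring
  have hpos : 0 < ((N : ℝ) + 1) ^ 2 * R ^ 2 := by positivity
  rw [← div_le_iff₀' hpos]
  let J : (Fin (N + 1) → ℂ) →ₗ[ℂ] (Fin Nt → ℂ) :=
    { toFun := fun x => Function.extend c x 0
      map_add' := fun x y => by
        have := Function.extend_add c x y (0 : Fin Nt → ℂ) 0
        simpa using this
      map_smul' := fun t x => by
        have := Function.extend_smul t c x (0 : Fin Nt → ℂ)
        simpa using this }
  have hJ : ∀ x i, J x (c i) = x i := fun x i => hc.extend_apply _ _ _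
  have hJ0 : ∀ x j, (¬∃ i, c i = j) → J x j = 0 := fun x j hj => by
    simp [J, Function.extend_apply' _ _ _ hj]
  have hJinj : Function.Injective J := fun x y hxy => funext fun i => by
    rw [← hJ x i, hxy, hJ]
  have hJsum : ∀ (x : Fin (N + 1) → ℂ) (g : Fin Nt → ℂ → ℂ), (∀ j, g j 0 = 0) →
      ∑ j, g j (J x j) = ∑ i, g (c i) (x i) := by
    intro x g hg
    symm
    refine Finset.sum_of_injOn c hc.injOn (by simp) (fun j _ hj => ?_) fun i _ => by rw [hJ]
    rw [hJ0 x j (by simpa using hj), hg]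
  have hJnsq : ∀ x, nsq (J x) = nsq x := by
    intro x
    have := hJsum x (fun _ z => ((‖z‖ ^ 2 : ℝ) : ℂ)) (by simp)
    unfold nsq
    exact_mod_cast this
  refine D.le_lam m (LinearMap.range J) ?_ ?_
  · rw [LinearMap.finrank_range_of_inj hJinj, hm]
    simp
  · rintro _ ⟨x, rfl⟩
    have h1 : X *ᵥ x = (H *ᵥ J x) ∘ r := by
      funext i
      simp only [Function.comp, Matrix.mulVec, dotProduct]
      exact (hJsum x (fun j z => H (r i) j * z) (by simp)).symm
    have h2 : nsq (X *ᵥ x) ≤ nsq (H *ᵥ J x) := by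
      rw [h1]
      have := Finset.sum_map Finset.univ ⟨r, hr⟩ fun i => ‖(H *ᵥ J x) i‖ ^ 2
      refine (le_of_eq this.symm).trans ?_
      exact Finset.sum_le_univ_sum_of_nonneg fun _ => sq_nonneg _
    rw [hJnsq, div_mul_eq_mul_div, div_le_iff₀ hpos]
    calc _ ≤ (N + 1) ^ 2 * R ^ 2 * nsq (X *ᵥ x) := hsum x
      _ ≤ (N + 1) ^ 2 * R ^ 2 * nsq (H *ᵥ J x) := by gcongr
      _ = _ := by ring

end minors

end

end SLMIMO
-- Generic full rank.
namespace SLMIMO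

noncomputable section

section generic

/-- Moving in a direction `E` whose selected submatrix is the identity turns the minor into a
characteristic polynomial in `t`, so each line contains finitely many zeros. -/
lemma ae_det_submatrix_ne_zero {a b r : ℕ} {p : Fin r → Fin a} {q : Fin r → Fin b}
    (hp : Function.Injective p) (hq : Function.Injective q) :
    ∀ᵐ T : Fin a → Fin b → ℂ, ((Matrix.of T).submatrix p q).det ≠ 0 := by
  rw [ae_iff]
  simp only [not_not]
  let E : Fin a → Fin b → ℂ := fun x y => ∑ i, if x = p i ∧ y = q i then 1 else 0
  have hE : (Matrix.of E).submatrix p q = 1 := by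
    ext i j
    simp only [Matrix.submatrix_apply, Matrix.of_apply, E, hp.eq_iff, hq.eq_iff, Matrix.one_apply]
    rw [Finset.sum_eq_single i]
    · simp [eq_comm]
    · intro k _ hk
      rw [if_neg]
      exact fun h => hk h.1.symm
    · simp
  have hc : Continuous fun T : Fin a → Fin b → ℂ => ((Matrix.of T).submatrix p q).det :=
    Continuous.matrix_det (continuous_matrix fun i j =>
      (continuous_apply (q j)).comp (continuous_apply (p i)))
  refine measure_eq_zero_of_countable_lines volume
    (isClosed_eq hc continuous_const).measurableSet E fun T => ?_
  set X := (Matrix.of T).submatrix p q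
  have h1 : ∀ t : ℝ, ((Matrix.of (T + t • E)).submatrix p q).det = (-X).charpoly.eval (t : ℂ) := by
    intro t
    rw [Matrix.eval_charpoly]
    congr 1
    have h2 : (Matrix.of (T + t • E)).submatrix p q =
        X + (t : ℂ) • (Matrix.of E).submatrix p q := by
      ext i j
      simp [X]
    rw [h2, hE, sub_neg_eq_add, add_comm]
    congr 1
    ext i j
    simp [Matrix.one_apply, Matrix.scalar_apply, Matrix.diagonal_apply]
  have hfin : {z : ℂ | (-X).charpoly.IsRoot z}.Finite :=
    Polynomial.finite_setOfPred_isRoot (Matrix.charpoly_monic _).ne_zero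
  refine (hfin.preimage (f := fun t : ℝ => (t : ℂ))
    Complex.ofReal_injective.injOn).countable.mono fun t ht => ?_
  have h3 : ((Matrix.of (T + t • E)).submatrix p q).det = 0 := ht
  rw [h1] at h3
  exact h3

lemma ae_exists_inverse (a b : ℕ) : ∀ᵐ T : Fin a → Fin b → ℂ,
    (∃ P : Matrix (Fin b) (Fin a) ℂ, P * Matrix.of T = 1) ∨
      ∃ P : Matrix (Fin b) (Fin a) ℂ, Matrix.of T * P = 1 := by
  rcases le_total a b with hab | hab
  · filter_upwards [ae_det_submatrix_ne_zero (Function.injective_id (α := Fin a))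
      (Fin.castLE_injective hab)] with T hT
    right
    refine ⟨(1 : Matrix (Fin b) (Fin b) ℂ).submatrix id (Fin.castLE hab) *
      ((Matrix.of T).submatrix id (Fin.castLE hab))⁻¹, ?_⟩
    have h1 : Matrix.of T * (1 : Matrix (Fin b) (Fin b) ℂ).submatrix id (Fin.castLE hab) =
        (Matrix.of T).submatrix id (Fin.castLE hab) := by
      ext i j
      simp [Matrix.mul_apply, Matrix.one_apply]
    rw [← Matrix.mul_assoc, h1, Matrix.mul_nonsing_inv _ (isUnit_iff_ne_zero.2 hT)]
  · filter_upwards [ae_det_submatrix_ne_zero (Fin.castLE_injective hab)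
      (Function.injective_id (α := Fin b))] with T hT
    left
    refine ⟨((Matrix.of T).submatrix (Fin.castLE hab) id)⁻¹ *
      (1 : Matrix (Fin a) (Fin a) ℂ).submatrix (Fin.castLE hab) id, ?_⟩
    have h1 : (1 : Matrix (Fin a) (Fin a) ℂ).submatrix (Fin.castLE hab) id * Matrix.of T =
        (Matrix.of T).submatrix (Fin.castLE hab) id := by
      ext i j
      simp [Matrix.mul_apply, Matrix.one_apply]
    rw [Matrix.mul_assoc, h1, Matrix.nonsing_inv_mul _ (isUnit_iff_ne_zero.2 hT)]

lemma ae_lam_pos {Nr Nt : ℕ} (svd : ∀ H : Matrix (Fin Nr) (Fin Nt) ℂ, SVD H) :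
    ∀ᵐ h : Fin Nr → Fin Nt → ℂ, ∀ m, 0 < (svd (Matrix.of h)).lam m := by
  filter_upwards [ae_exists_inverse Nr Nt] with h hh m
  rcases hh with ⟨P, hP⟩ | ⟨P, hP⟩
  · obtain ⟨c, hc, hle⟩ := exists_le_nsq_mulVec hP
    refine hc.trans_le ((svd _).le_lam m ⊤ ?_ fun x _ => hle x)
    simpa using m.isLt.trans_le (min_le_left _ _)
  · have hP' := congrArg Matrix.conjTranspose hP
    rw [Matrix.conjTranspose_mul, Matrix.conjTranspose_one] at hP'
    obtain ⟨c, hc, hle⟩ := exists_le_nsq_mulVec hP'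
    exact hc.trans_le ((svd _).le_lam_of_conjTranspose m hle)

end generic

/-! ### Partition of unity by minors and its decay in the blow-up coordinate. -/

section weights

variable {Nr Nt : ℕ}

/-- The sum of the `2 s`-th powers of the absolute values of the minors of size `N`. -/
def minorSum (N s : ℕ) (h : Fin Nr → Fin Nt → ℂ) : ℝ :=
  ∑ p : Fin N → Fin Nr, ∑ q : Fin N → Fin Nt, ‖((Matrix.of h).submatrix p q).det‖ ^ (2 * s)

/-- The relative weight of a minor. -/
def minorWeight {N : ℕ} (s : ℕ) (p : Fin N → Fin Nr) (q : Fin N → Fin Nt)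
    (h : Fin Nr → Fin Nt → ℂ) : ℝ :=
  ‖((Matrix.of h).submatrix p q).det‖ ^ (2 * s) / minorSum N s h

variable {N : ℕ} (s : ℕ)

lemma minorSum_nonneg (h : Fin Nr → Fin Nt → ℂ) : 0 ≤ minorSum N s h := by
  unfold minorSum
  positivity

lemma minorWeight_nonneg (p : Fin N → Fin Nr) (q : Fin N → Fin Nt) (h : Fin Nr → Fin Nt → ℂ) :
    0 ≤ minorWeight s p q h :=
  div_nonneg (by positivity) (minorSum_nonneg s h)

lemma pow_norm_det_le_minorSum (p : Fin N → Fin Nr) (q : Fin N → Fin Nt)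
    (h : Fin Nr → Fin Nt → ℂ) :
    ‖((Matrix.of h).submatrix p q).det‖ ^ (2 * s) ≤ minorSum N s h := by
  unfold minorSum
  calc _ ≤ ∑ q : Fin N → Fin Nt, ‖((Matrix.of h).submatrix p q).det‖ ^ (2 * s) :=
        Finset.single_le_sum (f := fun q : Fin N → Fin Nt =>
          ‖((Matrix.of h).submatrix p q).det‖ ^ (2 * s)) (fun _ _ => by positivity)
          (Finset.mem_univ q)
    _ ≤ _ := Finset.single_le_sum (f := fun p : Fin N → Fin Nr => ∑ q : Fin N → Fin Nt,
          ‖((Matrix.of h).submatrix p q).det‖ ^ (2 * s)) (fun _ _ => by positivity)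
          (Finset.mem_univ p)

lemma minorWeight_le_one (p : Fin N → Fin Nr) (q : Fin N → Fin Nt) (h : Fin Nr → Fin Nt → ℂ) :
    minorWeight s p q h ≤ 1 :=
  div_le_one_of_le₀ (pow_norm_det_le_minorSum s p q h) (minorSum_nonneg s h)

lemma continuous_minor (p : Fin N → Fin Nr) (q : Fin N → Fin Nt) :
    Continuous fun h : Fin Nr → Fin Nt → ℂ => ((Matrix.of h).submatrix p q).det :=
  Continuous.matrix_det (continuous_matrix fun i j =>
    (continuous_apply (q j)).comp (continuous_apply (p i)))

lemma continuous_minorSum : Continuous (minorSum N s : (Fin Nr → Fin Nt → ℂ) → ℝ) := by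
  unfold minorSum
  exact continuous_finsetSum _ fun p _ => continuous_finsetSum _ fun q _ =>
    (continuous_minor p q).norm.pow _

lemma measurable_minorWeight (p : Fin N → Fin Nr) (q : Fin N → Fin Nt) :
    Measurable (minorWeight s p q : (Fin Nr → Fin Nt → ℂ) → ℝ) :=
  ((continuous_minor p q).norm.pow _).measurable.div (continuous_minorSum s).measurable

lemma continuousAt_minorWeight (p : Fin N → Fin Nr) (q : Fin N → Fin Nt)
    {h : Fin Nr → Fin Nt → ℂ} (hh : minorSum N s h ≠ 0) : ContinuousAt (minorWeight s p q) h :=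
  ((continuous_minor p q).norm.pow _).continuousAt.div (continuous_minorSum s).continuousAt hh

lemma sum_minorWeight {h : Fin Nr → Fin Nt → ℂ} (hh : minorSum N s h ≠ 0) :
    ∑ p : Fin N → Fin Nr, ∑ q : Fin N → Fin Nt, minorWeight s p q h = 1 := by
  unfold minorWeight
  simp only [← Finset.sum_div]
  exact div_self hh

lemma minorSum_pos {p : Fin N → Fin Nr} {q : Fin N → Fin Nt} {h : Fin Nr → Fin Nt → ℂ}
    (hh : ((Matrix.of h).submatrix p q).det ≠ 0) : 0 < minorSum N s h :=
  lt_of_lt_of_le (by have := norm_pos_iff.2 hh; positivity) (pow_norm_det_le_minorSum s p q h)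

lemma minorWeight_eq_zero (hs : s ≠ 0) {p : Fin N → Fin Nr} {q : Fin N → Fin Nt}
    (hpq : ¬(Function.Injective p ∧ Function.Injective q)) (h : Fin Nr → Fin Nt → ℂ) :
    minorWeight s p q h = 0 := by
  have hdet : ((Matrix.of h).submatrix p q).det = 0 := by
    rw [not_and_or] at hpq
    rcases hpq with hp | hq
    · obtain ⟨i, j, hij, hne⟩ := Function.not_injective_iff.1 hp
      exact Matrix.det_zero_of_row_eq hne (by funext k; simp [hij])
    · obtain ⟨i, j, hij, hne⟩ := Function.not_injective_iff.1 hq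
      exact Matrix.det_zero_of_column_eq hne (by intro k; simp [hij])
  unfold minorWeight
  rw [hdet, norm_zero, zero_pow (by omega), zero_div]

lemma exists_equiv_of_injective {p : Fin N → Fin Nr} (hp : Function.Injective p) :
    ∃ e : Fin N ⊕ Fin (Nr - N) ≃ Fin Nr, ∀ i, e (Sum.inl i) = p i := by
  classical
  have hc : Fintype.card ((Set.range p)ᶜ : Set (Fin Nr)) = Nr - N := by
    rw [Fintype.card_compl_set, Fintype.card_fin, Set.card_range_of_injective hp, Fintype.card_fin]
  exact ⟨((Equiv.ofInjective p hp).sumCongr (Fintype.equivFinOfCardEq hc).symm).trans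
    (Equiv.Set.sumCompl (Set.range p)), fun i => by simp⟩

variable {a b : ℕ} (e : Fin N ⊕ Fin a ≃ Fin Nr) (f : Fin N ⊕ Fin b ≃ Fin Nt)

/-- Bordering `A` by row `i` and column `j` gives, by the Schur complement, a minor equal to `det A
* δ * T i j`, to which `det_sq_le_mul_lam` applies with `R` the largest `N × N` minor. Since `R ^ (2
* s)` is at most `minorSum`, the weight compensates exactly for `det A` being small compared with
`R`. -/
lemma minorWeight_mul_le {A : Matrix (Fin N) (Fin N) ℂ} (B : Matrix (Fin N) (Fin b) ℂ)
    (C : Matrix (Fin a) (Fin N) ℂ) (T : Matrix (Fin a) (Fin b) ℂ) (hA : IsUnit A.det) {δ : ℝ}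
    (hδ : 0 < δ) {H : Matrix (Fin Nr) (Fin Nt) ℂ} (hH : H = blowUp e f A B C T δ) (D : SVD H)
    (m : Fin (min Nt Nr)) (hm : (m : ℕ) = N) {p : Fin N → Fin Nr} (hp : ∀ i, e (Sum.inl i) = p i)
    {q : Fin N → Fin Nt} (hq : ∀ i, f (Sum.inl i) = q i) (i : Fin a) (j : Fin b) :
    minorWeight s p q H * ‖T i j‖ ^ (2 * s) ≤
      ((N : ℝ) + 1) ^ (2 * s) * (D.lam m / δ ^ 2) ^ s := by
  have hApq : H.submatrix p q = A := by
    ext k l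
    simp [hH, blowUp, blockMat, ← hp, ← hq]
  have : Nonempty ((Fin N → Fin Nr) × (Fin N → Fin Nt)) := ⟨(p, q)⟩
  obtain ⟨⟨p₀, q₀⟩, hmax⟩ := Finite.exists_max fun z : (Fin N → Fin Nr) × (Fin N → Fin Nt) =>
    ‖(H.submatrix z.1 z.2).det‖
  set R := ‖(H.submatrix p₀ q₀).det‖
  have hApos : 0 < ‖A.det‖ := norm_pos_iff.2 hA.ne_zero
  have hR0 : 0 < R := hApos.trans_le (by have := hmax (p, q); rwa [hApq] at this)
  have hRs : R ^ (2 * s) ≤ minorSum N s H := pow_norm_det_le_minorSum s p₀ q₀ H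
  let ε : Fin (N + 1) ≃ Fin N ⊕ Fin 1 := finSumFinEquiv.symm
  let r : Fin (N + 1) → Fin Nr := fun x => e (Sum.map id (fun _ => i) (ε x))
  let c : Fin (N + 1) → Fin Nt := fun x => f (Sum.map id (fun _ => j) (ε x))
  have hinj : ∀ {k : ℕ} (i : Fin k), Function.Injective
      (Sum.map id (fun _ => i) : Fin N ⊕ Fin 1 → Fin N ⊕ Fin k) := fun i =>
    Function.injective_id.sumMap (Function.injective_of_subsingleton _)
  have key := det_sq_le_mul_lam D m hm (r := r) (c := c)
    (e.injective.comp ((hinj i).comp ε.injective)) (f.injective.comp ((hinj j).comp ε.injective))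
    (R := R) (fun p q => hmax (p, q)) hR0
  have hdet : (H.submatrix r c).det = A.det * ((δ : ℂ) * T i j) := by
    let X : Matrix (Fin N ⊕ Fin 1) (Fin N ⊕ Fin 1) ℂ := Matrix.fromBlocks A
      (B.submatrix id fun _ => j) (C.submatrix (fun _ => i) id)
      ((C * A⁻¹ * B + (δ : ℂ) • T).submatrix (fun _ => i) fun _ => j)
    have h1 : H.submatrix r c = X.submatrix ε ε := by
      ext k l
      simp only [hH, blowUp, blockMat, Matrix.submatrix_apply, r, c, Equiv.symm_apply_apply, X]
      rcases ε k <;> rcases ε l <;> simp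
    rw [h1, Matrix.det_submatrix_equiv_self]
    let _ := Matrix.invertibleOfIsUnitDet A hA
    rw [Matrix.det_fromBlocks₁₁, Matrix.det_fin_one, Matrix.invOf_eq_nonsing_inv]
    congr 1
    have h2 : C.submatrix (fun _ : Fin 1 => i) id * A⁻¹ * B.submatrix id (fun _ : Fin 1 => j) =
        (C * A⁻¹ * B).submatrix (fun _ => i) fun _ => j := by
      ext k l
      simp [Matrix.mul_apply]
    rw [h2]
    simp
  rw [hdet, norm_mul, norm_mul, Complex.norm_real, Real.norm_of_nonneg hδ.le] at key
  have hW : 0 < minorSum N s H := lt_of_lt_of_le (by positivity) hRs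
  have hlam : D.lam m = δ ^ 2 * (D.lam m / δ ^ 2) := by field_simp
  set μ := D.lam m / δ ^ 2
  have hμ : 0 ≤ μ := div_nonneg (D.lam_nonneg m) (sq_nonneg δ)
  have key2 : ‖A.det‖ ^ 2 * ‖T i j‖ ^ 2 ≤ (N + 1) ^ 2 * R ^ 2 * μ := by
    rw [hlam] at key
    have hδ2 : 0 < δ ^ 2 := by positivity
    refine le_of_mul_le_mul_left ?_ hδ2
    calc _ = (‖A.det‖ * (δ * ‖T i j‖)) ^ 2 := by ring
      _ ≤ _ := key
      _ = _ := by ring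
  have key3 := pow_le_pow_left₀ (by positivity) key2 s
  unfold minorWeight
  rw [show (Matrix.of H).submatrix p q = A from hApq, div_mul_eq_mul_div, div_le_iff₀ hW]
  calc ‖A.det‖ ^ (2 * s) * ‖T i j‖ ^ (2 * s) = (‖A.det‖ ^ 2 * ‖T i j‖ ^ 2) ^ s := by
        rw [mul_pow, ← pow_mul, ← pow_mul]
    _ ≤ ((N + 1) ^ 2 * R ^ 2 * μ) ^ s := key3
    _ = ((N : ℝ) + 1) ^ (2 * s) * μ ^ s * R ^ (2 * s) := by
        rw [mul_pow, mul_pow, ← pow_mul, ← pow_mul]; ring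
    _ ≤ _ := by gcongr

end weights

end

end SLMIMO
-- Change of variables near the matrices of rank `N`.
namespace SLMIMO

noncomputable section

section assemble

instance isAddHaarMeasure_volume_pi_pi (a b : ℕ) :
    (volume : Measure (Fin a → Fin b → ℂ)).IsAddHaarMeasure := by
  have : ∀ _ : Fin a, (volume : Measure (Fin b → ℂ)).IsAddHaarMeasure := fun _ => inferInstance
  exact Measure.pi.isAddHaarMeasure fun _ : Fin a => (volume : Measure (Fin b → ℂ))

lemma isAddHaarMeasure_volume_prod {E F : Type*} [NormedAddCommGroup E] [MeasureSpace E]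
    [NormedAddCommGroup F] [MeasureSpace F] [BorelSpace E] [BorelSpace F]
    [SecondCountableTopology E] [SecondCountableTopology F] [SigmaFinite (volume : Measure E)]
    [SigmaFinite (volume : Measure F)] [(volume : Measure E).IsAddHaarMeasure]
    [(volume : Measure F).IsAddHaarMeasure] : (volume : Measure (E × F)).IsAddHaarMeasure :=
  inferInstanceAs (Measure.prod volume volume).IsAddHaarMeasure

variable {Nr Nt N a b : ℕ}

/-- The blocks `A`, `B`, `C` that parametrize the matrices of rank `N`. -/
abbrev Params (N a b : ℕ) : Type :=
  (Fin N → Fin N → ℂ) × (Fin N → Fin b → ℂ) × (Fin a → Fin N → ℂ)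

instance isAddHaarMeasure_volume_params : (volume : Measure (Params N a b)).IsAddHaarMeasure := by
  have : (volume : Measure ((Fin N → Fin b → ℂ) × (Fin a → Fin N → ℂ))).IsAddHaarMeasure :=
    isAddHaarMeasure_volume_prod
  exact isAddHaarMeasure_volume_prod

instance isAddHaarMeasure_volume_params_prod :
    (volume : Measure (Params N a b × (Fin a → Fin b → ℂ))).IsAddHaarMeasure :=
  isAddHaarMeasure_volume_prod

variable (e : Fin N ⊕ Fin a ≃ Fin Nr) (f : Fin N ⊕ Fin b ≃ Fin Nt)

/-- The block decomposition as a linear equivalence. -/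
def assemble : (Params N a b × (Fin a → Fin b → ℂ)) ≃ₗ[ℝ] (Fin Nr → Fin Nt → ℂ) where
  toFun z := fun i j => Sum.elim (fun k => Sum.elim (z.1.1 k) (z.1.2.1 k) (f.symm j))
    (fun k => Sum.elim (z.1.2.2 k) (z.2 k) (f.symm j)) (e.symm i)
  map_add' z z' := by
    funext i j
    simp only [Pi.add_apply]
    rcases e.symm i <;> rcases f.symm j <;> rfl
  map_smul' r z := by
    funext i j
    simp only [Pi.smul_apply, RingHom.id_apply]
    rcases e.symm i <;> rcases f.symm j <;> rfl
  invFun h := ((fun i j => h (e (Sum.inl i)) (f (Sum.inl j)),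
    fun i j => h (e (Sum.inl i)) (f (Sum.inr j)), fun i j => h (e (Sum.inr i)) (f (Sum.inl j))),
    fun i j => h (e (Sum.inr i)) (f (Sum.inr j)))
  left_inv z := by simp
  right_inv h := by
    funext i j
    obtain ⟨i, rfl⟩ := e.surjective i
    obtain ⟨j, rfl⟩ := f.surjective j
    simp only [Equiv.symm_apply_apply]
    rcases i <;> rcases j <;> simp

/-- The lower right block of the matrix of rank `N` with the given other blocks. -/
def rankFill (p : Params N a b) : Fin a → Fin b → ℂ :=
  Matrix.of p.2.2 * (Matrix.of p.1)⁻¹ * Matrix.of p.2.1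

lemma measurable_rankFill : Measurable (rankFill : Params N a b → Fin a → Fin b → ℂ) := by
  refine measurable_pi_lambda _ fun i => measurable_pi_lambda _ fun j => ?_
  simp only [rankFill, Matrix.mul_apply, Matrix.inv_def, Ring.inverse_eq_inv', Matrix.smul_apply,
    Matrix.of_apply, smul_eq_mul]
  have hdet : Measurable fun p : Params N a b => (Matrix.of p.1).det :=
    ((continuous_id (X := Matrix (Fin N) (Fin N) ℂ)).matrix_det.comp
      (continuous_fst : Continuous fun p : Params N a b => p.1)).measurable
  have hadj : ∀ x k, Measurable fun p : Params N a b => (Matrix.of p.1).adjugate x k := fun x k =>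
    (((continuous_id (X := Matrix (Fin N) (Fin N) ℂ)).matrix_adjugate.matrix_elem x k).comp
      (continuous_fst : Continuous fun p : Params N a b => p.1)).measurable
  refine Finset.measurable_fun_sum _ fun k _ => Measurable.mul (Finset.measurable_fun_sum _
    fun x _ => Measurable.mul ?_ (hdet.inv.mul (hadj x k))) ?_
  · fun_prop
  · fun_prop

lemma assemble_rankFill_add (p : Params N a b) (δ : ℝ) (T : Fin a → Fin b → ℂ) :
    assemble e f (p, rankFill p + δ • T) =
      blowUp e f (Matrix.of p.1) (Matrix.of p.2.1) (Matrix.of p.2.2) (Matrix.of T) δ := by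
  funext i j
  obtain ⟨i, rfl⟩ := e.surjective i
  obtain ⟨j, rfl⟩ := f.surjective j
  rcases i <;> rcases j <;> simp [assemble, blowUp, blockMat, rankFill]
  rfl

lemma continuous_assemble : Continuous (assemble e f) :=
  (assemble e f).toLinearMap.continuous_of_finiteDimensional

/-- The source of the diversity exponent: for fixed `A, B, C` the substitution is a translation and
a dilation in real dimension `2ab`. The translation may be arbitrary, so the default value of `A⁻¹`
at singular `A` is harmless. -/
lemma exists_lintegral_eq_blowUp : ∃ c : ℝ≥0∞, c ≠ 0 ∧ c ≠ ∞ ∧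
    ∀ F : (Fin Nr → Fin Nt → ℂ) → ℝ≥0∞, Measurable F → ∀ δ : ℝ, 0 < δ →
      (ENNReal.ofReal (δ ^ (2 * (a * b))))⁻¹ * ∫⁻ h, F h =
        c * ∫⁻ z : Params N a b × (Fin a → Fin b → ℂ),
          F (assemble e f (z.1, rankFill z.1 + δ • z.2)) := by
  obtain ⟨c, hc0, hc, hmap⟩ := exists_map_eq_smul (assemble e f).symm.toContinuousLinearEquiv
    volume volume
  refine ⟨c, hc0, hc, fun F hF δ hδ => ?_⟩
  have hFa : Measurable fun z => F (assemble e f z) :=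
    hF.comp (continuous_assemble e f).measurable
  have h1 : ∫⁻ h, F h = c * ∫⁻ z, F (assemble e f z) := by
    rw [← smul_eq_mul, ← lintegral_smul_measure, ← hmap,
      lintegral_map hFa (ContinuousLinearEquiv.continuous _).measurable]
    refine lintegral_congr fun h => ?_
    congr 1
    exact ((assemble e f).apply_symm_apply h).symm
  have hfr : Module.finrank ℝ (Fin a → Fin b → ℂ) = 2 * (a * b) := by
    simp [Module.finrank_pi_fintype, Complex.finrank_real_complex]
    ring
  have h2 : ∀ p : Params N a b, ∫⁻ D, F (assemble e f (p, D)) =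
      ENNReal.ofReal (δ ^ (2 * (a * b))) *
        ∫⁻ T, F (assemble e f (p, rankFill p + δ • T)) := by
    intro p
    have hG : Measurable fun D => F (assemble e f (p, D)) := hFa.comp measurable_prodMk_left
    have hG' : Measurable fun D => F (assemble e f (p, rankFill p + D)) :=
      hG.comp (measurable_const_add _)
    rw [← lintegral_add_left_eq_self (fun D => F (assemble e f (p, D))) (rankFill p)]
    have h3 : ∫⁻ T, F (assemble e f (p, rankFill p + δ • T)) =
        ∫⁻ D, F (assemble e f (p, rankFill p + D)) ∂(volume.map fun T => δ • T) :=
      (lintegral_map hG' (measurable_const_smul δ)).symm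
    rw [h3, Measure.map_addHaar_smul volume hδ.ne', lintegral_smul_measure, hfr, smul_eq_mul,
      ← mul_assoc, ← ENNReal.ofReal_mul (by positivity), abs_of_pos (by positivity),
      mul_inv_cancel₀ (by positivity), ENNReal.ofReal_one, one_mul]
  have hmeas : Measurable fun z : Params N a b × (Fin a → Fin b → ℂ) =>
      F (assemble e f (z.1, rankFill z.1 + δ • z.2)) := by
    refine hFa.comp (measurable_fst.prodMk ?_)
    exact (measurable_rankFill.comp measurable_fst).add (measurable_snd.const_smul δ)
  rw [h1, Measure.volume_eq_prod, lintegral_prod _ hFa.aemeasurable,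
    lintegral_prod _ hmeas.aemeasurable]
  simp only [h2]
  rw [lintegral_const_mul _ hmeas.lintegral_prod_right']
  have h4 : ENNReal.ofReal (δ ^ (2 * (a * b))) ≠ 0 := (ENNReal.ofReal_pos.2 (by positivity)).ne'
  rw [mul_left_comm c, ← mul_assoc, ENNReal.inv_mul_cancel h4 ENNReal.ofReal_ne_top, one_mul]

lemma norm_params_sq_le (z : Params N a b × (Fin a → Fin b → ℂ)) :
    ‖z.1‖ ^ 2 ≤ ∑ i, nsq (assemble e f z i) := by
  have h0 : 0 ≤ ∑ i, nsq (assemble e f z i) := Finset.sum_nonneg fun i _ => nsq_nonneg _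
  have h1 : ∀ i j, ‖assemble e f z i j‖ ≤ Real.sqrt (∑ i, nsq (assemble e f z i)) := fun i j =>
    Real.le_sqrt_of_sq_le ((norm_sq_le_nsq _ j).trans
      (Finset.single_le_sum (f := fun i => nsq (assemble e f z i)) (fun i _ => nsq_nonneg _)
        (Finset.mem_univ i)))
  rw [← Real.le_sqrt (norm_nonneg _) h0]
  have hs := Real.sqrt_nonneg (∑ i, nsq (assemble e f z i))
  simp only [Prod.norm_def, sup_le_iff, pi_norm_le_iff_of_nonneg hs]
  refine ⟨fun i j => ?_, fun i j => ?_, fun i j => ?_⟩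
  · simpa [assemble] using h1 (e (Sum.inl i)) (f (Sum.inl j))
  · simpa [assemble] using h1 (e (Sum.inl i)) (f (Sum.inr j))
  · simpa [assemble] using h1 (e (Sum.inr i)) (f (Sum.inl j))

lemma exists_matDensity_le (r : ℕ) : ∃ K, 0 ≤ K ∧
    ∀ z : Params N a b × (Fin a → Fin b → ℂ),
      matDensity (assemble e f z) ≤ K * (1 + ‖z.1‖) ^ (-(r : ℝ)) := by
  have hπ := Real.pi_pos
  -- From `(1 + x) ^ r ≤ r! * exp (1 + x)` and `1 + x - x ^ 2 ≤ 2`.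
  refine ⟨(Real.pi⁻¹ ^ Nt) ^ Nr * (r.factorial * Real.exp 2), by positivity, fun z => ?_⟩
  rw [matDensity_eq, mul_assoc]
  refine mul_le_mul_of_nonneg_left ?_ (by positivity)
  have hx := norm_nonneg z.1
  have h1 := Real.pow_div_factorial_le_exp (1 + ‖z.1‖) (by positivity) r
  have h2 := norm_params_sq_le e f z
  rw [Real.rpow_neg (by positivity), Real.rpow_natCast, ← div_eq_mul_inv,
    le_div_iff₀ (by positivity)]
  rw [div_le_iff₀ (by positivity)] at h1
  calc _ ≤ Real.exp (-∑ i, nsq (assemble e f z i)) * (Real.exp (1 + ‖z.1‖) * r.factorial) := by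
        gcongr
    _ = r.factorial * Real.exp (1 + ‖z.1‖ - ∑ i, nsq (assemble e f z i)) := by
        rw [mul_left_comm, ← mul_assoc, mul_comm, ← Real.exp_add]
        ring_nf
    _ ≤ _ := by
        gcongr
        nlinarith [sq_nonneg (‖z.1‖ - 1)]

end assemble

/-! ### Dominated convergence in one chart. -/

section limit

variable {Nr Nt N a b : ℕ} (e : Fin N ⊕ Fin a ≃ Fin Nr) (f : Fin N ⊕ Fin b ≃ Fin Nt)
  {κ : Type*} (svd : ∀ H : Matrix (Fin Nr) (Fin Nt) ℂ, SVD H)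

/-- The contribution of a minor to the average error probability, as an integrand. -/
def errIntegrand (ψ : κ → Fin (min Nt Nr) → ℂ) (s : ℕ) (p : Fin N → Fin Nr) (q : Fin N → Fin Nt)
    (δ : ℝ) (h : Fin Nr → Fin Nt → ℂ) : ℝ≥0∞ :=
  ENNReal.ofReal (minorWeight s p q h * matDensity h) *
    errProb Nr ψ fun m => (svd (Matrix.of h)).lam m / δ ^ 2

lemma measurable_errIntegrand (ψ : κ → Fin (min Nt Nr) → ℂ) (s : ℕ) (p : Fin N → Fin Nr)
    (q : Fin N → Fin Nt) (δ : ℝ) : Measurable (errIntegrand svd ψ s p q δ) := by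
  unfold errIntegrand
  refine ((measurable_minorWeight s p q).mul continuous_matDensity.measurable).ennreal_ofReal.mul ?_
  refine (measurable_errProb Nr ψ).comp (measurable_pi_lambda _ fun m => ?_)
  exact (continuous_lam svd m).measurable.div_const _

/-- A majorant uniform in `δ`: decay in the blocks `A, B, C` comes from the Gaussian density. Decay
in `T` comes from `minorWeight_mul_le`, applied at the largest entry of `T`, combined with the bound
on `(λ_N / δ²) ^ s` times the error probability. -/
lemma exists_errIntegrand_le [Finite κ] (ψ : κ → Fin (min Nt Nr) → ℂ)
    (P : Fin (min Nt Nr)) (hP : (P : ℕ) = N) (hψ : ∀ j, ∃ m ≤ P, ψ j m ≠ 0) (s r : ℕ)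
    {p : Fin N → Fin Nr} (hp : ∀ i, e (Sum.inl i) = p i) {q : Fin N → Fin Nt} (hq : ∀ i, f (Sum.inl i) = q i) :
    ∃ K, 0 ≤ K ∧ ∀ δ : ℝ, 0 < δ → ∀ z : Params N a b × (Fin a → Fin b → ℂ),
      (Matrix.of z.1.1).det ≠ 0 →
      errIntegrand svd ψ s p q δ (assemble e f (z.1, rankFill z.1 + δ • z.2)) ≤
        ENNReal.ofReal (K * ((1 + ‖z.1‖) ^ (-(r : ℝ)) * (1 + ‖z.2‖) ^ (-((2 * s : ℕ) : ℝ)))) := by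
  obtain ⟨K₁, hK₁, h₁⟩ := exists_matDensity_le e f r
  obtain ⟨K₂, hK₂, h₂⟩ := exists_pow_mul_errProb_le (min_le_right Nt Nr) ψ P hψ s
  have hNr : Nr = N + a := by simpa using (Fintype.card_congr e).symm
  have hNt : Nt = N + b := by simpa using (Fintype.card_congr f).symm
  have ha : 0 < a := by have := P.isLt.trans_le (min_le_right Nt Nr); omega
  have hb : 0 < b := by have := P.isLt.trans_le (min_le_left Nt Nr); omega
  have : Nonempty (Fin a × Fin b) := ⟨(⟨0, ha⟩, ⟨0, hb⟩)⟩
  -- The power of `2` comes from the convexity bound `(1 + x) ^ (2 * s) ≤ 2 ^ (2 * s - 1) * (1 + x ^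
  -- (2 * s))`.
  set K₃ : ℝ := 2 ^ (2 * s - 1) * (1 + ((N : ℝ) + 1) ^ (2 * s) * K₂)
  refine ⟨K₁ * K₃, by positivity, fun δ hδ z hz => ?_⟩
  set h := assemble e f (z.1, rankFill z.1 + δ • z.2) with hh
  have hH : Matrix.of h = blowUp e f (Matrix.of z.1.1) (Matrix.of z.1.2.1) (Matrix.of z.1.2.2)
    (Matrix.of z.2) δ := assemble_rankFill_add e f z.1 δ z.2
  let D := svd (Matrix.of h)
  set φ := errProb Nr ψ fun m => D.lam m / δ ^ 2 with hφ
  have hφ1 : φ ≤ 1 := errProb_le_one _ _ _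
  have hφr : φ = ENNReal.ofReal φ.toReal :=
    (ENNReal.ofReal_toReal (hφ1.trans_lt ENNReal.one_lt_top).ne).symm
  have hφ0 : 0 ≤ φ.toReal := ENNReal.toReal_nonneg
  have hφ1' : φ.toReal ≤ 1 := ENNReal.toReal_le_of_le_ofReal zero_le_one (by simpa using hφ1)
  have hδ2 : 0 < δ ^ 2 := by positivity
  have hμ0 : 0 ≤ D.lam P / δ ^ 2 := div_nonneg (D.lam_nonneg _) hδ2.le
  have h3 : (D.lam P / δ ^ 2) ^ s * φ.toReal ≤ K₂ := by
    have h4 := h₂ (fun m => D.lam m / δ ^ 2)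
      (fun i j hij => div_le_div_of_nonneg_right (D.lam_antitone hij) hδ2.le)
      (fun m => div_nonneg (D.lam_nonneg _) hδ2.le)
    rw [← hφ, hφr, ← ENNReal.ofReal_mul (by positivity)] at h4
    exact (ENNReal.ofReal_le_ofReal_iff hK₂).1 h4
  obtain ⟨⟨i₀, j₀⟩, hmax⟩ := Finite.exists_max fun x : Fin a × Fin b => ‖z.2 x.1 x.2‖
  have hnorm : ‖z.2‖ ≤ ‖z.2 i₀ j₀‖ := (pi_norm_le_iff_of_nonneg (norm_nonneg _)).2 fun i =>
    (pi_norm_le_iff_of_nonneg (norm_nonneg _)).2 fun j => hmax (i, j)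
  set w := minorWeight s p q h
  have hw0 : 0 ≤ w := minorWeight_nonneg s p q h
  have hw1 : w ≤ 1 := minorWeight_le_one s p q h
  have h5 : w * ‖z.2 i₀ j₀‖ ^ (2 * s) ≤ ((N : ℝ) + 1) ^ (2 * s) * (D.lam P / δ ^ 2) ^ s :=
    minorWeight_mul_le s e f (Matrix.of z.1.2.1) (Matrix.of z.1.2.2) (Matrix.of z.2)
      (isUnit_iff_ne_zero.2 hz) hδ hH D P hP hp hq i₀ j₀
  have h6 : w * φ.toReal * (1 + ‖z.2‖) ^ (2 * s) ≤ K₃ := by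
    have h7 : (1 + ‖z.2‖) ^ (2 * s) ≤ 2 ^ (2 * s - 1) * (1 + ‖z.2 i₀ j₀‖ ^ (2 * s)) := by
      have h8 := add_pow_le (zero_le_one' ℝ) (norm_nonneg (z.2 i₀ j₀)) (2 * s)
      rw [one_pow] at h8
      refine le_trans ?_ h8
      gcongr
    have h9 : w * φ.toReal ≤ 1 := mul_le_one₀ hw1 hφ0 hφ1'
    have h10 : w * φ.toReal * ‖z.2 i₀ j₀‖ ^ (2 * s) ≤ ((N : ℝ) + 1) ^ (2 * s) * K₂ := by
      calc _ = w * ‖z.2 i₀ j₀‖ ^ (2 * s) * φ.toReal := by ring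
        _ ≤ ((N : ℝ) + 1) ^ (2 * s) * (D.lam P / δ ^ 2) ^ s * φ.toReal := by gcongr
        _ = ((N : ℝ) + 1) ^ (2 * s) * ((D.lam P / δ ^ 2) ^ s * φ.toReal) := by ring
        _ ≤ _ := by gcongr
    calc _ ≤ w * φ.toReal * (2 ^ (2 * s - 1) * (1 + ‖z.2 i₀ j₀‖ ^ (2 * s))) := by gcongr
      _ = 2 ^ (2 * s - 1) * (w * φ.toReal + w * φ.toReal * ‖z.2 i₀ j₀‖ ^ (2 * s)) := by ring
      _ ≤ _ := mul_le_mul_of_nonneg_left (add_le_add h9 h10) (by positivity)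
  have h11 : w * φ.toReal ≤ K₃ * (1 + ‖z.2‖) ^ (-((2 * s : ℕ) : ℝ)) := by
    rw [Real.rpow_neg (by positivity), Real.rpow_natCast, ← div_eq_mul_inv,
      le_div_iff₀ (by positivity)]
    exact h6
  have h12 := h₁ (z.1, rankFill z.1 + δ • z.2)
  have h13 := (matDensity_pos h).le
  change ENNReal.ofReal (w * matDensity h) * φ ≤ _
  rw [hφr, ← ENNReal.ofReal_mul (mul_nonneg hw0 h13)]
  refine ENNReal.ofReal_le_ofReal ?_
  calc w * matDensity h * φ.toReal = matDensity h * (w * φ.toReal) := by ring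
    _ ≤ (K₁ * (1 + ‖z.1‖) ^ (-(r : ℝ))) * (K₃ * (1 + ‖z.2‖) ^ (-((2 * s : ℕ) : ℝ))) := by
        gcongr
    _ = _ := by ring

lemma continuous_blowUp (A : Matrix (Fin N) (Fin N) ℂ) (B : Matrix (Fin N) (Fin b) ℂ)
    (C : Matrix (Fin a) (Fin N) ℂ) (T : Matrix (Fin a) (Fin b) ℂ) :
    Continuous fun δ : ℝ => blowUp e f A B C T δ := by
  unfold blowUp blockMat
  refine Continuous.matrix_submatrix ?_ _ _
  refine Continuous.matrix_fromBlocks continuous_const continuous_const continuous_const ?_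
  exact continuous_const.add (Complex.continuous_ofReal.smul continuous_const)

/-- The minor of the chart equals `det A` for every `δ`, so weight and density are continuous up to
`δ = 0` and positive there; the error probability converges by the limits of the rescaled singular
values. -/
lemma exists_tendsto_errIntegrand [Finite κ] (ψ : κ → Fin (min Nt Nr) → ℂ) (P : Fin (min Nt Nr))
    (hP : (P : ℕ) = N) (hψ : ∀ j, ψ j ≠ 0) (s : ℕ) {p : Fin N → Fin Nr}
    (hp : ∀ i, e (Sum.inl i) = p i) {q : Fin N → Fin Nt} (hq : ∀ i, f (Sum.inl i) = q i)
    (z : Params N a b × (Fin a → Fin b → ℂ)) (hz : (Matrix.of z.1.1).det ≠ 0)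
    (hT : (∃ X : Matrix (Fin b) (Fin a) ℂ, X * Matrix.of z.2 = 1) ∨
      ∃ X : Matrix (Fin b) (Fin a) ℂ, Matrix.of z.2 * X = 1) :
    ∃ ℓ, Tendsto (fun δ => errIntegrand svd ψ s p q δ
        (assemble e f (z.1, rankFill z.1 + δ • z.2))) (nhdsWithin 0 (Set.Ioi 0)) (nhds ℓ) ∧
      ((∃ j, ∀ m < P, ψ j m = 0) → 0 < ℓ) := by
  have hA : IsUnit (Matrix.of z.1.1).det := isUnit_iff_ne_zero.2 hz
  let H : ℝ → Matrix (Fin Nr) (Fin Nt) ℂ := blowUp e f (Matrix.of z.1.1) (Matrix.of z.1.2.1)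
    (Matrix.of z.1.2.2) (Matrix.of z.2)
  obtain ⟨ℓ, hℓ, hpos⟩ := exists_tendsto_errProb (min_le_right Nt Nr) ψ hψ P
    (l := nhdsWithin 0 (Set.Ioi 0)) (μ := fun δ m => (svd (H δ)).lam m / δ ^ 2)
    (fun m hm => tendsto_lam_div_atTop e f _ _ _ hA (fun δ => svd (H δ)) m
      (by rw [← hP]; exact hm))
    (fun m hm => exists_tendsto_lam_div e f _ _ _ hA (fun δ => svd (H δ)) hT m
      (by rw [← hP]; exact hm))
  have hminor : ∀ δ, (H δ).submatrix p q = Matrix.of z.1.1 := by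
    intro δ
    ext k l
    simp [H, blowUp, blockMat, ← hp, ← hq]
  have hH0 : ((H 0).submatrix p q).det ≠ 0 := by rw [hminor]; exact hz
  have hms : 0 < minorSum N s (H 0) := minorSum_pos s hH0
  have hHc : Tendsto H (nhdsWithin 0 (Set.Ioi 0)) (nhds (H 0)) :=
    ((continuous_blowUp e f _ _ _ _).tendsto 0).mono_left nhdsWithin_le_nhds
  have hcoef : Tendsto (fun δ => ENNReal.ofReal (minorWeight s p q (H δ) * matDensity (H δ)))
      (nhdsWithin 0 (Set.Ioi 0))
      (nhds (ENNReal.ofReal (minorWeight s p q (H 0) * matDensity (H 0)))) :=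
    ENNReal.tendsto_ofReal (((continuousAt_minorWeight s p q hms.ne').tendsto.comp hHc).mul
      ((continuous_matDensity.tendsto _).comp hHc))
  have hℓ1 : ℓ ≤ 1 := le_of_tendsto' hℓ fun δ => errProb_le_one _ _ _
  have hH : ∀ δ : ℝ, assemble e f (z.1, rankFill z.1 + δ • z.2) = H δ := fun δ =>
    assemble_rankFill_add e f z.1 δ z.2
  have hint : ∀ δ : ℝ, errIntegrand svd ψ s p q δ (assemble e f (z.1, rankFill z.1 + δ • z.2)) =
      ENNReal.ofReal (minorWeight s p q (H δ) * matDensity (H δ)) *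
        errProb Nr ψ fun m => (svd (H δ)).lam m / δ ^ 2 := fun δ => by rw [hH]; rfl
  simp only [hint]
  refine ⟨_, ENNReal.Tendsto.mul hcoef (Or.inr (hℓ1.trans_lt ENNReal.one_lt_top).ne) hℓ
    (Or.inr ENNReal.ofReal_ne_top), fun hj => ENNReal.mul_pos ?_ (hpos hj).ne'⟩
  refine (ENNReal.ofReal_pos.2 (mul_pos (div_pos ?_ hms) (matDensity_pos _))).ne'
  have := norm_pos_iff.2 hH0
  exact pow_pos this _

lemma exists_tendsto_lintegral_errIntegrand [Finite κ] (ψ : κ → Fin (min Nt Nr) → ℂ)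
    (P : Fin (min Nt Nr)) (hP : (P : ℕ) = N) (hψ0 : ∀ j, ψ j ≠ 0) (hψ : ∀ j, ∃ m ≤ P, ψ j m ≠ 0)
    (s : ℕ) (hs : a * b < s) {p : Fin N → Fin Nr} (hp : ∀ i, e (Sum.inl i) = p i) {q : Fin N → Fin Nt}
    (hq : ∀ i, f (Sum.inl i) = q i) :
    ∃ ℓ : ℝ≥0∞, ℓ ≠ ∞ ∧ Tendsto (fun δ : ℝ => (ENNReal.ofReal (δ ^ (2 * (a * b))))⁻¹ *
        ∫⁻ h, errIntegrand svd ψ s p q δ h) (nhdsWithin 0 (Set.Ioi 0)) (nhds ℓ) ∧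
      ((∃ j, ∀ m < P, ψ j m = 0) → 0 < ℓ) := by
  obtain ⟨c, hc0, hc, heq⟩ := exists_lintegral_eq_blowUp e f
  -- Both exponents exceed the real dimension of their space: `r` by this choice, `2 * s` because `a
  -- * b < s`.
  let r : ℕ := Module.finrank ℝ (Params N a b) + 1
  obtain ⟨K, hK, hbound⟩ := exists_errIntegrand_le e f svd ψ P hP hψ s r hp hq
  let F : ℝ → Params N a b × (Fin a → Fin b → ℂ) → ℝ≥0∞ := fun δ z =>
    errIntegrand svd ψ s p q δ (assemble e f (z.1, rankFill z.1 + δ • z.2))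
  let G : Params N a b × (Fin a → Fin b → ℂ) → ℝ := fun z =>
    K * ((1 + ‖z.1‖) ^ (-(r : ℝ)) * (1 + ‖z.2‖) ^ (-((2 * s : ℕ) : ℝ)))
  have hF : ∀ δ, Measurable (F δ) := fun δ =>
    (measurable_errIntegrand svd ψ s p q δ).comp ((continuous_assemble e f).measurable.comp
      (measurable_fst.prodMk ((measurable_rankFill.comp measurable_fst).add
        (measurable_snd.const_smul δ))))
  have hG : Integrable G := by
    refine Integrable.const_mul ?_ K
    have h1 : Integrable fun x : Params N a b => (1 + ‖x‖) ^ (-(r : ℝ)) :=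
      integrable_one_add_norm (by simp [r])
    have h2 : Integrable fun x : Fin a → Fin b → ℂ => (1 + ‖x‖) ^ (-((2 * s : ℕ) : ℝ)) := by
      refine integrable_one_add_norm ?_
      have hfr : Module.finrank ℝ (Fin a → Fin b → ℂ) = 2 * (a * b) := by
        simp [Module.finrank_pi_fintype, Complex.finrank_real_complex]
        ring
      rw [hfr]
      exact_mod_cast (by omega : 2 * (a * b) < 2 * s)
    exact h1.mul_prod h2
  have hGfin : ∫⁻ z, ENNReal.ofReal (G z) ≠ ∞ := hG.lintegral_lt_top.ne
  have hae : ∀ᵐ z : Params N a b × (Fin a → Fin b → ℂ), (Matrix.of z.1.1).det ≠ 0 ∧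
      ((∃ X : Matrix (Fin b) (Fin a) ℂ, X * Matrix.of z.2 = 1) ∨
        ∃ X : Matrix (Fin b) (Fin a) ℂ, Matrix.of z.2 * X = 1) := by
    have h1 : ∀ᵐ A : Fin N → Fin N → ℂ, (Matrix.of A).det ≠ 0 :=
      ae_det_submatrix_ne_zero (p := id) (q := id) Function.injective_id Function.injective_id
    have h2 : ∀ᵐ x : Params N a b, (Matrix.of x.1).det ≠ 0 :=
      Measure.quasiMeasurePreserving_fst.ae h1
    have h3 : ∀ᵐ z : Params N a b × (Fin a → Fin b → ℂ), (Matrix.of z.1.1).det ≠ 0 :=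
      Measure.quasiMeasurePreserving_fst.ae h2
    exact h3.and (Measure.quasiMeasurePreserving_snd.ae (ae_exists_inverse a b))
  have hex : ∀ z : Params N a b × (Fin a → Fin b → ℂ), ∃ ℓ, ((Matrix.of z.1.1).det ≠ 0 ∧
      ((∃ X : Matrix (Fin b) (Fin a) ℂ, X * Matrix.of z.2 = 1) ∨
        ∃ X : Matrix (Fin b) (Fin a) ℂ, Matrix.of z.2 * X = 1)) →
      Tendsto (fun δ => F δ z) (nhdsWithin 0 (Set.Ioi 0)) (nhds ℓ) ∧
      ((∃ j, ∀ m < P, ψ j m = 0) → 0 < ℓ) := by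
    intro z
    by_cases hz : (Matrix.of z.1.1).det ≠ 0 ∧
      ((∃ X : Matrix (Fin b) (Fin a) ℂ, X * Matrix.of z.2 = 1) ∨
        ∃ X : Matrix (Fin b) (Fin a) ℂ, Matrix.of z.2 * X = 1)
    · obtain ⟨ℓ, hℓ⟩ := exists_tendsto_errIntegrand e f svd ψ P hP hψ0 s hp hq z hz.1 hz.2
      exact ⟨ℓ, fun _ => hℓ⟩
    · exact ⟨0, fun h => absurd h hz⟩
  choose g hg using hex
  have hglim : ∀ᵐ z, Tendsto (fun δ => F δ z) (nhdsWithin 0 (Set.Ioi 0)) (nhds (g z)) :=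
    hae.mono fun z hz => (hg z hz).1
  have hFG : ∀ δ ∈ Set.Ioi (0 : ℝ), ∀ᵐ z, F δ z ≤ ENNReal.ofReal (G z) := fun δ hδ =>
    hae.mono fun z hz => hbound δ hδ z hz.1
  have hlim := tendsto_lintegral_filter_of_dominated_convergence
    (μ := (volume : Measure (Params N a b × (Fin a → Fin b → ℂ))))
    (l := nhdsWithin (0 : ℝ) (Set.Ioi 0)) (F := F) (f := g) (fun z => ENNReal.ofReal (G z))
    (Eventually.of_forall hF) (by filter_upwards [self_mem_nhdsWithin] with δ hδ using hFG δ hδ)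
    hGfin hglim
  have hgm : AEMeasurable g := aemeasurable_of_tendsto_metrizable_ae
    (nhdsWithin (0 : ℝ) (Set.Ioi 0)) (fun δ => (hF δ).aemeasurable) hglim
  refine ⟨c * ∫⁻ z, g z, ENNReal.mul_ne_top hc ?_, ?_, fun hj => ?_⟩
  · refine ne_top_of_le_ne_top hGfin (le_of_tendsto hlim ?_)
    filter_upwards [self_mem_nhdsWithin] with δ hδ
    exact lintegral_mono_ae (hFG δ hδ)
  · refine Tendsto.congr' ?_ (ENNReal.Tendsto.const_mul hlim (Or.inr hc))
    filter_upwards [self_mem_nhdsWithin] with δ hδ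
    exact (heq _ (measurable_errIntegrand svd ψ s p q δ) δ hδ).symm
  · refine ENNReal.mul_pos hc0 fun h0 => ?_
    rw [lintegral_eq_zero_iff' hgm] at h0
    have h1 : ∀ᵐ _ : Params N a b × (Fin a → Fin b → ℂ), False := by
      filter_upwards [h0, hae] with z hz1 hz2
      exact ((hg z hz2).2 hj).ne' hz1
    rw [ae_iff] at h1
    simp only [not_false_eq_true] at h1
    exact (isOpen_univ.measure_pos volume Set.univ_nonempty).ne' h1

end limit

end

end SLMIMO
-- Summation over charts and messages, and the diversity gain.
namespace SLMIMO

noncomputable section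

variable {Nr Nt : ℕ}

section average

variable {κ : Type*} (svd : ∀ H : Matrix (Fin Nr) (Fin Nt) ℂ, SVD H)

lemma ae_minorSum_ne_zero {N : ℕ} (hr : N ≤ Nr) (ht : N ≤ Nt) (s : ℕ) :
    ∀ᵐ h : Fin Nr → Fin Nt → ℂ, minorSum N s h ≠ 0 := by
  filter_upwards [ae_det_submatrix_ne_zero (Fin.castLE_injective hr) (Fin.castLE_injective ht)]
    with h hh
  exact (minorSum_pos s hh).ne'

/-- Almost every matrix has a nonzero `N × N` minor, so the weights sum to `1` almost everywhere. -/
lemma lintegral_errProb_eq_sum {N : ℕ} (hr : N ≤ Nr) (ht : N ≤ Nt)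
    (ψ : κ → Fin (min Nt Nr) → ℂ) (s : ℕ) (δ : ℝ) :
    ∫⁻ h, errProb Nr ψ (fun m => (svd (Matrix.of h)).lam m / δ ^ 2) ∂channelLaw Nr Nt =
      ∑ p : Fin N → Fin Nr, ∑ q : Fin N → Fin Nt, ∫⁻ h, errIntegrand svd ψ s p q δ h := by
  have hm : Measurable fun h : Fin Nr → Fin Nt → ℂ => ENNReal.ofReal (matDensity h) :=
    continuous_matDensity.measurable.ennreal_ofReal
  have hφ : Measurable fun h : Fin Nr → Fin Nt → ℂ =>
      errProb Nr ψ (fun m => (svd (Matrix.of h)).lam m / δ ^ 2) :=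
    (measurable_errProb Nr ψ).comp (measurable_pi_lambda _ fun m =>
      (continuous_lam svd m).measurable.div_const _)
  rw [channelLaw_eq_withDensity, lintegral_withDensity_eq_lintegral_mul _ hm hφ]
  have h1 : ∀ p : Fin N → Fin Nr, ∑ q : Fin N → Fin Nt, ∫⁻ h, errIntegrand svd ψ s p q δ h =
      ∫⁻ h, ∑ q : Fin N → Fin Nt, errIntegrand svd ψ s p q δ h := fun p =>
    (lintegral_finsetSum _ fun q _ => measurable_errIntegrand svd ψ s p q δ).symm
  simp only [h1]
  rw [← lintegral_finsetSum _ fun p _ => Finset.measurable_fun_sum _ fun q _ =>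
    measurable_errIntegrand svd ψ s p q δ]
  refine lintegral_congr_ae ?_
  filter_upwards [ae_minorSum_ne_zero hr ht s] with h hh
  simp only [errIntegrand, ← Finset.sum_mul, Pi.mul_apply]
  congr 1
  have h2 : ∀ (p : Fin N → Fin Nr) (q : Fin N → Fin Nt), 0 ≤ minorWeight s p q h * matDensity h :=
    fun p q => mul_nonneg (minorWeight_nonneg s p q h) (matDensity_pos h).le
  have h3 : matDensity h = ∑ p : Fin N → Fin Nr, ∑ q : Fin N → Fin Nt,
      minorWeight s p q h * matDensity h := by
    simp only [← Finset.sum_mul, sum_minorWeight s hh, one_mul]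
  conv_lhs => rw [h3]
  rw [ENNReal.ofReal_sum_of_nonneg fun p _ => Finset.sum_nonneg fun q _ => h2 p q]
  exact Finset.sum_congr rfl fun p _ => ENNReal.ofReal_sum_of_nonneg fun q _ => h2 p q

lemma exists_tendsto_lintegral_errProb [Finite κ] (ψ : κ → Fin (min Nt Nr) → ℂ)
    (P : Fin (min Nt Nr)) (hψ0 : ∀ j, ψ j ≠ 0) (hψ : ∀ j, ∃ m ≤ P, ψ j m ≠ 0) :
    ∃ ℓ : ℝ≥0∞, ℓ ≠ ∞ ∧ Tendsto (fun δ : ℝ =>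
        (ENNReal.ofReal (δ ^ (2 * ((Nr - P) * (Nt - P)))))⁻¹ *
          ∫⁻ h, errProb Nr ψ (fun m => (svd (Matrix.of h)).lam m / δ ^ 2) ∂channelLaw Nr Nt)
        (nhdsWithin 0 (Set.Ioi 0)) (nhds ℓ) ∧
      ((∃ j, ∀ m < P, ψ j m = 0) → 0 < ℓ) := by
  obtain ⟨N, hN⟩ : ∃ N : ℕ, (P : ℕ) = N := ⟨_, rfl⟩
  have hr : N ≤ Nr := hN ▸ (P.isLt.trans_le (min_le_right Nt Nr)).le
  have ht : N ≤ Nt := hN ▸ (P.isLt.trans_le (min_le_left Nt Nr)).le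
  rw [hN]
  set s := (Nr - N) * (Nt - N) + 1 with hs
  have key : ∀ (p : Fin N → Fin Nr) (q : Fin N → Fin Nt), ∃ ℓ : ℝ≥0∞, ℓ ≠ ∞ ∧
      Tendsto (fun δ : ℝ => (ENNReal.ofReal (δ ^ (2 * ((Nr - N) * (Nt - N)))))⁻¹ *
        ∫⁻ h, errIntegrand svd ψ s p q δ h) (nhdsWithin 0 (Set.Ioi 0)) (nhds ℓ) ∧
      (Function.Injective p → Function.Injective q → (∃ j, ∀ m < P, ψ j m = 0) → 0 < ℓ) := by
    intro p q
    by_cases hpq : Function.Injective p ∧ Function.Injective q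
    · obtain ⟨e, he⟩ := exists_equiv_of_injective hpq.1
      obtain ⟨f, hf⟩ := exists_equiv_of_injective hpq.2
      obtain ⟨ℓ, h1, h2, h3⟩ := exists_tendsto_lintegral_errIntegrand e f svd ψ P hN hψ0 hψ s
        (Nat.lt_succ_self _) he hf
      exact ⟨ℓ, h1, h2, fun _ _ => h3⟩
    -- A repeated row or column makes the minor vanish; the weight is then `0`, since the exponent
    -- `2 * s` is positive.
    · refine ⟨0, ENNReal.zero_ne_top, ?_, fun hp hq => absurd ⟨hp, hq⟩ hpq⟩
      have h0 : ∀ δ h, errIntegrand svd ψ s p q δ h = 0 := fun δ h => by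
        simp [errIntegrand, minorWeight_eq_zero s (Nat.succ_ne_zero _) hpq h]
      simp [h0]
  choose ℓ hℓ hlim hpos using key
  refine ⟨∑ p, ∑ q, ℓ p q, ?_, ?_, fun hj => ?_⟩
  · exact ENNReal.sum_ne_top.2 fun p _ => ENNReal.sum_ne_top.2 fun q _ => hℓ p q
  · simp only [lintegral_errProb_eq_sum svd hr ht ψ s, Finset.mul_sum]
    exact tendsto_finsetSum _ fun p _ => tendsto_finsetSum _ fun q _ => hlim p q
  -- All contributions are nonnegative, so the leading minor alone suffices for positivity.
  · refine (hpos _ _ (Fin.castLE_injective hr) (Fin.castLE_injective ht) hj).trans_le ?_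
    exact (Finset.single_le_sum (f := fun q => ℓ (Fin.castLE hr) q) (fun _ _ => zero_le)
      (Finset.mem_univ _)).trans (Finset.single_le_sum (f := fun p => ∑ q, ℓ p q)
        (fun _ _ => zero_le) (Finset.mem_univ _))

end average

section diversity

variable {L M : ℕ} {C : Code (min Nt Nr) L M} {svd : ∀ H : Matrix (Fin Nr) (Fin Nt) ℂ, SVD H}
  {detect : Matrix (Fin Nr) (Fin Nt) ℂ → (Fin (min Nt Nr) → ℂ) → (Fin (min Nt Nr) → ℂ)}

lemma awep_eq_sum_errProb (hdetect : IsMLDetector C svd detect)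
    (hinj : Function.Injective C.symbol) {v : ℝ≥0} (hv : 0 < v) :
    awep C svd detect v = (∑ w : Fin L → Fin M, (∫⁻ h, errProb Nr (diffs C w)
      (fun m => (svd (Matrix.of h)).lam m / v) ∂channelLaw Nr Nt).toReal) / (M : ℝ) ^ L := by
  have hac : channelLaw Nr Nt ≪ volume := by
    rw [channelLaw_eq_withDensity]
    exact withDensity_absolutelyContinuous _ _
  unfold awep
  congr 1
  refine Finset.sum_congr rfl fun w _ => ?_
  congr 1
  refine lintegral_congr_ae (hac.ae_le ?_)
  filter_upwards [ae_lam_pos svd] with h hh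
  exact noiseLaw_detect_ne hdetect hinj w hv _ hh

lemma exists_tendsto_awep_div (hM : 0 < M) (hdetect : IsMLDetector C svd detect)
    (hinj : Function.Injective C.symbol) (P : Fin (min Nt Nr))
    (hle : ∀ w w', w' ≠ w → ∃ m ≤ P, C.symbol w m ≠ C.symbol w' m)
    (hex : ∃ w w', w' ≠ w ∧ ∀ m < P, C.symbol w m = C.symbol w' m) :
    ∃ ℓ : ℝ, 0 < ℓ ∧ Tendsto (fun δ : ℝ => awep C svd detect (Real.toNNReal (δ ^ 2)) /
      δ ^ (2 * ((Nr - P) * (Nt - P)))) (nhdsWithin 0 (Set.Ioi 0)) (nhds ℓ) := by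
  have h0 : ∀ w (j : {w' : Fin L → Fin M // w' ≠ w}), diffs C w j ≠ 0 := fun w j hj =>
    j.2 (hinj (sub_eq_zero.1 hj)).symm
  have hle' : ∀ w (j : {w' : Fin L → Fin M // w' ≠ w}), ∃ m ≤ P, diffs C w j m ≠ 0 := by
    intro w j
    obtain ⟨m, hm, hne⟩ := hle w j.1 j.2
    exact ⟨m, hm, sub_ne_zero.2 hne⟩
  choose ℓ hfin hlim hpos using fun w =>
    exists_tendsto_lintegral_errProb svd (diffs C w) P (h0 w) (hle' w)
  have hM' : (0 : ℝ) < (M : ℝ) ^ L := by positivity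
  refine ⟨(∑ w : Fin L → Fin M, (ℓ w).toReal) / (M : ℝ) ^ L, div_pos ?_ hM', ?_⟩
  · obtain ⟨w, w', hne, hz⟩ := hex
    have hw : 0 < (ℓ w).toReal := ENNReal.toReal_pos
      (hpos w ⟨⟨w', hne⟩, fun m hm => sub_eq_zero.2 (hz m hm)⟩).ne'
      (hfin w)
    exact hw.trans_le (Finset.single_le_sum (f := fun w => (ℓ w).toReal)
      (fun _ _ => ENNReal.toReal_nonneg) (Finset.mem_univ w))
  · refine Tendsto.congr' ?_ ((tendsto_finsetSum (Finset.univ : Finset (Fin L → Fin M))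
      fun w _ => (ENNReal.tendsto_toReal (hfin w)).comp (hlim w)).div_const ((M : ℝ) ^ L))
    filter_upwards [self_mem_nhdsWithin] with δ hδ
    have hδ' : 0 < δ ^ 2 := pow_pos hδ 2
    rw [awep_eq_sum_errProb hdetect hinj (Real.toNNReal_pos.2 hδ'), Real.coe_toNNReal _ hδ'.le,
      div_right_comm]
    simp only [Finset.sum_div]
    refine Finset.sum_congr rfl fun w _ => congrArg (· / (M : ℝ) ^ L) ?_
    simp only [Function.comp_apply]
    rw [ENNReal.toReal_mul, ENNReal.toReal_inv, ENNReal.toReal_ofReal (pow_pos hδ _).le,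
      div_eq_inv_mul]

lemma hasDiversityGain_of_tendsto {F : ℝ≥0 → ℝ} {d : ℕ} (hd : 0 < d) {P ℓ : ℝ} (hP : 0 < P)
    (hℓ : 0 < ℓ) (h : Tendsto (fun δ : ℝ => F (Real.toNNReal (δ ^ 2)) / δ ^ (2 * d))
      (nhdsWithin 0 (Set.Ioi 0)) (nhds ℓ)) :
    HasDiversityGain (fun snr => F (Real.toNNReal (P / snr))) d := by
  have hx : 0 < ℓ * P ^ d := by positivity
  have hd' : (d : ℝ) ≠ 0 := by positivity
  -- With `δ² = P / snr` the error probability is equivalent to `ℓ * (P / snr) ^ d`; solving `G ^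
  -- (-d) = ℓ * P ^ d` gives the coding gain.
  refine ⟨(ℓ * P ^ d) ^ (-(d : ℝ)⁻¹), by positivity, ?_⟩
  have hlim : Tendsto (fun snr : ℝ => Real.sqrt (P / snr)) atTop (nhdsWithin 0 (Set.Ioi 0)) := by
    rw [tendsto_nhdsWithin_iff]
    refine ⟨?_, ?_⟩
    · have h1 : Tendsto (fun snr : ℝ => P / snr) atTop (nhds 0) :=
        tendsto_const_nhds.div_atTop tendsto_id
      simpa [Function.comp_def] using (Real.continuous_sqrt.tendsto 0).comp h1
    · filter_upwards [eventually_gt_atTop 0] with snr hsnr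
      exact Real.sqrt_pos.2 (div_pos hP hsnr)
  have h2 := (h.comp hlim).div_const ℓ
  rw [div_self hℓ.ne'] at h2
  refine isEquivalent_of_tendsto_one (h2.congr' ?_)
  filter_upwards [eventually_gt_atTop 0] with snr hsnr
  simp only [Function.comp_apply, Pi.div_apply]
  rw [pow_mul, Real.sq_sqrt (div_pos hP hsnr).le, Real.mul_rpow (by positivity) hsnr.le,
    ← Real.rpow_mul hx.le, neg_mul_neg, inv_mul_cancel₀ hd', Real.rpow_one, Real.rpow_neg hsnr.le,
    Real.rpow_natCast, div_pow]
  field_simp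

end diversity

end

end SLMIMO
-- Leading zeros of differences and of columns of the layering matrix.
namespace SLMIMO

section leadingZeros

variable {n : ℕ} {α : Type*} [Zero α]

lemma leadingZeros_eq {v : Fin n → α} {m : Fin n} (hm : v m ≠ 0) (h : ∀ m' < m, v m' = 0) :
    leadingZeros v = m := by
  have : {k : Fin n | ∀ m' ≤ k, v m' = 0} = ↑(Finset.Iio m) := by
    ext k
    simp only [Set.mem_ofPred_eq, Finset.coe_Iio, Set.mem_Iio]
    exact ⟨fun hk => not_le.1 fun hmk => hm (hk m hmk), fun hk m' hm' => h m' (hm'.trans_lt hk)⟩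
  rw [leadingZeros, this, Set.ncard_coe_finset, Fin.card_Iio]

lemma exists_leadingZeros {v : Fin n → α} (hv : v ≠ 0) :
    ∃ m : Fin n, v m ≠ 0 ∧ (∀ m' < m, v m' = 0) ∧ leadingZeros v = m := by
  obtain ⟨m, hm, hmin⟩ := wellFounded_lt.has_min {m : Fin n | v m ≠ 0} (Function.ne_iff.1 hv)
  have hlt : ∀ m' < m, v m' = 0 := fun m' hm' => by_contra fun h => hmin m' h hm'
  exact ⟨m, hm, hlt, leadingZeros_eq hm hlt⟩

lemma leadingZeros_le {v : Fin n → α} {m : Fin n} (hm : v m ≠ 0) : leadingZeros v ≤ m := by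
  obtain ⟨k, -, hlt, hk⟩ := exists_leadingZeros (v := v) fun h => hm (congrFun h m)
  rw [hk]
  exact Fin.le_def.1 (not_lt.1 fun h => hm (hlt m h))

end leadingZeros

namespace Code

variable {n L M : ℕ} (C : Code n L M)

lemma symbol_apply_ne_iff (w w' : Fin L → Fin M) (m : Fin n) :
    C.symbol w m ≠ C.symbol w' m ↔ ∃ l, m ∈ C.pos l ∧ w l ≠ w' l :=
  (C.design w w' m).trans <| exists_congr fun l =>
    and_congr_right fun _ => (C.codebook_injective l).ne_iff

/-- A layer using no eigen-channel would have only the zero codeword, against the distinctness of at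
least two codewords. -/
lemma pos_nonempty (hM : 2 ≤ M) (l : Fin L) : (C.pos l).Nonempty := by
  rw [Finset.nonempty_iff_ne_empty]
  intro h
  have h0 : ∀ i, C.codebook l i = 0 := fun i => funext fun m => C.sparse l i m (by simp [h])
  have h1 := C.codebook_injective l
    ((h0 ⟨0, by omega⟩).trans (h0 ⟨1, by omega⟩).symm)
  simp at h1

lemma symbol_injective (hM : 2 ≤ M) : Function.Injective C.symbol := by
  intro w w' h
  funext l
  by_contra hl
  obtain ⟨m, hm⟩ := C.pos_nonempty hM l
  exact (C.symbol_apply_ne_iff w w' m).2 ⟨l, hm, hl⟩ (congrFun h m)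

lemma slMatrix_apply_ne_zero_iff (m : Fin n) (l : Fin L) : C.slMatrix m l ≠ 0 ↔ m ∈ C.pos l := by
  simp [slMatrix]

lemma mem_differences (w w' : Fin L → Fin M) : C.symbol w - C.symbol w' ∈ C.differences :=
  ⟨_, ⟨w, rfl⟩, _, ⟨w', rfl⟩, rfl⟩

lemma exists_first_pos (hM : 2 ≤ M) (l : Fin L) : ∃ m : Fin n, m ∈ C.pos l ∧
    (∀ m' < m, m' ∉ C.pos l) ∧ leadingZeros (fun m => C.slMatrix m l) = m := by
  obtain ⟨k, hk⟩ := C.pos_nonempty hM l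
  obtain ⟨m, hm, hlt, h⟩ := exists_leadingZeros (v := fun m => C.slMatrix m l)
    fun h => (C.slMatrix_apply_ne_zero_iff k l).2 hk (congrFun h k)
  refine ⟨m, (C.slMatrix_apply_ne_zero_iff m l).1 hm, fun m' hm' hmem => ?_, h⟩
  exact (C.slMatrix_apply_ne_zero_iff m' l).2 hmem (hlt m' hm')

/-- Two messages that differ in layer `l` only: no other layer can contribute to the difference. -/
lemma exists_symbol_apply_ne_iff (hM : 2 ≤ M) (l : Fin L) :
    ∃ w w' : Fin L → Fin M, w' ≠ w ∧ ∀ m, C.symbol w m ≠ C.symbol w' m ↔ m ∈ C.pos l := by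
  let i₀ : Fin M := ⟨0, by omega⟩
  let i₁ : Fin M := ⟨1, by omega⟩
  have hne : i₀ ≠ i₁ := by simp [i₀, i₁]
  refine ⟨fun _ => i₀, Function.update (fun _ => i₀) l i₁, fun h => ?_, fun m => ?_⟩
  · have := congrFun h l
    rw [Function.update_self] at this
    exact hne this.symm
  · rw [symbol_apply_ne_iff]
    constructor
    · rintro ⟨l', hm, hl'⟩
      by_cases h : l' = l
      · exact h ▸ hm
      · exact absurd (Function.update_of_ne h i₁ fun _ => i₀).symm hl'
    · intro hm
      refine ⟨l, hm, ?_⟩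
      rw [Function.update_self]
      exact hne

/-- A column of the sparse layering matrix with the maximal number of leading zeros governs all
differences. -/
lemma exists_isGreatest_leadingZeros (hL : 1 ≤ L) (hM : 2 ≤ M) : ∃ P : Fin n,
    IsGreatest (leadingZeros '' {ψ ∈ C.differences | ψ ≠ 0}) P ∧
    IsGreatest (Set.range fun l : Fin L => leadingZeros fun m => C.slMatrix m l) P ∧
    (∀ w w', w' ≠ w → ∃ m ≤ P, C.symbol w m ≠ C.symbol w' m) ∧
    ∃ w w', w' ≠ w ∧ ∀ m < P, C.symbol w m = C.symbol w' m := by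
  have : Nonempty (Fin L) := ⟨⟨0, hL⟩⟩
  -- `f l` is the first eigen-channel of layer `l`. Any two messages differ in some layer `l`, hence
  -- at position `f l`, which is at most the maximum `f l₀`; changing layer `l₀` alone attains it.
  choose f hf hlt hlz using C.exists_first_pos hM
  obtain ⟨l₀, hl₀⟩ := Finite.exists_max f
  have hle : ∀ w w', w' ≠ w → ∃ m ≤ f l₀, C.symbol w m ≠ C.symbol w' m := by
    intro w w' h
    obtain ⟨l, hl⟩ := Function.ne_iff.1 h
    exact ⟨f l, hl₀ l, (C.symbol_apply_ne_iff w w' _).2 ⟨l, hf l, hl.symm⟩⟩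
  obtain ⟨w, w', hne, hw⟩ := C.exists_symbol_apply_ne_iff hM l₀
  have hz : ∀ m < f l₀, C.symbol w m = C.symbol w' m := fun m hm =>
    not_not.1 fun h => hlt l₀ m hm ((hw m).1 h)
  refine ⟨f l₀, ⟨⟨C.symbol w - C.symbol w', ⟨C.mem_differences w w', ?_⟩, ?_⟩, ?_⟩,
    ⟨⟨l₀, hlz l₀⟩, ?_⟩, hle, w, w', hne, hz⟩
  · exact sub_ne_zero.2 ((C.symbol_injective hM).ne hne.symm)
  · exact leadingZeros_eq (sub_ne_zero.2 ((hw _).2 (hf l₀))) fun m hm => sub_eq_zero.2 (hz m hm)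
  · rintro _ ⟨ψ, ⟨⟨_, ⟨v, rfl⟩, _, ⟨v', rfl⟩, rfl⟩, hψ⟩, rfl⟩
    obtain ⟨m, hm, hmne⟩ := hle v v' fun h => hψ (by rw [h, sub_self])
    exact (leadingZeros_le (v := C.symbol v - C.symbol v') (sub_ne_zero.2 hmne)).trans
      (Fin.le_def.1 hm)
  · rintro _ ⟨l, rfl⟩
    exact (hlz l).trans_le (Fin.le_def.1 (hl₀ l))

lemma power_pos (hL : 1 ≤ L) (hM : 2 ≤ M) : 0 < C.power := by
  obtain ⟨w, w', hne, -⟩ := C.exists_symbol_apply_ne_iff hM ⟨0, hL⟩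
  have hex : ∃ v, C.symbol v ≠ 0 := by
    by_contra! h
    exact hne (C.symbol_injective hM ((h w').trans (h w).symm))
  obtain ⟨v, hv⟩ := hex
  obtain ⟨m, hm⟩ := Function.ne_iff.1 hv
  have hM' : (0 : ℝ) < M := by exact_mod_cast (by omega : 0 < M)
  refine div_pos (Finset.sum_pos' (fun _ _ => Finset.sum_nonneg fun _ _ => by positivity)
    ⟨v, Finset.mem_univ _, ?_⟩) (by positivity)
  exact Finset.sum_pos' (fun _ _ => by positivity)
    ⟨m, Finset.mem_univ _, pow_pos (norm_pos_iff.2 hm) 2⟩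

end Code

end SLMIMO

theorem proposition1 (Nt Nr L M : ℕ) (hL : 1 ≤ L) (hM : 2 ≤ M)
    (C : SLMIMO.Code (min Nt Nr) L M)
    (svd : ∀ H : Matrix (Fin Nr) (Fin Nt) ℂ, SLMIMO.SVD H)
    (detect : Matrix (Fin Nr) (Fin Nt) ℂ → (Fin (min Nt Nr) → ℂ) → (Fin (min Nt Nr) → ℂ))
    (hdetect : SLMIMO.IsMLDetector C svd detect) :
    IsGreatest (SLMIMO.leadingZeros '' {ψ ∈ C.differences | ψ ≠ 0}) C.maxLeadingZeros ∧
    IsGreatest (Set.range fun l : Fin L => SLMIMO.leadingZeros fun m => C.slMatrix m l)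
      C.maxLeadingZeros ∧
    SLMIMO.HasDiversityGain
      (fun snr => SLMIMO.awep C svd detect (Real.toNNReal (C.power / snr)))
      (((Nr : ℝ) - C.maxLeadingZeros) * ((Nt : ℝ) - C.maxLeadingZeros)) := by
  obtain ⟨P, hdiff, hcol, hle, hex⟩ := C.exists_isGreatest_leadingZeros hL hM
  have hmax : C.maxLeadingZeros = P := hdiff.csSup_eq
  rw [hmax]
  refine ⟨hdiff, hcol, ?_⟩
  obtain ⟨ℓ, hℓ, hlim⟩ := SLMIMO.exists_tendsto_awep_div (by omega) hdetect
    (C.symbol_injective hM) P hle hex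
  have hr : (P : ℕ) < Nr := P.isLt.trans_le (min_le_right Nt Nr)
  have ht : (P : ℕ) < Nt := P.isLt.trans_le (min_le_left Nt Nr)
  -- Since `P` is an index below both antenna numbers, both factors of the exponent are positive and
  -- the natural subtractions agree with the real ones.
  have := SLMIMO.hasDiversityGain_of_tendsto
    (Nat.mul_pos (Nat.sub_pos_of_lt hr) (Nat.sub_pos_of_lt ht)) (C.power_pos hL hM) hℓ hlim
  rwa [Nat.cast_mul, Nat.cast_sub hr.le, Nat.cast_sub ht.le] at this
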